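/- **Setting.** Let $\mathcal S$ be a measurable space, $\mathcal A$ a finite non-empty set, $d,H,K\ge 1$. Consider an episodic linear MDP with stages $h\in[H]$: $\mathbb P_h(\cdot\mid s,a)=\langle\boldsymbol\phi(s,a),\boldsymbol\mu_h(\cdot)\rangle$ and $r_h(s,a)=\langle\boldsymbol\phi(s,a),\boldsymbol\theta_h\rangle\in[0,1]$, where $\boldsymbol\phi:\mathcal S\times\mathcal A\to\mathbb R^d$ is known and measurable in $s$, $\boldsymbol\mu_h$ is a $d$-tuple of signed measures on $\mathcal S$, $\|\boldsymbol\phi(s,a)\|_2\le1$, $\|\boldsymbol\theta_h\|_2\le W$, and $\|\boldsymbol\mu_h v\|_2\le\sqrt d$ for all measurable $v$ with $\|v\|_\infty\le1$ (here $\boldsymbol\mu V:=\int V\,d\boldsymbol\mu\in\mathbb R^d$). Write $\mathbb P_hV(s,a)=\mathbb E_{s'\sim\mathbb P_h(\cdot\mid s,a)}V(s')$, $[\mathbb V_hV]=\mathbb P_hV^2-(\mathbb P_hV)^2$, let $V_h^*=\sup_\pi V_h^\pi$ be the optimal value function (so $V^*_{H+1}=0$), $\|x\|_{M}=\sqrt{x^\top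 Mx}$ and $x_{[0,m]}=\max\{0,\min\{x,m\}\}$. **Algorithm (LSVI-UCB$^+$).** Let $\lambda\ge 1/(H^2\sqrt d)$ and $\delta\in(0,1)$. Start with $\widehat\Lambda_{1,h}=\widetilde\Lambda_{1,h}=\widehat\Lambda_{0,h}=\lambda I$, $\widehat{\boldsymbol\mu}_{1,h}=0$, $\widehat Q_{0,h}\equiv H$, $k_0=0$. In episode $k=1,\dots,K$, with $\widehat V_{k,H+1}=\widecheck V_{k,H+1}=0$ and $h=H,\dots,1$: if $\det\widehat\Lambda_{k,h'}\ge2\det\widehat\Lambda_{k_0,h'}$ for some $h'\in[H]$ (decided once per episode), then for all $h$ put $\widehat Q_{k,h}=\min\{r_h+\langle\widehat{\boldsymbol\mu}_{k,h}\widehat V_{k,h+1},\boldsymbol\phi\rangle+\widehat\beta\|\boldsymbol\phi\|_{\widehat\Lambda_{k,h}^{-1}},\widehat Q_{k-1,h},H\}$ and afterwards $k_0\leftarrow k$; otherwise $\widehat Q_{k,h}=\widehat Q_{k-1,h}$. Further $\widecheck Q_{k,h}=r_h+\langle\widehat{\boldsymbol\mu}_{k,h}\widecheck V_{k,h+1},\boldsymbol\phi\rangle-\widecheck\beta\|\boldsymbol\phi\|_{\widehat\Lambda_{k,h}^{-1}}$,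 $\widehat V_{k,h}=\max_a\widehat Q_{k,h}(\cdot,a)$, $\widecheck V_{k,h}=\max\{\max_a\widecheck Q_{k,h}(\cdot,a),0\}$. The initial state $s_1^k$ is chosen adversarially (possibly depending on the past), $a_h^k\in\arg\max_a\widehat Q_{k,h}(s_h^k,a)$, and given the state-action pairs up to stage $h$ of episode $k$, $s_{h+1}^k\sim\mathbb P_h(\cdot\mid s_h^k,a_h^k)$. Write $\boldsymbol\phi_h^k=\boldsymbol\phi(s_h^k,a_h^k)$ and $$[\widehat{\mathbb V}_{k,h}\widehat V_{k,h+1}](s_h^k,a_h^k)=\langle\widehat{\boldsymbol\mu}_{k,h}\widehat V_{k,h+1}^2,\boldsymbol\phi_h^k\rangle_{[0,H^2]}-\big(\langle\widehat{\boldsymbol\mu}_{k,h}\widehat V_{k,h+1},\boldsymbol\phi_h^k\rangle_{[0,H]}\big)^2,$$ $$U_{k,h}=\min\Big\{\widetilde\beta\|\boldsymbol\phi_h^k\|_{\widehat\Lambda_{k,h}^{-1}}+4H\big[|\langle\widehat{\boldsymbol\mu}_{k,h}(\widehat V_{k,h+1}-\widecheck V_{k,h+1}),\boldsymbol\phi_h^k\rangle|+(\bar\beta+\widecheck\beta)\|\boldsymbol\phi_h^k\|_{\widehat\Lambda_{k,h}^{-1}}\big],2H^2\Big\},$$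 $$E_{k,h}=\min\Big\{H\big[\langle\widehat{\boldsymbol\mu}_{k,h}\widehat V_{k,h+1},\boldsymbol\phi_h^k\rangle-\langle\widehat{\boldsymbol\mu}_{k,h}\widecheck V_{k,h+1},\boldsymbol\phi_h^k\rangle+(\bar\beta+\widecheck\beta)\|\boldsymbol\phi_h^k\|_{\widehat\Lambda_{k,h}^{-1}}+H\sqrt\lambda/K\big],H^2\Big\}.$$ The weights are $\widetilde\sigma_{k,h}^2=\max\{H,Hd^3E_{k,h},[\widehat{\mathbb V}_{k,h}\widehat V_{k,h+1}](s_h^k,a_h^k)+U_{k,h}\}$; $\varsigma_{k,h}=\sqrt H$ if $\|\widetilde\sigma_{k,h}^{-1}\boldsymbol\phi_h^k\|_{\widetilde\Lambda_{k,h}^{-1}}\le1/(H^3d^5)$ and $\varsigma_{k,h}=H^2\sqrt{d^5}$ otherwise; $\widehat\sigma_{k,h}^2=\max\{\varsigma_{k,h}^2,d^3HE_{k,h},[\widehat{\mathbb V}_{k,h}\widehat V_{k,h+1}](s_h^k,a_h^k)+U_{k,h}\}$. Finally $\widetilde\Lambda_{k+1,h}=\widetilde\Lambda_{k,h}+\widetilde\sigma_{k,h}^{-2}\boldsymbol\phi_h^k(\boldsymbol\phi_h^k)^\top$,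 $\widehat\Lambda_{k+1,h}=\widehat\Lambda_{k,h}+\widehat\sigma_{k,h}^{-2}\boldsymbol\phi_h^k(\boldsymbol\phi_h^k)^\top$, $\widehat{\boldsymbol\mu}_{k+1,h}=\widehat\Lambda_{k+1,h}^{-1}\sum_{i\le k}\widehat\sigma_{i,h}^{-2}\boldsymbol\phi_h^i\,\boldsymbol\delta(s_{h+1}^i)^\top$. **Radii.** With $J=dH\log(1+K)$, $L=W+K/\lambda$, $\Gamma=dJ\log(1+\frac{4KL}{H\sqrt\lambda})+d^2J\log(1+\frac{8K^2\widehat B^2\sqrt d}{H^2\lambda^2})$ and $\ell=\log(1+\frac{K}{Hd\lambda})$, set $$\begin{aligned} \bar\beta&=\sqrt H\sqrt{d\ell+\log\tfrac H\delta+\Gamma}+H\sqrt{\lambda d}+2,\\ \widetilde\beta&=\sqrt{H^3}\sqrt{d\ell+\log\tfrac H\delta+dJ\log(1+\tfrac{8KL}{\sqrt\lambda})+d^2J\log(1+\tfrac{32K^2\widehat B^2\sqrt d}{\lambda^2})}+H^2\sqrt{\lambda d}+2,\\ \widecheck\beta&=\sqrt H\sqrt{d\ell+\log\tfrac H\delta+d\log(1+\tfrac{4KL}{H\sqrt\lambda})+d^2\log(1+\tfrac{8K^2\widecheck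 B^2\sqrt d}{H^2\lambda^2})}+H\sqrt{\lambda d}+2,\\ \widehat\beta^{(1)}&=8\sqrt{d\,\ell\log\tfrac{4K^2H}{\delta}}+4\log\tfrac{4K^2H}{\delta}+H\sqrt{\lambda d},\\ \widehat\beta^{(2)}&=8\sqrt{\tfrac{2}{Hd^2}\ell\,\big[\log\tfrac{4K^2H}{\delta}+\Gamma\big]}+\tfrac{4}{H\sqrt{d^5}}\big[\log\tfrac{4K^2H}{\delta}+\Gamma\big]+H\sqrt{\lambda d}+2, \end{aligned}$$ and $\widehat\beta=\widehat\beta^{(1)}+\widehat\beta^{(2)}$, where $\widehat B,\widecheck B$ are any constants with $\widehat\beta\le\widehat B$ and $\widecheck\beta\le\widecheck B$. **Statement.** (a) There is an absolute constant $C>0$ such that for $\lambda=1/(H^2\sqrt d)$ and all $d,H,K\ge1$, $W\ge0$, $\delta\in(0,1)$: $\widehat\beta\le C\sqrt d\,\log^2\!\big(3+dHK(1+W)(1+\widehat B)/\delta\big)$ for every $\widehat B\ge0$, and $\widehat B$ can be chosen with $\widehat\beta\le\widehat B\le C\sqrt d\,\log^2\!\big(3+dHK(1+W)/\delta\big)$;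 thus $\widehat\beta=\widetilde O(\sqrt d)$. (b) With probability at least $1-7\delta$, simultaneously for all $k\in[K]$, $h\in[H]$, $$\boldsymbol\mu_h\in\widehat{\mathcal C}_{k,h}\cap\widecheck{\mathcal C}_{k,h}\cap\widehat{\mathcal C}^{(1)}_{k,h}\cap\widehat{\mathcal C}^{(2)}_{k,h}\cap\bar{\mathcal C}_{k,h}\cap\widetilde{\mathcal C}_{k,h},$$ where these are the sets of all $\boldsymbol\mu$ with $\|(\boldsymbol\mu-\widehat{\boldsymbol\mu}_{k,h})V\|_{\widehat\Lambda_{k,h}}\le\beta$ for $(V,\beta)$ equal to $(\widehat V_{k,h+1},\widehat\beta)$, $(\widecheck V_{k,h+1},\widecheck\beta)$, $(V_{h+1}^*,\widehat\beta^{(1)})$, $(\widehat V_{k,h+1}-V_{h+1}^*,\widehat\beta^{(2)})$, $(\widehat V_{k,h+1},\bar\beta)$, $(\widehat V_{k,h+1}^2,\widetilde\beta)$, respectively; and on the same event, for all $k,h$, $$\big|[\widehat{\mathbb V}_{k,h}\widehat V_{k,h+1}](s_h^k,a_h^k)-[\mathbb V_hV_{h+1}^*](s_h^k,a_h^k)\big|\le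 U_{k,h},\qquad[\mathbb V_h(\widehat V_{k,h+1}-V_{h+1}^*)](s_h^k,a_h^k)\le E_{k,h},$$ and, more generally, $[\mathbb V_h(V-V_{h+1}^*)](s_h^k,a_h^k)\le E_{k,h}$ for every measurable $V:\mathcal S\to[0,H]$ with $V_{h+1}^*-\zeta\le V\le\widehat V_{k,h+1}+\zeta$, where $\zeta=H\sqrt\lambda/K$. -/

import Mathlib

open MeasureTheory ProbabilityTheory

noncomputable section

namespace LinMDP

/-! ### Linear algebra and integration -/

/-- `‖x‖_M = √(xᵀ M x)`. -/
def wnorm {d : ℕ} (M : Matrix (Fin d) (Fin d) ℝ) (x : Fin d → ℝ) : ℝ :=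
  Real.sqrt (x ⬝ᵥ M.mulVec x)

/-- The Euclidean norm of a coordinate vector. -/
def enorm2 {d : ℕ} (x : Fin d → ℝ) : ℝ := ‖WithLp.toLp 2 x‖

/-- The vector `μ V ∈ ℝ^d`, for a `d`-tuple `μ` of signed measures on `S` and `V : S → ℝ`:
its `i`-th coordinate is `∫ V dμ_i`. -/
def muApply {S : Type*} [MeasurableSpace S] {d : ℕ} (μ : Fin d → SignedMeasure S) (V : S → ℝ) :
    Fin d → ℝ :=
  fun i => ∫ᵛ s, V s ∂•(μ i)

/-- The truncation `x_{[0, M]}`. -/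
def clip (M x : ℝ) : ℝ := max 0 (min x M)

/-! ### Linear Markov decision processes

Stages are numbered `0, …, H - 1` and episodes `0, …, K - 1`; value functions vanish at stage `H`. -/

/-- An episodic linear MDP with horizon `H`, feature map `phi` into `ℝ^d`, signed measures `mu h`
and reward parameters `theta h`, subject to the standard normalization. -/
structure LinearMDP (S A : Type*) [MeasurableSpace S] (d H : ℕ) (W : ℝ) where
  phi : S → A → Fin d → ℝ
  mu : ℕ → Fin d → SignedMeasure S
  theta : ℕ → Fin d → ℝ
  trans : ℕ → S → A → Measure S
  phi_measurable : ∀ a, Measurable fun s => phi s a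
  trans_prob : ∀ h < H, ∀ s a, IsProbabilityMeasure (trans h s a)
  trans_eq : ∀ h < H, ∀ s a, ∀ B, MeasurableSet B →
    (trans h s a).real B = ∑ i, phi s a i * mu h i B
  phi_norm : ∀ s a, enorm2 (phi s a) ≤ 1
  mu_norm : ∀ h < H, ∀ v : S → ℝ, Measurable v → (∀ s, |v s| ≤ 1) →
    enorm2 (muApply (mu h) v) ≤ Real.sqrt d
  theta_norm : ∀ h < H, enorm2 (theta h) ≤ W
  reward_mem : ∀ h < H, ∀ s a, theta h ⬝ᵥ phi s a ∈ Set.Icc (0 : ℝ) 1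

namespace LinearMDP

variable {S A : Type*} [MeasurableSpace S] {d H : ℕ} {W : ℝ}

/-- The reward `r_h(s,a) = ⟨φ(s,a), θ_h⟩`. -/
def reward (M : LinearMDP S A d H W) (h : ℕ) (s : S) (a : A) : ℝ := M.theta h ⬝ᵥ M.phi s a

/-- `[ℙ_h V](s,a)`. -/
def expect (M : LinearMDP S A d H W) (h : ℕ) (V : S → ℝ) (s : S) (a : A) : ℝ :=
  ∫ s', V s' ∂(M.trans h s a)

/-- `[𝕍_h V](s,a) = ℙ_h V² (s,a) - [ℙ_h V (s,a)]²`. -/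
def var (M : LinearMDP S A d H W) (h : ℕ) (V : S → ℝ) (s : S) (a : A) : ℝ :=
  M.expect h (fun s' => V s' ^ 2) s a - M.expect h V s a ^ 2

/-- Expected cumulative reward of the policy `π` over the last `n` stages. -/
def polToGo (M : LinearMDP S A d H W) (π : ℕ → S → A) : ℕ → S → ℝ
  | 0 => fun _ => 0
  | n + 1 => fun s =>
      M.reward (H - (n + 1)) s (π (H - (n + 1)) s) +
        M.expect (H - (n + 1)) (polToGo M π n) s (π (H - (n + 1)) s)

/-- The value function `V_h^π`. -/
def vPol (M : LinearMDP S A d H W) (π : ℕ → S → A) (h : ℕ) : S → ℝ := M.polToGo π (H - h)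

/-- The optimal value function `V_h^* = sup_π V_h^π`, over measurable policies. -/
def vStar [MeasurableSpace A] (M : LinearMDP S A d H W) (h : ℕ) (s : S) : ℝ :=
  ⨆ π : {π : ℕ → S → A // ∀ h', Measurable (π h')}, M.vPol π.1 h s

end LinearMDP

/-! ### The confidence radii -/

/-- `J = d H log(1 + K)`. -/
def numJ (d H K : ℕ) : ℝ := d * H * Real.log (1 + K)

/-- `L = W + K / λ`. -/
def bigL (K : ℕ) (lam W : ℝ) : ℝ := W + K / lam

/-- The covering term
`d J log(1 + 4KL/(H√λ)) + d² J log(1 + 8K²B²√d/(H²λ²))`. -/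
def coverTerm (d H K : ℕ) (lam W B : ℝ) : ℝ :=
  d * numJ d H K * Real.log (1 + 4 * K * bigL K lam W / (H * Real.sqrt lam)) +
    d ^ 2 * numJ d H K * Real.log (1 + 8 * K ^ 2 * B ^ 2 * Real.sqrt d / (H ^ 2 * lam ^ 2))

/-- The radius `β̄`. -/
def betaBar (d H K : ℕ) (lam W δ B : ℝ) : ℝ :=
  Real.sqrt H * Real.sqrt (d * Real.log (1 + K / (H * d * lam)) + Real.log (H / δ) +
      coverTerm d H K lam W B) + H * Real.sqrt (lam * d) + 2

/-- The radius `β̃`. -/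
def betaTil (d H K : ℕ) (lam W δ B : ℝ) : ℝ :=
  Real.sqrt (H ^ 3) * Real.sqrt (d * Real.log (1 + K / (H * d * lam)) + Real.log (H / δ) +
      d * numJ d H K * Real.log (1 + 8 * K * bigL K lam W / Real.sqrt lam) +
      d ^ 2 * numJ d H K * Real.log (1 + 32 * K ^ 2 * B ^ 2 * Real.sqrt d / lam ^ 2)) +
    H ^ 2 * Real.sqrt (lam * d) + 2

/-- The radius `β̌`, as a function of the constant `B̌`. -/
def betaChk (d H K : ℕ) (lam W δ B : ℝ) : ℝ :=
  Real.sqrt H * Real.sqrt (d * Real.log (1 + K / (H * d * lam)) + Real.log (H / δ) +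
      d * Real.log (1 + 4 * K * bigL K lam W / (H * Real.sqrt lam)) +
      d ^ 2 * Real.log (1 + 8 * K ^ 2 * B ^ 2 * Real.sqrt d / (H ^ 2 * lam ^ 2))) +
    H * Real.sqrt (lam * d) + 2

/-- The radius `β̂⁽¹⁾`. -/
def betaOne (d H K : ℕ) (lam δ : ℝ) : ℝ :=
  8 * Real.sqrt (d * Real.log (1 + K / (H * d * lam)) * Real.log (4 * K ^ 2 * H / δ)) +
    4 * Real.log (4 * K ^ 2 * H / δ) + H * Real.sqrt (lam * d)

/-- The radius `β̂⁽²⁾`, as a function of the constant `B̂`. -/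
def betaTwo (d H K : ℕ) (lam W δ B : ℝ) : ℝ :=
  8 * Real.sqrt (2 / (H * d ^ 2) * Real.log (1 + K / (H * d * lam)) *
      (Real.log (4 * K ^ 2 * H / δ) + coverTerm d H K lam W B)) +
    4 / (H * Real.sqrt (d ^ 5)) * (Real.log (4 * K ^ 2 * H / δ) + coverTerm d H K lam W B) +
    H * Real.sqrt (lam * d) + 2

/-- The exploration radius `β̂ = β̂⁽¹⁾ + β̂⁽²⁾`, as a function of the constant `B̂`. -/
def betaHat (d H K : ℕ) (lam W δ B : ℝ) : ℝ :=
  betaOne d H K lam δ + betaTwo d H K lam W δ B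

/-! ### The algorithm LSVI-UCB⁺ -/

/-- The inputs of the algorithm: the number of stages and of episodes, the features, the rewards,
the regularization parameter and the radii. -/
structure Config (S A : Type*) (d : ℕ) where
  H : ℕ
  K : ℕ
  phi : S → A → Fin d → ℝ
  reward : ℕ → S → A → ℝ
  lam : ℝ
  bHat : ℝ
  bBar : ℝ
  bTil : ℝ
  bChk : ℝ

/-- What the learner knows at the start of an episode `k`: the matrices `Λ̂_{k,h}` and `Λ̃_{k,h}`,
the measures `∑_{i<k} σ̂_{i,h}⁻² φ(s_h^i,a_h^i) δ(s_{h+1}^i)ᵀ`, the matrices `Λ̂_{k₀,h}` of the last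
updating episode `k₀`, and the optimistic functions `Q̂_{k-1,h}` of the previous episode. -/
structure State (S A : Type*) [MeasurableSpace S] (d : ℕ) where
  lamHat : ℕ → Matrix (Fin d) (Fin d) ℝ
  lamTil : ℕ → Matrix (Fin d) (Fin d) ℝ
  resp : ℕ → Fin d → SignedMeasure S
  lamLast : ℕ → Matrix (Fin d) (Fin d) ℝ
  qPrev : ℕ → S → A → ℝ

section Algorithm

variable {S A : Type*} [MeasurableSpace S] {d : ℕ}

/-- The state before the first episode. -/
def Config.init (c : Config S A d) : State S A d where
  lamHat := fun _ => c.lam • 1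
  lamTil := fun _ => c.lam • 1
  resp := fun _ => 0
  lamLast := fun _ => c.lam • 1
  qPrev := fun _ _ _ => c.H

namespace State

variable (st : State S A d) (c : Config S A d)

/-- The estimator `μ̂_{k,h} = Λ̂_{k,h}⁻¹ ∑_{i<k} σ̂_{i,h}⁻² φ(s_h^i,a_h^i) δ(s_{h+1}^i)ᵀ`. -/
def muHat (h : ℕ) : Fin d → SignedMeasure S :=
  fun i => ∑ j, (st.lamHat h)⁻¹ i j • st.resp h j

/-- `[ℙ̂_{k,h} V](s,a) = ⟨μ̂_{k,h} V, φ(s,a)⟩`. -/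
def pHat (h : ℕ) (V : S → ℝ) (s : S) (a : A) : ℝ :=
  muApply (st.muHat h) V ⬝ᵥ c.phi s a

/-- `‖φ(s,a)‖` in the norm of `Λ̂_{k,h}⁻¹`. -/
def width (h : ℕ) (s : S) (a : A) : ℝ := wnorm (st.lamHat h)⁻¹ (c.phi s a)

/-- The condition under which the optimistic value functions are updated in this episode. -/
def Updates : Prop := ∃ h < c.H, 2 * (st.lamLast h).det ≤ (st.lamHat h).det

open Classical in
/-- `Q̂_{k,h}`, given `V = V̂_{k,h+1}`. -/
def qHatOf (h : ℕ) (V : S → ℝ) (s : S) (a : A) : ℝ :=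
  if st.Updates c then
    min (min (c.reward h s a + st.pHat c h V s a + c.bHat * st.width c h s a) (st.qPrev h s a)) c.H
  else st.qPrev h s a

/-- `Q̌_{k,h}`, given `V = V̌_{k,h+1}`. -/
def qChkOf (h : ℕ) (V : S → ℝ) (s : S) (a : A) : ℝ :=
  c.reward h s a + st.pHat c h V s a - c.bChk * st.width c h s a

variable [Fintype A] [Nonempty A]

/-- `V̂_{k,h}` with `n = H - h` stages to go. -/
def vHatToGo : ℕ → S → ℝ
  | 0 => fun _ => 0
  | n + 1 => fun s => Finset.univ.sup' Finset.univ_nonempty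
      fun a => st.qHatOf c (c.H - (n + 1)) (vHatToGo n) s a

/-- `V̌_{k,h}` with `n = H - h` stages to go. -/
def vChkToGo : ℕ → S → ℝ
  | 0 => fun _ => 0
  | n + 1 => fun s => max (Finset.univ.sup' Finset.univ_nonempty
      fun a => st.qChkOf c (c.H - (n + 1)) (vChkToGo n) s a) 0

/-- The optimistic value function `V̂_{k,h}`. -/
def vHat (h : ℕ) : S → ℝ := st.vHatToGo c (c.H - h)

/-- The pessimistic value function `V̌_{k,h}`. -/
def vChk (h : ℕ) : S → ℝ := st.vChkToGo c (c.H - h)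

/-- The optimistic function `Q̂_{k,h}`. -/
def qHat (h : ℕ) (s : S) (a : A) : ℝ := st.qHatOf c h (st.vHat c (h + 1)) s a

/-- The estimated variance `[𝕍̂_{k,h} V̂_{k,h+1}](s,a)`. -/
def varHat (h : ℕ) (s : S) (a : A) : ℝ :=
  clip ((c.H : ℝ) ^ 2) (st.pHat c h (fun s' => st.vHat c (h + 1) s' ^ 2) s a) -
    clip (c.H : ℝ) (st.pHat c h (st.vHat c (h + 1)) s a) ^ 2

/-- The offset `U_{k,h}` at `(s,a) = (s_h^k, a_h^k)`. -/
def offU (h : ℕ) (s : S) (a : A) : ℝ :=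
  min (c.bTil * st.width c h s a +
      4 * c.H * (|st.pHat c h (fun s' => st.vHat c (h + 1) s' - st.vChk c (h + 1) s') s a| +
        c.bBar * st.width c h s a + c.bChk * st.width c h s a))
    (2 * (c.H : ℝ) ^ 2)

/-- The bound `E_{k,h}` at `(s,a) = (s_h^k, a_h^k)`. -/
def offE (h : ℕ) (s : S) (a : A) : ℝ :=
  min (c.H * (st.pHat c h (st.vHat c (h + 1)) s a - st.pHat c h (st.vChk c (h + 1)) s a +
      c.bBar * st.width c h s a + c.bChk * st.width c h s a + c.H * Real.sqrt c.lam / c.K))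
    ((c.H : ℝ) ^ 2)

/-- The weight `σ̃_{k,h}` at `(s,a) = (s_h^k, a_h^k)`. -/
def sigTil (h : ℕ) (s : S) (a : A) : ℝ :=
  Real.sqrt (max (max (c.H : ℝ) (c.H * d ^ 3 * st.offE c h s a))
    (st.varHat c h s a + st.offU c h s a))

open Classical in
/-- The lower bound `ς_{k,h}` at `(s,a) = (s_h^k, a_h^k)`. -/
def sigMin (h : ℕ) (s : S) (a : A) : ℝ :=
  if wnorm (st.lamTil h)⁻¹ ((st.sigTil c h s a)⁻¹ • c.phi s a) ≤ 1 / ((c.H : ℝ) ^ 3 * d ^ 5) then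
    Real.sqrt c.H
  else (c.H : ℝ) ^ 2 * Real.sqrt ((d : ℝ) ^ 5)

/-- The weight `σ̂_{k,h}` at `(s,a) = (s_h^k, a_h^k)`. -/
def sigHat (h : ℕ) (s : S) (a : A) : ℝ :=
  Real.sqrt (max (max (st.sigMin c h s a ^ 2) (d ^ 3 * c.H * st.offE c h s a))
    (st.varHat c h s a + st.offU c h s a))

open Classical in
/-- The state at the end of an episode with states `s h` and actions `a h`. -/
def next (s : ℕ → S) (a : ℕ → A) : State S A d where
  lamHat := fun h => st.lamHat h + (st.sigHat c h (s h) (a h) ^ 2)⁻¹ •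
    Matrix.vecMulVec (c.phi (s h) (a h)) (c.phi (s h) (a h))
  lamTil := fun h => st.lamTil h + (st.sigTil c h (s h) (a h) ^ 2)⁻¹ •
    Matrix.vecMulVec (c.phi (s h) (a h)) (c.phi (s h) (a h))
  resp := fun h j => st.resp h j + VectorMeasure.dirac (s (h + 1))
    ((st.sigHat c h (s h) (a h) ^ 2)⁻¹ * c.phi (s h) (a h) j)
  lamLast := if st.Updates c then st.lamHat else st.lamLast
  qPrev := st.qHat c

/-- The set of all `μ` with `‖(μ - μ̂_{k,h}) V‖ ≤ β` in the norm of `Λ̂_{k,h}`. -/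
def confSet (h : ℕ) (V : S → ℝ) (β : ℝ) : Set (Fin d → SignedMeasure S) :=
  {μ | wnorm (st.lamHat h) (muApply (μ - st.muHat h) V) ≤ β}

end State

variable [Fintype A] [Nonempty A]

/-- The learner's state at the start of episode `k`, when `s i h` and `a i h` are the state and the
action at stage `h` of episode `i`. -/
def Config.run (c : Config S A d) (s : ℕ → ℕ → S) (a : ℕ → ℕ → A) : ℕ → State S A d
  | 0 => c.init
  | k + 1 => (c.run s a k).next c (s k) (a k)

/-- The algorithm for the linear MDP `M`, run with the radii above; `B̂` and `B̌` are the constants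
that enter them. -/
def LinearMDP.config {H : ℕ} {W : ℝ} (M : LinearMDP S A d H W) (K : ℕ) (lam δ Bhat Bchk : ℝ) :
    Config S A d where
  H := H
  K := K
  phi := M.phi
  reward := M.reward
  lam := lam
  bHat := betaHat d H K lam W δ Bhat
  bBar := betaBar d H K lam W δ Bhat
  bTil := betaTil d H K lam W δ Bhat
  bChk := betaChk d H K lam W δ Bchk

end Algorithm

/-! ### The interaction of the algorithm with the MDP -/

section Interaction

variable {S A Ω : Type*} [MeasurableSpace S] [MeasurableSpace A]

/-- `𝓕_{k,h}`: the `σ`-algebra generated by the state-action pairs up to and including stage `h` of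
episode `k`, where an episode has `H` stages. -/
@[reducible] def history (H : ℕ) (s : ℕ → ℕ → Ω → S) (a : ℕ → ℕ → Ω → A) (k h : ℕ) : MeasurableSpace Ω :=
  ⨆ (j : ℕ) (l : ℕ) (_ : l < H ∧ (j < k ∨ (j = k ∧ l ≤ h))),
    MeasurableSpace.comap (fun ω => (s j l ω, a j l ω)) inferInstance

/-- `s k h` and `a k h` are the states and actions that arise when the algorithm `c` interacts for
`c.K` episodes with the MDP `M`: actions are greedy for `Q̂_{k,h}` (ties broken arbitrarily), and the
next state has the law `ℙ_h(· | s_h^k, a_h^k)` given the history. The initial states `s k 0` are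
arbitrary: an adversary may choose them depending on the past. -/
structure IsInteraction [MeasurableSpace Ω] [Fintype A] [Nonempty A] {d H : ℕ} {W : ℝ}
    (M : LinearMDP S A d H W) (c : Config S A d) (P : Measure Ω)
    (s : ℕ → ℕ → Ω → S) (a : ℕ → ℕ → Ω → A) : Prop where
  measurable_state : ∀ k h, Measurable (s k h)
  measurable_action : ∀ k h, Measurable (a k h)
  greedy : ∀ k < c.K, ∀ h < H, ∀ᵐ ω ∂P, ∀ b : A,
    (c.run (fun i l => s i l ω) (fun i l => a i l ω) k).qHat c h (s k h ω) b ≤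
      (c.run (fun i l => s i l ω) (fun i l => a i l ω) k).qHat c h (s k h ω) (a k h ω)
  transition : ∀ k < c.K, ∀ h < H, ∀ B, MeasurableSet B →
    P⟦s k (h + 1) ⁻¹' B | history H s a k h⟧ =ᵐ[P]
      fun ω => (M.trans h (s k h ω) (a k h ω)).real B

end Interaction

end LinMDP

end

/-!
The proof separates a probabilistic part, which bounds the noise along the trajectory for fixed test
functions, from a deterministic induction on the run of the algorithm.

For a fixed function `V` the error of the weighted ridge regression in the norm of `Λ̂` is a bias of
at most `‖V‖ √(λ d)` plus a self-normalized sum of martingale differences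
(`wnorm_mu_sub_muHat_le`). Such sums obey a Hoeffding inequality (`IsDraw.hoeffding`), obtained by
the method of mixtures, and a Bernstein inequality (`IsDraw.bernstein`); both follow from Ville's
maximal inequality. The Bernstein inequality needs the bound `1 / (H √(d⁵))` on the range of the
weighted noise (`noise_range_le`), and this is what the threshold in the definition of `ς` provides:
either the weight is at least `H² √(d⁵)`, or the feature has small width.

The functions `V̂` and `V̌` depend on the data, so they are replaced by elements of finite nets
(`exists_net_vHat`, `exists_net_vChk`). An optimistic function is a minimum over the episodes in
which an update occurred, of functions with `O(d²)` parameters each. There are at most `2J` such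
episodes (`card_updSet_le`), because each update doubles a determinant. The logarithm in `J` is free
of `H`: for `K ≤ H³` the features of small width hardly change the determinant and all other weights
are large, while for `K > H³` powers of `H` are absorbed by `K`. The union bound over nets, stages
and kinds of functions gives an event of probability at least `1 - 5δ`
(`IsInteraction.exists_good_event`).

On this event the induction of `inConf_of_noiseBounds` runs over the episodes and, within an episode,
backwards over the stages. If `V̌ ≤ V* ≤ V̂` at stage `h + 1`, and the variance bounds hold in all
earlier episodes, then the weights dominate the true variances, so the noise bounds apply and `μ_h`
lies in all confidence sets (`inConf_step`). These in turn give the enclosure at stage `h`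
(`enclosed_step`) and the variance bounds in the current episode (`varBounds`). The condition on the
variance of `V̂_{k,h+1} - V*` at the points visited in earlier episodes `i < k` holds because
`V̂_{k,h+1} ≤ V̂_{i,h+1}`; this is why the bound `E` is required for all functions between
`V* - ζ` and `V̂ + ζ`, and not only for `V̂` itself.

For the size of the radius, all logarithms in `β̂` are bounded by multiples of
`log (3 + dHK(1 + W)(1 + B)/δ)` (`betaHat_le`). As `B̂` enters only
through a logarithm, a large multiple of `√d log²` is an admissible choice (`exists_betaHat_le`).
-/

noncomputable section

namespace LinMDP

open Matrix

/-! ### Weighted norms and rank-one updates -/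

section LinearAlgebra

variable {d : ℕ}

lemma enorm2_sq (x : Fin d → ℝ) : enorm2 x ^ 2 = x ⬝ᵥ x := by
  rw [enorm2, EuclideanSpace.norm_sq_eq]
  simp [dotProduct, sq]

lemma enorm2_nonneg (x : Fin d → ℝ) : 0 ≤ enorm2 x := norm_nonneg _

lemma enorm2_add_le (x y : Fin d → ℝ) : enorm2 (x + y) ≤ enorm2 x + enorm2 y := by
  simpa [enorm2] using norm_add_le (WithLp.toLp 2 x) (WithLp.toLp 2 y)

lemma enorm2_smul (c : ℝ) (x : Fin d → ℝ) : enorm2 (c • x) = |c| * enorm2 x := by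
  simp [enorm2, norm_smul]

lemma dotProduct_le_enorm2 (x y : Fin d → ℝ) : |x ⬝ᵥ y| ≤ enorm2 x * enorm2 y := by
  have := abs_real_inner_le_norm (WithLp.toLp 2 x) (WithLp.toLp 2 y)
  simpa [enorm2, EuclideanSpace.inner_eq_star_dotProduct, dotProduct_comm] using this

lemma wnorm_nonneg (M : Matrix (Fin d) (Fin d) ℝ) (x : Fin d → ℝ) : 0 ≤ wnorm M x :=
  Real.sqrt_nonneg _

lemma quad_nonneg {M : Matrix (Fin d) (Fin d) ℝ} (hM : M.PosSemidef) (x : Fin d → ℝ) :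
    0 ≤ x ⬝ᵥ M *ᵥ x := by
  simpa using hM.dotProduct_mulVec_nonneg x

lemma wnorm_sq {M : Matrix (Fin d) (Fin d) ℝ} (hM : M.PosSemidef) (x : Fin d → ℝ) :
    wnorm M x ^ 2 = x ⬝ᵥ M *ᵥ x :=
  Real.sq_sqrt (quad_nonneg hM x)

lemma symm_dotProduct {M : Matrix (Fin d) (Fin d) ℝ} (hM : M.IsHermitian) (x y : Fin d → ℝ) :
    x ⬝ᵥ M *ᵥ y = y ⬝ᵥ M *ᵥ x := by
  have h : Mᵀ = M := by simpa [IsHermitian, conjTranspose_eq_transpose_of_trivial] using hM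
  rw [dotProduct_mulVec, ← mulVec_transpose, h, dotProduct_comm]

lemma wnorm_zero (M : Matrix (Fin d) (Fin d) ℝ) : wnorm M 0 = 0 := by simp [wnorm]

lemma wnorm_smul (M : Matrix (Fin d) (Fin d) ℝ) (c : ℝ) (x : Fin d → ℝ) :
    wnorm M (c • x) = |c| * wnorm M x := by
  unfold wnorm
  rw [mulVec_smul, smul_dotProduct, dotProduct_smul, smul_eq_mul, smul_eq_mul, ← mul_assoc,
    Real.sqrt_mul (mul_self_nonneg c), Real.sqrt_mul_self_eq_abs]

lemma wnorm_neg (M : Matrix (Fin d) (Fin d) ℝ) (x : Fin d → ℝ) : wnorm M (-x) = wnorm M x := by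
  simp [wnorm, mulVec_neg]

lemma abs_bilin_le {M : Matrix (Fin d) (Fin d) ℝ} (hM : M.PosSemidef) (x y : Fin d → ℝ) :
    |x ⬝ᵥ M *ᵥ y| ≤ wnorm M x * wnorm M y := by
  have key : ∀ t : ℝ, 0 ≤ (y ⬝ᵥ M *ᵥ y) * (t * t) + (2 * (x ⬝ᵥ M *ᵥ y)) * t + x ⬝ᵥ M *ᵥ x := by
    intro t
    have h := quad_nonneg hM (x + t • y)
    rw [mulVec_add, mulVec_smul, add_dotProduct, dotProduct_add, dotProduct_add, smul_dotProduct,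
      smul_dotProduct, dotProduct_smul, dotProduct_smul, symm_dotProduct hM.1 y x] at h
    simp only [smul_eq_mul] at h
    linarith
  have hd := discrim_le_zero key
  rw [discrim] at hd
  apply abs_le_of_sq_le_sq _ (mul_nonneg (wnorm_nonneg _ _) (wnorm_nonneg _ _))
  rw [mul_pow, wnorm_sq hM, wnorm_sq hM]
  linarith

lemma wnorm_add_le {M : Matrix (Fin d) (Fin d) ℝ} (hM : M.PosSemidef) (x y : Fin d → ℝ) :
    wnorm M (x + y) ≤ wnorm M x + wnorm M y := by
  apply le_of_sq_le_sq _ (add_nonneg (wnorm_nonneg _ _) (wnorm_nonneg _ _))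
  have h := (le_abs_self _).trans (abs_bilin_le hM x y)
  rw [add_sq, wnorm_sq hM, wnorm_sq hM, wnorm_sq hM, mulVec_add, add_dotProduct, dotProduct_add,
    dotProduct_add, symm_dotProduct hM.1 y x]
  linarith

lemma wnorm_sum_le {ι : Type*} {M : Matrix (Fin d) (Fin d) ℝ} (hM : M.PosSemidef) (s : Finset ι)
    (f : ι → Fin d → ℝ) : wnorm M (∑ i ∈ s, f i) ≤ ∑ i ∈ s, wnorm M (f i) := by
  classical
  induction s using Finset.induction_on with
  | empty => simp [wnorm_zero]
  | insert i s hi ih =>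
    rw [Finset.sum_insert hi, Finset.sum_insert hi]
    exact (wnorm_add_le hM _ _).trans (by linarith)

lemma mulVec_inv_mulVec {M : Matrix (Fin d) (Fin d) ℝ} (hM : M.PosDef) (x : Fin d → ℝ) :
    M *ᵥ M⁻¹ *ᵥ x = x := by
  rw [mulVec_mulVec, mul_nonsing_inv _ ((isUnit_iff_isUnit_det _).mp hM.isUnit), one_mulVec]

lemma inv_mulVec_mulVec {M : Matrix (Fin d) (Fin d) ℝ} (hM : M.PosDef) (x : Fin d → ℝ) :
    M⁻¹ *ᵥ M *ᵥ x = x := by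
  rw [mulVec_mulVec, nonsing_inv_mul _ ((isUnit_iff_isUnit_det _).mp hM.isUnit), one_mulVec]

lemma wnorm_inv_mulVec {M : Matrix (Fin d) (Fin d) ℝ} (hM : M.PosDef) (v : Fin d → ℝ) :
    wnorm M (M⁻¹ *ᵥ v) = wnorm M⁻¹ v := by
  unfold wnorm
  rw [mulVec_inv_mulVec hM, dotProduct_comm]

lemma abs_dotProduct_le {M : Matrix (Fin d) (Fin d) ℝ} (hM : M.PosDef) (x y : Fin d → ℝ) :
    |x ⬝ᵥ y| ≤ wnorm M x * wnorm M⁻¹ y := by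
  have h := abs_bilin_le hM.posSemidef x (M⁻¹ *ᵥ y)
  rwa [mulVec_inv_mulVec hM, wnorm_inv_mulVec hM] at h

/-- Inversion is antitone: if `A ≤ c B` as quadratic forms, then `B⁻¹ ≤ c A⁻¹`. -/
lemma wnorm_inv_le_of_quad_le {A B : Matrix (Fin d) (Fin d) ℝ} (hA : A.PosDef) (hB : B.PosDef)
    {c : ℝ} (hc : 0 ≤ c) (h : ∀ x : Fin d → ℝ, x ⬝ᵥ A *ᵥ x ≤ c * (x ⬝ᵥ B *ᵥ x)) (v : Fin d → ℝ) :
    wnorm B⁻¹ v ≤ Real.sqrt c * wnorm A⁻¹ v := by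
  rcases (wnorm_nonneg B⁻¹ v).eq_or_lt with h0 | h0
  · rw [← h0]
    exact mul_nonneg (Real.sqrt_nonneg _) (wnorm_nonneg _ _)
  have h1 := (le_abs_self _).trans (abs_dotProduct_le hA (B⁻¹ *ᵥ v) v)
  rw [dotProduct_comm, ← wnorm_sq hB.inv.posSemidef] at h1
  have h2 : wnorm A (B⁻¹ *ᵥ v) ≤ Real.sqrt c * wnorm B⁻¹ v := by
    rw [← wnorm_inv_mulVec hB, wnorm, wnorm, ← Real.sqrt_mul hc]
    exact Real.sqrt_le_sqrt (h _)
  have h3 : wnorm B⁻¹ v * wnorm B⁻¹ v ≤ (Real.sqrt c * wnorm A⁻¹ v) * wnorm B⁻¹ v := by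
    calc _ = wnorm B⁻¹ v ^ 2 := by ring
      _ ≤ _ := h1
      _ ≤ (Real.sqrt c * wnorm B⁻¹ v) * wnorm A⁻¹ v :=
        mul_le_mul_of_nonneg_right h2 (wnorm_nonneg _ _)
      _ = _ := by ring
  exact le_of_mul_le_mul_right h3 h0

lemma posSemidef_vecMulVec (x : Fin d → ℝ) : (vecMulVec x x).PosSemidef := by
  simpa using posSemidef_vecMulVec_self_star x

lemma posDef_add_vecMulVec {M : Matrix (Fin d) (Fin d) ℝ} (hM : M.PosDef) (x : Fin d → ℝ) :
    (M + vecMulVec x x).PosDef := hM.add_posSemidef (posSemidef_vecMulVec x)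

/-- The matrix determinant lemma. -/
lemma det_add_vecMulVec {M : Matrix (Fin d) (Fin d) ℝ} (hM : M.PosDef) (x : Fin d → ℝ) :
    (M + vecMulVec x x).det = M.det * (1 + wnorm M⁻¹ x ^ 2) := by
  rw [vecMulVec_eq Unit, det_add_replicateCol_mul_replicateRow
    ((isUnit_iff_isUnit_det _).mp hM.isUnit), wnorm_sq hM.inv.posSemidef]
  congr 1
  simp only [det_unique, Matrix.add_apply, one_apply_eq]
  rw [Matrix.mul_assoc, mul_apply]
  congr 1

/-- The Sherman–Morrison formula, applied to a vector. -/
lemma inv_add_vecMulVec_mulVec {M : Matrix (Fin d) (Fin d) ℝ} (hM : M.PosDef) (x v : Fin d → ℝ) :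
    (M + vecMulVec x x)⁻¹ *ᵥ v =
      M⁻¹ *ᵥ v - ((x ⬝ᵥ M⁻¹ *ᵥ v) / (1 + wnorm M⁻¹ x ^ 2)) • M⁻¹ *ᵥ x := by
  have hw : (0 : ℝ) < 1 + wnorm M⁻¹ x ^ 2 := by positivity
  have h : (M + vecMulVec x x) *ᵥ
      (M⁻¹ *ᵥ v - ((x ⬝ᵥ M⁻¹ *ᵥ v) / (1 + wnorm M⁻¹ x ^ 2)) • M⁻¹ *ᵥ x) = v := by
    rw [mulVec_sub, mulVec_smul, add_mulVec, add_mulVec, mulVec_inv_mulVec hM,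
      mulVec_inv_mulVec hM, vecMulVec_mulVec, vecMulVec_mulVec, ← wnorm_sq hM.inv.posSemidef]
    ext i
    simp
    field_simp
    ring
  conv_lhs => rw [← h]
  rw [inv_mulVec_mulVec (posDef_add_vecMulVec hM x)]

/-- How the squared norm of a self-normalized sum changes when a term `η x` is added. -/
lemma wnorm_sq_rank_one_update {M : Matrix (Fin d) (Fin d) ℝ} (hM : M.PosDef) (S x : Fin d → ℝ)
    (η : ℝ) :
    wnorm (M + vecMulVec x x)⁻¹ (S + η • x) ^ 2 = wnorm M⁻¹ S ^ 2 +
      (-(x ⬝ᵥ M⁻¹ *ᵥ S) ^ 2 + 2 * η * (x ⬝ᵥ M⁻¹ *ᵥ S) + η ^ 2 * wnorm M⁻¹ x ^ 2) /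
        (1 + wnorm M⁻¹ x ^ 2) := by
  have hw : (0 : ℝ) < 1 + wnorm M⁻¹ x ^ 2 := by positivity
  rw [wnorm_sq (posDef_add_vecMulVec hM x).inv.posSemidef, inv_add_vecMulVec_mulVec hM]
  simp only [mulVec_add, mulVec_smul, dotProduct_sub, dotProduct_add, add_dotProduct,
    dotProduct_smul, smul_dotProduct, smul_eq_mul]
  rw [symm_dotProduct hM.inv.1 S x, ← wnorm_sq hM.inv.posSemidef x,
    ← wnorm_sq hM.inv.posSemidef S]
  field_simp
  ring

/-- The regularized Gram matrix `λ I + ∑_{i < k} x_i x_iᵀ`. -/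
def gram (lam : ℝ) (x : ℕ → Fin d → ℝ) (k : ℕ) : Matrix (Fin d) (Fin d) ℝ :=
  lam • 1 + ∑ i ∈ Finset.range k, vecMulVec (x i) (x i)

lemma gram_zero (lam : ℝ) (x : ℕ → Fin d → ℝ) : gram lam x 0 = lam • 1 := by simp [gram]

lemma gram_succ (lam : ℝ) (x : ℕ → Fin d → ℝ) (k : ℕ) :
    gram lam x (k + 1) = gram lam x k + vecMulVec (x k) (x k) := by
  simp [gram, Finset.sum_range_succ, add_assoc]

lemma gram_posDef {lam : ℝ} (hl : 0 < lam) (x : ℕ → Fin d → ℝ) (k : ℕ) :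
    (gram lam x k).PosDef := by
  induction k with
  | zero => rw [gram_zero]; exact PosDef.one.smul hl
  | succ k ih => rw [gram_succ]; exact posDef_add_vecMulVec ih _

lemma quad_gram (lam : ℝ) (x : ℕ → Fin d → ℝ) (k : ℕ) (v : Fin d → ℝ) :
    v ⬝ᵥ gram lam x k *ᵥ v = lam * (v ⬝ᵥ v) + ∑ i ∈ Finset.range k, (x i ⬝ᵥ v) ^ 2 := by
  induction k with
  | zero => simp [gram_zero, smul_mulVec]
  | succ k ih =>
    rw [gram_succ, add_mulVec, dotProduct_add, ih, Finset.sum_range_succ, vecMulVec_mulVec]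
    simp [dotProduct_comm v (x k)]
    ring

lemma wnorm_inv_gram_le {lam : ℝ} (hl : 0 < lam) (x : ℕ → Fin d → ℝ) (k : ℕ) (v : Fin d → ℝ) :
    wnorm (gram lam x k)⁻¹ v ≤ enorm2 v / Real.sqrt lam := by
  have h := wnorm_inv_le_of_quad_le (gram_posDef hl x 0) (gram_posDef hl x k) zero_le_one
    (fun v => ?_) v
  · refine h.trans_eq ?_
    have hd : (gram lam x 0)⁻¹ = lam⁻¹ • (1 : Matrix (Fin d) (Fin d) ℝ) := by
      rw [gram_zero]
      apply inv_eq_left_inv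
      rw [smul_mul_smul_comm, inv_mul_cancel₀ hl.ne', one_smul, one_mul]
    rw [hd, wnorm, smul_mulVec, one_mulVec, dotProduct_smul, smul_eq_mul, ← enorm2_sq,
      Real.sqrt_one, one_mul, Real.sqrt_mul (by positivity), Real.sqrt_sq (enorm2_nonneg _),
      Real.sqrt_inv]
    field_simp
  · rw [quad_gram, quad_gram, one_mul]
    simp only [Finset.range_zero, Finset.sum_empty, add_zero, le_add_iff_nonneg_right]
    exact Finset.sum_nonneg fun i _ => sq_nonneg _

lemma det_gram_succ {lam : ℝ} (hl : 0 < lam) (x : ℕ → Fin d → ℝ) (k : ℕ) :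
    (gram lam x (k + 1)).det = (gram lam x k).det * (1 + wnorm (gram lam x k)⁻¹ (x k) ^ 2) := by
  rw [gram_succ, det_add_vecMulVec (gram_posDef hl x k)]

lemma log_det_gram {lam : ℝ} (hl : 0 < lam) (x : ℕ → Fin d → ℝ) (k : ℕ) :
    Real.log (gram lam x k).det = Real.log (lam ^ d) +
      ∑ i ∈ Finset.range k, Real.log (1 + wnorm (gram lam x i)⁻¹ (x i) ^ 2) := by
  induction k with
  | zero => simp [gram_zero]
  | succ k ih =>
    rw [det_gram_succ hl, Real.log_mul (gram_posDef hl x k).det_pos.ne' (by positivity), ih,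
      Finset.sum_range_succ, add_assoc]

lemma trace_gram (lam : ℝ) (x : ℕ → Fin d → ℝ) (k : ℕ) :
    (gram lam x k).trace = lam * d + ∑ i ∈ Finset.range k, enorm2 (x i) ^ 2 := by
  simp only [gram, trace_add, trace_smul, trace_one, Fintype.card_fin, trace_sum, trace_vecMulVec,
    enorm2_sq, smul_eq_mul]

/-- The inequality between the arithmetic and the geometric mean of the eigenvalues. -/
lemma log_det_le (hd : 0 < d) {M : Matrix (Fin d) (Fin d) ℝ} (hM : M.PosDef) :
    Real.log M.det ≤ d * Real.log (M.trace / d) := by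
  have hd' : (0 : ℝ) < d := by exact_mod_cast hd
  have hev : ∀ i, 0 < hM.isHermitian.eigenvalues i := fun i => hM.eigenvalues_pos i
  have hdet : M.det = ∏ i, hM.isHermitian.eigenvalues i := by
    simpa using hM.isHermitian.det_eq_prod_eigenvalues
  have htr : M.trace = ∑ i, hM.isHermitian.eigenvalues i := by
    simpa using hM.isHermitian.trace_eq_sum_eigenvalues
  have h := Real.geom_mean_le_arith_mean Finset.univ (fun _ => 1)
    (fun i => hM.isHermitian.eigenvalues i) (by simp) (by simpa using hd) (fun i _ => (hev i).le)
  simp only [Real.rpow_one, Finset.sum_const, Finset.card_univ, Fintype.card_fin, nsmul_eq_mul,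
    mul_one, one_mul, ← hdet, ← htr] at h
  have hl := Real.log_le_log (Real.rpow_pos_of_pos hM.det_pos _) h
  rw [Real.log_rpow hM.det_pos] at hl
  rw [inv_mul_le_iff₀ hd'] at hl
  exact hl

/-- The elliptical potential: the logarithmic growth of the determinant. -/
lemma sum_log_le (hd : 0 < d) {lam : ℝ} (hl : 0 < lam) (x : ℕ → Fin d → ℝ) (k : ℕ) :
    ∑ i ∈ Finset.range k, Real.log (1 + wnorm (gram lam x i)⁻¹ (x i) ^ 2) ≤
      d * Real.log (1 + (∑ i ∈ Finset.range k, enorm2 (x i) ^ 2) / (d * lam)) := by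
  have hd' : (0 : ℝ) < d := by exact_mod_cast hd
  have h1 := log_det_gram hl x k
  have h2 := log_det_le hd (gram_posDef hl x k)
  have hs : 0 ≤ ∑ i ∈ Finset.range k, enorm2 (x i) ^ 2 := Finset.sum_nonneg fun i _ => sq_nonneg _
  have h3 : (gram lam x k).trace / d =
      lam * (1 + (∑ i ∈ Finset.range k, enorm2 (x i) ^ 2) / (d * lam)) := by
    rw [trace_gram]; field_simp
  rw [h3, Real.log_mul hl.ne' (by positivity), mul_add] at h2
  rw [Real.log_pow] at h1
  linarith

lemma div_one_add_le_log {y : ℝ} (hy : 0 ≤ y) : y / (1 + y) ≤ Real.log (1 + y) := by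
  have h := Real.one_sub_inv_le_log_of_pos (show 0 < 1 + y by linarith)
  have : y / (1 + y) = 1 - (1 + y)⁻¹ := by field_simp; ring
  linarith

end LinearAlgebra

/-! ### Covering numbers of Euclidean balls -/

section Covering

/-- The balls of radius `ε / 2` around the points of `T` are disjoint, and a ball of radius
`ρ + ε / 2` contains them. -/
lemma card_le_of_separated {ι : Type*} [Fintype ι] {ρ ε : ℝ} (hρ : 0 ≤ ρ) (hε : 0 < ε)
    (T : Finset (EuclideanSpace ℝ ι)) (hT : ∀ x ∈ T, ‖x‖ ≤ ρ)
    (hsep : ∀ x ∈ T, ∀ y ∈ T, x ≠ y → ε ≤ ‖x - y‖) :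
    (T.card : ℝ) ≤ (1 + 2 * ρ / ε) ^ Fintype.card ι := by
  let μ : Measure (EuclideanSpace ℝ ι) := Measure.addHaar
  have hδ : 0 < ε / 2 := by positivity
  have hr : 0 < ρ + ε / 2 := by positivity
  have D : Set.Pairwise (T : Set (EuclideanSpace ℝ ι))
      (Function.onFun Disjoint fun c => Metric.ball c (ε / 2)) := by
    intro c hc e he hce
    apply Metric.ball_disjoint_ball
    rw [dist_eq_norm]
    linarith [hsep c hc e he hce]
  have hsub : (⋃ c ∈ T, Metric.ball c (ε / 2)) ⊆
      Metric.ball (0 : EuclideanSpace ℝ ι) (ρ + ε / 2) := by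
    refine Set.iUnion₂_subset fun x hx => Metric.ball_subset_ball' ?_
    rw [dist_zero_right]
    linarith [hT x hx]
  have I : (T.card : ENNReal) * ENNReal.ofReal ((ε / 2) ^ Module.finrank ℝ (EuclideanSpace ℝ ι)) *
      μ (Metric.ball 0 1) ≤
      ENNReal.ofReal ((ρ + ε / 2) ^ Module.finrank ℝ (EuclideanSpace ℝ ι)) * μ (Metric.ball 0 1) := by
    calc _ = μ (⋃ c ∈ T, Metric.ball c (ε / 2)) := by
          rw [measure_biUnion_finset D fun c _ => measurableSet_ball]
          simp only [μ.addHaar_ball_of_pos _ hδ, Finset.sum_const, nsmul_eq_mul, mul_assoc]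
      _ ≤ μ (Metric.ball (0 : EuclideanSpace ℝ ι) (ρ + ε / 2)) := measure_mono hsub
      _ = _ := by simp only [μ.addHaar_ball_of_pos _ hr]
  have J := (ENNReal.mul_le_mul_iff_left (Metric.measure_ball_pos _ _ zero_lt_one).ne'
    measure_ball_lt_top.ne).1 I
  have K := ENNReal.toReal_le_of_le_ofReal (pow_nonneg hr.le _) J
  rw [ENNReal.toReal_mul, ENNReal.toReal_natCast, ENNReal.toReal_ofReal (by positivity),
    finrank_euclideanSpace] at K
  rw [← le_div_iff₀ (by positivity), ← div_pow] at K
  have e : (ρ + ε / 2) / (ε / 2) = 1 + 2 * ρ / ε := by field_simp; ring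
  rwa [e] at K

/-- A ball of radius `ρ` in Euclidean space of dimension `n` is covered by `(1 + 2ρ/ε)^n` balls of
radius `ε`. -/
lemma exists_net {ι : Type*} [Fintype ι] {ρ ε : ℝ} (hρ : 0 ≤ ρ) (hε : 0 < ε) :
    ∃ N : Finset (EuclideanSpace ℝ ι), (N.card : ℝ) ≤ (1 + 2 * ρ / ε) ^ Fintype.card ι ∧
      ∀ x, ‖x‖ ≤ ρ → ∃ y ∈ N, ‖x - y‖ ≤ ε := by
  classical
  by_contra! hcon
  -- Without a net, separated sets of every cardinality can be built greedily.
  have h : ∀ n : ℕ, ∃ T : Finset (EuclideanSpace ℝ ι), T.card = n ∧ (∀ x ∈ T, ‖x‖ ≤ ρ) ∧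
      ∀ x ∈ T, ∀ y ∈ T, x ≠ y → ε ≤ ‖x - y‖ := by
    intro n
    induction n with
    | zero => exact ⟨∅, by simp⟩
    | succ n ih =>
      obtain ⟨T, hc, hT, hs⟩ := ih
      obtain ⟨z, hz, hzT⟩ := hcon T (card_le_of_separated hρ hε T hT hs)
      have hzn : z ∉ T := fun hm => by
        have := hzT z hm
        simp at this
        linarith
      refine ⟨insert z T, by rw [Finset.card_insert_of_notMem hzn, hc], ?_, ?_⟩
      · intro x hx
        rcases Finset.mem_insert.mp hx with rfl | hx
        exacts [hz, hT x hx]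
      · intro x hx y hy hxy
        rcases Finset.mem_insert.mp hx with hx' | hx' <;>
          rcases Finset.mem_insert.mp hy with hy' | hy'
        · exact absurd (hx'.trans hy'.symm) hxy
        · rw [hx']; exact (hzT y hy').le
        · rw [hy', norm_sub_rev]; exact (hzT x hx').le
        · exact hs x hx' y hy' hxy
  obtain ⟨n, hn⟩ := exists_nat_gt ((1 + 2 * ρ / ε) ^ Fintype.card ι)
  obtain ⟨T, hc, hT, hs⟩ := h n
  have := card_le_of_separated hρ hε T hT hs
  rw [hc] at this
  linarith

end Covering

/-! ### One step of the self-normalized supermartingales -/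

section OneStep

/-- The increment of `‖S‖²_{Λ⁻¹}` when a term `η x` is added, where `a = ⟨x, Λ⁻¹ S⟩` and
`w = ‖x‖_{Λ⁻¹}`; see `wnorm_sq_rank_one_update`. -/
def incr (a w η : ℝ) : ℝ := (-a ^ 2 + 2 * η * a + η ^ 2 * w ^ 2) / (1 + w ^ 2)

lemma measurable_incr : Measurable fun p : ℝ × ℝ × ℝ => incr p.1 p.2.1 p.2.2 := by
  unfold incr
  fun_prop

/-- The method of mixtures in one dimension: `exp (incr a w η / 2)` is, up to normalization, the
average of `exp (y η - y² / 2)` over `y` with law `N(a, w²)`. -/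
lemma lintegral_gaussian_mixture (a η : ℝ) {w : ℝ} (hw : 0 < w) :
    ∫⁻ y, ENNReal.ofReal (gaussianPDFReal a (w ^ 2).toNNReal y * Real.exp (y * η - y ^ 2 / 2)) =
      ENNReal.ofReal ((Real.sqrt (1 + w ^ 2))⁻¹ * Real.exp (incr a w η / 2)) := by
  have hv : ((w ^ 2).toNNReal : ℝ) = w ^ 2 := Real.coe_toNNReal _ (by positivity)
  have hv' : ((w ^ 2 / (1 + w ^ 2)).toNNReal : ℝ) = w ^ 2 / (1 + w ^ 2) :=
    Real.coe_toNNReal _ (by positivity)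
  have hpt : ∀ y, gaussianPDFReal a (w ^ 2).toNNReal y * Real.exp (y * η - y ^ 2 / 2) =
      ((Real.sqrt (1 + w ^ 2))⁻¹ * Real.exp (incr a w η / 2)) *
        gaussianPDFReal ((a + η * w ^ 2) / (1 + w ^ 2)) (w ^ 2 / (1 + w ^ 2)).toNNReal y := by
    intro y
    rw [gaussianPDFReal, gaussianPDFReal, hv, hv']
    have h1 : Real.sqrt (2 * Real.pi * w ^ 2) =
        Real.sqrt (1 + w ^ 2) * Real.sqrt (2 * Real.pi * (w ^ 2 / (1 + w ^ 2))) := by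
      rw [← Real.sqrt_mul (by positivity)]
      congr 1
      field_simp
    have h2 : -(y - a) ^ 2 / (2 * w ^ 2) + (y * η - y ^ 2 / 2) = incr a w η / 2 +
        -(y - (a + η * w ^ 2) / (1 + w ^ 2)) ^ 2 / (2 * (w ^ 2 / (1 + w ^ 2))) := by
      rw [incr]
      field_simp
      ring
    rw [mul_assoc, ← Real.exp_add, h2, Real.exp_add, h1, mul_inv]
    ring
  simp_rw [hpt]
  have hc : 0 ≤ (Real.sqrt (1 + w ^ 2))⁻¹ * Real.exp (incr a w η / 2) := by positivity
  simp_rw [ENNReal.ofReal_mul hc]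
  rw [lintegral_const_mul _ (measurable_gaussianPDFReal _ _).ennreal_ofReal,
    lintegral_gaussianPDFReal_eq_one, mul_one]
  exact (Real.toNNReal_pos.mpr (by positivity)).ne'

variable {S : Type*} [MeasurableSpace S]

/-- The one-step bound behind the self-normalized Hoeffding inequality. -/
lemma lintegral_exp_incr_hoeffding (ν : Measure S) [IsProbabilityMeasure ν] {f : S → ℝ}
    (hf : Measurable f) {lo hi R : ℝ} (hlo : ∀ x, lo ≤ f x) (hhi : ∀ x, f x ≤ hi)
    (hle : lo ≤ hi) (hR : 0 < R) (hR2 : (hi - lo) / 2 ≤ R) {a w : ℝ} (hw : 0 ≤ w)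
    (ha : w = 0 → a = 0) :
    ∫⁻ x, ENNReal.ofReal (Real.exp (incr a w (f x - ∫ z, f z ∂ν) / (2 * R ^ 2))) ∂ν ≤
      ENNReal.ofReal (Real.sqrt (1 + w ^ 2)) := by
  rcases hw.eq_or_lt with rfl | hw
  · simp [ha rfl, incr]
  set η : S → ℝ := fun x => f x - ∫ z, f z ∂ν with hη
  have hηm : Measurable η := hf.sub_const _
  have hsg := hasSubgaussianMGF_of_mem_Icc (μ := ν) hf.aemeasurable
    (ae_of_all _ fun x => ⟨hlo x, hhi x⟩)
  have hmgf : ∀ t : ℝ, ∫⁻ x, ENNReal.ofReal (Real.exp (t * (η x / R))) ∂ν ≤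
      ENNReal.ofReal (Real.exp (t ^ 2 / 2)) := by
    intro t
    have h1 := hsg.mgf_le (t / R)
    have h2 := hsg.integrable_exp_mul (t / R)
    have h3 : ∀ x, t * (η x / R) = t / R * (f x - ∫ z, f z ∂ν) := fun x => by simp [hη]; ring
    simp_rw [h3]
    rw [← ofReal_integral_eq_lintegral_ofReal h2 (ae_of_all _ fun x => (Real.exp_pos _).le)]
    apply ENNReal.ofReal_le_ofReal
    refine h1.trans (Real.exp_le_exp.mpr ?_)
    have h4 : ((‖hi - lo‖₊ / 2 : NNReal) : ℝ) = (hi - lo) / 2 := by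
      simp [abs_of_nonneg (sub_nonneg.mpr hle)]
    have h5 : ((hi - lo) / 2) ^ 2 ≤ R ^ 2 := pow_le_pow_left₀ (by linarith) hR2 2
    rw [NNReal.coe_pow, h4, div_pow t R 2]
    have : ((hi - lo) / 2) ^ 2 * (t ^ 2 / R ^ 2) ≤ R ^ 2 * (t ^ 2 / R ^ 2) :=
      mul_le_mul_of_nonneg_right h5 (by positivity)
    have h6 : R ^ 2 * (t ^ 2 / R ^ 2) = t ^ 2 := by field_simp
    linarith
  have hkey : ∀ x, ENNReal.ofReal (Real.exp (incr a w (η x) / (2 * R ^ 2))) =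
      ENNReal.ofReal (Real.sqrt (1 + w ^ 2)) * ∫⁻ y, ENNReal.ofReal
        (gaussianPDFReal (a / R) (w ^ 2).toNNReal y * Real.exp (y * (η x / R) - y ^ 2 / 2)) := by
    intro x
    have hs : 0 < Real.sqrt (1 + w ^ 2) := by positivity
    rw [lintegral_gaussian_mixture _ _ hw, ← ENNReal.ofReal_mul hs.le]
    congr 1
    rw [← mul_assoc, mul_inv_cancel₀ hs.ne', one_mul]
    congr 1
    simp only [incr]
    field_simp
  change ∫⁻ x, ENNReal.ofReal (Real.exp (incr a w (η x) / (2 * R ^ 2))) ∂ν ≤ _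
  simp_rw [hkey]
  have hmeas : Measurable (Function.uncurry fun (x : S) (y : ℝ) => ENNReal.ofReal
      (gaussianPDFReal (a / R) (w ^ 2).toNNReal y * Real.exp (y * (η x / R) - y ^ 2 / 2))) := by
    have := measurable_gaussianPDFReal (a / R) (w ^ 2).toNNReal
    unfold Function.uncurry
    fun_prop
  rw [lintegral_const_mul _ hmeas.lintegral_prod_right, lintegral_lintegral_swap hmeas.aemeasurable]
  conv_rhs => rw [← mul_one (ENNReal.ofReal (Real.sqrt (1 + w ^ 2)))]
  gcongr
  calc _ ≤ ∫⁻ y, ENNReal.ofReal (gaussianPDFReal (a / R) (w ^ 2).toNNReal y) := by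
        refine lintegral_mono fun y => ?_
        have hp := gaussianPDFReal_nonneg (a / R) (w ^ 2).toNNReal y
        have hsplit : ∀ x, ENNReal.ofReal
            (gaussianPDFReal (a / R) (w ^ 2).toNNReal y * Real.exp (y * (η x / R) - y ^ 2 / 2)) =
            ENNReal.ofReal (gaussianPDFReal (a / R) (w ^ 2).toNNReal y * Real.exp (-(y ^ 2 / 2))) *
              ENNReal.ofReal (Real.exp (y * (η x / R))) := by
          intro x
          rw [← ENNReal.ofReal_mul (by positivity), mul_assoc, ← Real.exp_add]
          congr 3
          ring
        simp_rw [hsplit]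
        rw [lintegral_const_mul _ (by fun_prop)]
        refine (mul_le_mul_right (hmgf y) _).trans_eq ?_
        rw [← ENNReal.ofReal_mul (by positivity), mul_assoc, ← Real.exp_add]
        simp
    _ = 1 := lintegral_gaussianPDFReal_eq_one _ (Real.toNNReal_pos.mpr (by positivity)).ne'

lemma exp_le_quadratic {y : ℝ} (hy : |y| ≤ 2) : Real.exp y ≤ 1 + y + 2 * y ^ 2 := by
  obtain ⟨h1, h2⟩ := abs_le.mp hy
  have hz : |y / 2| ≤ 1 := abs_le.mpr ⟨by linarith, by linarith⟩
  have h := (abs_le.mp (Real.abs_exp_sub_one_sub_id_le hz)).2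
  have h3 : Real.exp y = Real.exp (y / 2) ^ 2 := by rw [← Real.exp_nat_mul]; congr 1; push_cast; ring
  have h4 : Real.exp (y / 2) ≤ 1 + y / 2 + (y / 2) ^ 2 := by linarith
  have h5 := pow_le_pow_left₀ (Real.exp_pos _).le h4 2
  rw [h3]
  refine h5.trans ?_
  nlinarith [mul_nonneg (sq_nonneg y) (mul_nonneg (sub_nonneg.mpr h2) (by linarith : 0 ≤ y + 2)),
    mul_nonneg (sq_nonneg y) (sub_nonneg.mpr h2), sq_nonneg y]

/-- The one-step bound behind the self-normalized Bernstein inequality. -/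
lemma lintegral_exp_incr_bernstein (ν : Measure S) [IsProbabilityMeasure ν] {η : S → ℝ}
    (hη : Measurable η) {D : ℝ} (hD : ∀ x, |η x| ≤ D) (hmean : ∫ x, η x ∂ν = 0) {s2 : ℝ}
    (hvar : ∫ x, η x ^ 2 ∂ν ≤ s2) {a w R β θ : ℝ} (hw : 0 ≤ w) (hβ : 0 ≤ β) (ha : |a| ≤ β * w)
    (hR : ∀ x, |η x| * min 1 w ≤ R) (hR0 : 0 ≤ R) (hθ : 0 ≤ θ) (hθR : θ * (R * (2 * β + R)) ≤ 2) :
    ∫⁻ x, ENNReal.ofReal (Real.exp (θ * incr a w (η x))) ∂ν ≤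
      ENNReal.ofReal (Real.exp ((θ * s2 + 2 * θ ^ 2 * s2 * (2 * β + R) ^ 2) *
        (w ^ 2 / (1 + w ^ 2)))) := by
  set m := 2 * β + R with hm
  set b := w ^ 2 / (1 + w ^ 2) with hb
  have hb0 : 0 ≤ b := by positivity
  have hm0 : 0 ≤ m := by positivity
  have hsb : Real.sqrt b ≤ min 1 w := by
    apply le_min
    · rw [Real.sqrt_le_left zero_le_one, hb, one_pow, div_le_one (by positivity)]; linarith
    · rw [Real.sqrt_le_left hw, hb]
      exact div_le_self (sq_nonneg _) (by nlinarith [sq_nonneg w])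
  have hηR : ∀ x, |η x| * Real.sqrt b ≤ R := fun x =>
    (mul_le_mul_of_nonneg_left hsb (abs_nonneg _)).trans (hR x)
  let X : S → ℝ := fun x => 2 * a / (1 + w ^ 2) * η x + b * η x ^ 2
  have hX1 : ∀ x, |X x| ≤ (|η x| * Real.sqrt b) * m := by
    intro x
    have h1 : |2 * a / (1 + w ^ 2)| ≤ 2 * β * Real.sqrt b := by
      rw [abs_div, abs_mul, abs_two, abs_of_pos (by positivity : 0 < 1 + w ^ 2)]
      have h2 : w / (1 + w ^ 2) ≤ Real.sqrt b := by
        apply Real.le_sqrt_of_sq_le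
        rw [hb, div_pow, div_le_div_iff₀ (by positivity) (by positivity)]
        nlinarith [sq_nonneg (w ^ 2), sq_nonneg w]
      calc 2 * |a| / (1 + w ^ 2) ≤ 2 * (β * w) / (1 + w ^ 2) := by gcongr
        _ = 2 * β * (w / (1 + w ^ 2)) := by ring
        _ ≤ _ := by gcongr
    have hbs : Real.sqrt b * Real.sqrt b = b := Real.mul_self_sqrt hb0
    calc |X x| ≤ |2 * a / (1 + w ^ 2)| * |η x| + b * |η x| ^ 2 := by
          refine (abs_add_le _ _).trans_eq ?_
          rw [abs_mul, abs_mul, abs_of_nonneg hb0, abs_pow]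
      _ ≤ 2 * β * Real.sqrt b * |η x| + (|η x| * Real.sqrt b) * (|η x| * Real.sqrt b) := by
          have := mul_le_mul_of_nonneg_right h1 (abs_nonneg (η x))
          nlinarith
      _ ≤ 2 * β * Real.sqrt b * |η x| + (|η x| * Real.sqrt b) * R := by
          have := mul_le_mul_of_nonneg_left (hηR x)
            (mul_nonneg (abs_nonneg (η x)) (Real.sqrt_nonneg b))
          linarith
      _ = _ := by rw [hm]; ring
  have hX2 : ∀ x, |θ * X x| ≤ 2 := by
    intro x
    rw [abs_mul, abs_of_nonneg hθ]
    exact (mul_le_mul_of_nonneg_left ((hX1 x).trans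
      (mul_le_mul_of_nonneg_right (hηR x) hm0)) hθ).trans hθR
  have hX3 : ∀ x, X x ^ 2 ≤ b * m ^ 2 * η x ^ 2 := by
    intro x
    have := pow_le_pow_left₀ (abs_nonneg _) (hX1 x) 2
    rw [sq_abs, mul_pow, mul_pow, sq_abs, Real.sq_sqrt hb0] at this
    linarith
  have hbound : ∀ x, Real.exp (θ * incr a w (η x)) ≤
      1 + θ * (2 * a / (1 + w ^ 2)) * η x + (θ * b + 2 * θ ^ 2 * (b * m ^ 2)) * η x ^ 2 := by
    intro x
    have h1 : incr a w (η x) ≤ X x := by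
      have : incr a w (η x) = X x - a ^ 2 / (1 + w ^ 2) := by
        simp only [incr, X, hb]; field_simp; ring
      have : 0 ≤ a ^ 2 / (1 + w ^ 2) := by positivity
      linarith
    have h2 := exp_le_quadratic (hX2 x)
    have h3 : Real.exp (θ * incr a w (η x)) ≤ Real.exp (θ * X x) :=
      Real.exp_le_exp.mpr (mul_le_mul_of_nonneg_left h1 hθ)
    have h4 : 2 * (θ * X x) ^ 2 ≤ 2 * θ ^ 2 * (b * m ^ 2) * η x ^ 2 := by
      have := mul_le_mul_of_nonneg_left (hX3 x) (by positivity : 0 ≤ 2 * θ ^ 2)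
      linarith
    have h5 : θ * X x = θ * (2 * a / (1 + w ^ 2)) * η x + θ * b * η x ^ 2 := by simp only [X]; ring
    linarith
  have hi1 : Integrable η ν := Integrable.of_bound hη.aestronglyMeasurable D (ae_of_all _ hD)
  have hi2 : Integrable (fun x => η x ^ 2) ν := by
    refine Integrable.of_bound (hη.pow_const 2).aestronglyMeasurable (D ^ 2) (ae_of_all _ fun x => ?_)
    rw [norm_pow]
    exact pow_le_pow_left₀ (norm_nonneg _) (hD x) 2
  set c1 := θ * (2 * a / (1 + w ^ 2))
  set c2 := θ * b + 2 * θ ^ 2 * (b * m ^ 2) with hc2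
  have hc20 : 0 ≤ c2 := by positivity
  have hi : Integrable (fun x => 1 + c1 * η x + c2 * η x ^ 2) ν :=
    ((integrable_const 1).add (hi1.const_mul c1)).add (hi2.const_mul c2)
  have hnn : ∀ x, 0 ≤ 1 + c1 * η x + c2 * η x ^ 2 := fun x => (Real.exp_pos _).le.trans (hbound x)
  calc _ ≤ ∫⁻ x, ENNReal.ofReal (1 + c1 * η x + c2 * η x ^ 2) ∂ν :=
        lintegral_mono fun x => ENNReal.ofReal_le_ofReal (hbound x)
    _ = ENNReal.ofReal (∫ x, 1 + c1 * η x + c2 * η x ^ 2 ∂ν) :=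
        (ofReal_integral_eq_lintegral_ofReal hi (ae_of_all _ hnn)).symm
    _ ≤ _ := by
        apply ENNReal.ofReal_le_ofReal
        have e1 : ∫ x, 1 + c1 * η x + c2 * η x ^ 2 ∂ν = 1 + c2 * ∫ x, η x ^ 2 ∂ν := by
          rw [integral_add (f := fun x => 1 + c1 * η x) ((integrable_const 1).add (hi1.const_mul c1))
            (hi2.const_mul c2),
            integral_add (integrable_const 1) (hi1.const_mul c1), integral_const_mul,
            integral_const_mul, hmean]
          simp
        rw [e1]
        have e2 := mul_le_mul_of_nonneg_left hvar hc20
        have e3 := Real.add_one_le_exp (c2 * s2)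
        have e4 : c2 * s2 = (θ * s2 + 2 * θ ^ 2 * s2 * m ^ 2) * b := by rw [hc2]; ring
        rw [← e4]
        linarith

end OneStep

/-! ### A maximal inequality for nonnegative supermartingales -/

section Ville

variable {Ω : Type*} {mΩ : MeasurableSpace Ω}

/-- Ville's inequality, in a form in which the supermartingale property is needed only before the
first time at which one of the sets `bad k` is entered. -/
lemma measure_iUnion_le_of_supermartingale (P : Measure Ω) (F : ℕ → MeasurableSpace Ω)
    (hF : ∀ k, F k ≤ mΩ) (hmono : Monotone F) {n : ℕ} (M : ℕ → Ω → ENNReal) (bad : ℕ → Set Ω)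
    (c : ENNReal) (hbad : ∀ k ≤ n, MeasurableSet[F k] (bad k))
    (hstep : ∀ k < n, ∀ A, MeasurableSet[F k] A → Disjoint A (bad k) →
      ∫⁻ ω in A, M (k + 1) ω ∂P ≤ ∫⁻ ω in A, M k ω ∂P)
    (hc : ∀ k ≤ n, ∀ ω ∈ bad k, c ≤ M k ω) (h0 : ∫⁻ ω, M 0 ω ∂P ≤ 1) :
    c * P (⋃ k ≤ n, bad k) ≤ 1 := by
  have key : ∀ k ≤ n, c * P (⋃ j ≤ k, bad j) + ∫⁻ ω in (⋃ j ≤ k, bad j)ᶜ, M k ω ∂P ≤ 1 := by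
    have hU : ∀ k ≤ n, MeasurableSet[F k] (⋃ j ≤ k, bad j) := fun k hk =>
      MeasurableSet.iUnion fun j => MeasurableSet.iUnion fun hj =>
        hmono hj _ (hbad j (hj.trans hk))
    -- Points entering a bad set at time `k` pay `c` out of the mass of `M k`.
    have hpay : ∀ k ≤ n, ∀ A, MeasurableSet A → c * P (A ∩ bad k) +
        ∫⁻ ω in A \ bad k, M k ω ∂P ≤ ∫⁻ ω in A, M k ω ∂P := by
      intro k hk A hA
      rw [← lintegral_inter_add_sdiff _ A (hF k _ (hbad k hk))]
      gcongr
      calc c * P (A ∩ bad k) = ∫⁻ _ in A ∩ bad k, c ∂P := by rw [setLIntegral_const]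
        _ ≤ _ := setLIntegral_mono' (hA.inter (hF k _ (hbad k hk))) fun ω hω => hc k hk ω hω.2
    intro k
    induction k with
    | zero =>
      intro hk
      have h := hpay 0 hk Set.univ MeasurableSet.univ
      have e : (⋃ j ≤ 0, bad j) = bad 0 := by ext; simp
      rw [Set.univ_inter, Set.sdiff_eq, Set.univ_inter, setLIntegral_univ] at h
      rw [e]
      exact h.trans h0
    | succ k ih =>
      intro hk
      have hk' : k ≤ n := Nat.le_of_succ_le hk
      set U := ⋃ j ≤ k, bad j with hUdef
      have e : (⋃ j ≤ k + 1, bad j) = U ∪ (Uᶜ ∩ bad (k + 1)) := by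
        rw [hUdef, Set.biUnion_le_succ]
        ext ω
        simp only [Set.mem_union, Set.mem_inter_iff, Set.mem_compl_iff]
        tauto
      have hUm : MeasurableSet U := hF k _ (hU k hk')
      have e2 : (U ∪ (Uᶜ ∩ bad (k + 1)))ᶜ = Uᶜ \ bad (k + 1) := by
        ext ω
        simp only [Set.mem_union, Set.mem_inter_iff, Set.mem_compl_iff, Set.mem_sdiff]
        tauto
      have h1 := hpay (k + 1) hk Uᶜ hUm.compl
      have h2 := hstep k hk Uᶜ (hU k hk').compl
        (Set.disjoint_left.mpr fun ω hω hb => hω (Set.mem_biUnion (le_refl k) hb))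
      rw [e, e2]
      calc _ ≤ c * (P U + P (Uᶜ ∩ bad (k + 1))) + ∫⁻ ω in Uᶜ \ bad (k + 1), M (k + 1) ω ∂P := by
            gcongr
            exact measure_union_le _ _
        _ = c * P U + (c * P (Uᶜ ∩ bad (k + 1)) + ∫⁻ ω in Uᶜ \ bad (k + 1), M (k + 1) ω ∂P) := by
            ring
        _ ≤ c * P U + ∫⁻ ω in Uᶜ, M k ω ∂P := by
            gcongr
            exact h1.trans h2
        _ ≤ 1 := ih hk'
  exact le_self_add.trans (key n le_rfl)

end Ville

/-! ### Self-normalized concentration -/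

section Measurability

variable {Ω : Type*} [MeasurableSpace Ω] {d : ℕ}

lemma measurable_det {A : Ω → Matrix (Fin d) (Fin d) ℝ} (hA : ∀ i j, Measurable fun ω => A ω i j) :
    Measurable fun ω => (A ω).det := by
  simp only [det_apply]
  refine Finset.measurable_sum _ fun σ _ => ?_
  exact (Finset.measurable_prod _ fun i _ => hA _ _).const_smul _

lemma measurable_inv_apply {A : Ω → Matrix (Fin d) (Fin d) ℝ}
    (hA : ∀ i j, Measurable fun ω => A ω i j) (i j : Fin d) :
    Measurable fun ω => (A ω)⁻¹ i j := by
  simp only [inv_def, Matrix.smul_apply, smul_eq_mul, Ring.inverse_eq_inv', adjugate_apply]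
  refine (measurable_det hA).inv.mul (measurable_det fun k l => ?_)
  by_cases h : k = j
  · subst h
    simp only [updateRow_self]
    exact measurable_const
  · simp only [updateRow_ne h]
    exact hA k l

lemma measurable_quad {A : Ω → Matrix (Fin d) (Fin d) ℝ} {v u : Ω → Fin d → ℝ}
    (hA : ∀ i j, Measurable fun ω => A ω i j) (hu : Measurable u) (hv : Measurable v) :
    Measurable fun ω => u ω ⬝ᵥ A ω *ᵥ v ω := by
  simp only [dotProduct, mulVec]
  exact Finset.measurable_sum _ fun i _ => ((measurable_pi_apply i).comp hu).mul
    (Finset.measurable_sum _ fun j _ => (hA i j).mul ((measurable_pi_apply j).comp hv))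

lemma measurable_wnorm {A : Ω → Matrix (Fin d) (Fin d) ℝ} {v : Ω → Fin d → ℝ}
    (hA : ∀ i j, Measurable fun ω => A ω i j) (hv : Measurable v) :
    Measurable fun ω => wnorm (A ω) (v ω) :=
  (measurable_quad hA hv hv).sqrt

lemma measurable_gram_apply (lam : ℝ) {x : ℕ → Ω → Fin d → ℝ} {k : ℕ}
    (hx : ∀ i < k, Measurable (x i)) (i j : Fin d) :
    Measurable fun ω => gram lam (fun l => x l ω) k i j := by
  simp only [gram, Matrix.add_apply, Matrix.sum_apply, vecMulVec_apply]
  refine measurable_const.add (Finset.measurable_sum _ fun l hl => ?_)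
  have h := hx l (Finset.mem_range.mp hl)
  exact ((measurable_pi_apply i).comp h).mul ((measurable_pi_apply j).comp h)

lemma measurable_sum_smul {x : ℕ → Ω → Fin d → ℝ} {e : ℕ → Ω → ℝ} {k : ℕ}
    (hx : ∀ i < k, Measurable (x i)) (he : ∀ i < k, Measurable (e i)) :
    Measurable fun ω => ∑ i ∈ Finset.range k, e i ω • x i ω :=
  Finset.measurable_sum _ fun i hi =>
    (he i (Finset.mem_range.mp hi)).smul (hx i (Finset.mem_range.mp hi))

lemma measurable_exp_incr {S : Type*} [MeasurableSpace S] {T N A : Ω → ℝ} (hT : Measurable T)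
    (hN : Measurable N) (hA : Measurable A) {e : Ω × S → ℝ} (he : Measurable e) {ψ : ℝ → ℝ}
    (hψ : Measurable ψ) (θ : ℝ) : Measurable fun p : Ω × S => ENNReal.ofReal (Real.exp
      (T p.1 - ψ (N p.1) + θ * incr (A p.1) (N p.1) (e p))) := by
  have m5 : Measurable fun p : Ω × S => incr (A p.1) (N p.1) (e p) :=
    measurable_incr.comp ((hA.comp measurable_fst).prodMk ((hN.comp measurable_fst).prodMk he))
  exact ((((hT.comp measurable_fst).sub (hψ.comp (hN.comp measurable_fst))).add
    (m5.const_mul θ)).exp).ennreal_ofReal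

end Measurability

section Concentration

variable {Ω S : Type*} {mΩ : MeasurableSpace Ω} [MeasurableSpace S] {d : ℕ}

/-- The points `X k` are drawn from the laws `κ k` given the `σ`-algebras `F k`, for `k < n`: the
law of `X k` is expressed by integrating functions of the past and of `X k`. -/
structure IsDraw (P : Measure Ω) (F : ℕ → MeasurableSpace Ω) (X : ℕ → Ω → S)
    (κ : ℕ → Ω → Measure S) (n : ℕ) : Prop where
  le : ∀ k, F k ≤ mΩ
  mono : Monotone F
  prob : ∀ k < n, ∀ ω, IsProbabilityMeasure (κ k ω)
  meas : ∀ k, Measurable[F (k + 1)] (X k)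
  lintegral_eq : ∀ k < n, ∀ g : Ω × S → ENNReal, Measurable[(F k).prod inferInstance] g →
    ∫⁻ ω, g (ω, X k ω) ∂P = ∫⁻ ω, ∫⁻ y, g (ω, y) ∂(κ k ω) ∂P

variable {P : Measure Ω} {F : ℕ → MeasurableSpace Ω} {X : ℕ → Ω → S} {κ : ℕ → Ω → Measure S} {n : ℕ}

lemma IsDraw.setLIntegral_le (h : IsDraw P F X κ n) {k : ℕ} (hk : k < n) {A : Set Ω}
    (hA : MeasurableSet[F k] A) {g : Ω × S → ENNReal}
    (hg : Measurable[(F k).prod inferInstance] g) {m : Ω → ENNReal}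
    (hm : ∀ ω ∈ A, ∫⁻ y, g (ω, y) ∂(κ k ω) ≤ m ω) :
    ∫⁻ ω in A, g (ω, X k ω) ∂P ≤ ∫⁻ ω in A, m ω ∂P := by
  have hA' : MeasurableSet A := h.le k _ hA
  have hB : MeasurableSet[(F k).prod inferInstance] (A ×ˢ (Set.univ : Set S)) :=
    @MeasurableSet.prod _ _ (F k) _ _ _ hA MeasurableSet.univ
  have h1 := h.lintegral_eq k hk ((A ×ˢ (Set.univ : Set S)).indicator g)
    (by let _ : MeasurableSpace Ω := F k; exact hg.indicator hB)
  have h2 : ∀ ω y, (A ×ˢ (Set.univ : Set S)).indicator g (ω, y) =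
      A.indicator (fun ω => g (ω, y)) ω := by
    intro ω y
    by_cases hω : ω ∈ A <;> simp [hω]
  have h3 : ∀ ω, (A ×ˢ (Set.univ : Set S)).indicator g (ω, X k ω) =
      A.indicator (fun ω => g (ω, X k ω)) ω := by
    intro ω
    by_cases hω : ω ∈ A <;> simp [hω]
  simp_rw [h3] at h1
  rw [lintegral_indicator hA'] at h1
  rw [h1, ← lintegral_indicator hA']
  refine lintegral_mono fun ω => ?_
  simp_rw [h2]
  by_cases hω : ω ∈ A
  · simpa [hω] using hm ω hω
  · simp [hω]

/-- The self-normalized sum `∑_{i < k} η_i(X_i) x_i`. -/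
def selfSum (x : ℕ → Ω → Fin d → ℝ) (η : ℕ → Ω × S → ℝ) (X : ℕ → Ω → S) (k : ℕ) (ω : Ω) :
    Fin d → ℝ :=
  ∑ i ∈ Finset.range k, η i (ω, X i ω) • x i ω

/-- The norm `‖∑_{i < k} η_i(X_i) x_i‖` with respect to the inverse of the Gram matrix. -/
def selfNorm (lam : ℝ) (x : ℕ → Ω → Fin d → ℝ) (η : ℕ → Ω × S → ℝ) (X : ℕ → Ω → S) (k : ℕ) (ω : Ω) :
    ℝ :=
  wnorm (gram lam (fun i => x i ω) k)⁻¹ (selfSum x η X k ω)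

/-- The norm of the next vector `x_k`. -/
def nextNorm (lam : ℝ) (x : ℕ → Ω → Fin d → ℝ) (k : ℕ) (ω : Ω) : ℝ :=
  wnorm (gram lam (fun i => x i ω) k)⁻¹ (x k ω)

/-- The inner product of the next vector `x_k` with the self-normalized sum. -/
def nextInner (lam : ℝ) (x : ℕ → Ω → Fin d → ℝ) (η : ℕ → Ω × S → ℝ) (X : ℕ → Ω → S) (k : ℕ)
    (ω : Ω) : ℝ :=
  x k ω ⬝ᵥ (gram lam (fun i => x i ω) k)⁻¹ *ᵥ selfSum x η X k ω

omit [MeasurableSpace S] in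
lemma selfNorm_sq_succ {lam : ℝ} (hl : 0 < lam) (x : ℕ → Ω → Fin d → ℝ) (η : ℕ → Ω × S → ℝ)
    (X : ℕ → Ω → S) (k : ℕ) (ω : Ω) :
    selfNorm lam x η X (k + 1) ω ^ 2 = selfNorm lam x η X k ω ^ 2 +
      incr (nextInner lam x η X k ω) (nextNorm lam x k ω) (η k (ω, X k ω)) := by
  rw [selfNorm, gram_succ, selfSum, Finset.sum_range_succ,
    wnorm_sq_rank_one_update (gram_posDef hl _ k)]
  rfl

omit [MeasurableSpace S] in
lemma abs_nextInner_le {lam : ℝ} (hl : 0 < lam) (x : ℕ → Ω → Fin d → ℝ) (η : ℕ → Ω × S → ℝ)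
    (X : ℕ → Ω → S) (k : ℕ) (ω : Ω) :
    |nextInner lam x η X k ω| ≤ selfNorm lam x η X k ω * nextNorm lam x k ω := by
  rw [mul_comm]
  exact abs_bilin_le (gram_posDef hl _ k).inv.posSemidef _ _

lemma IsDraw.measurable_eval (h : IsDraw P F X κ n) {η : ℕ → Ω × S → ℝ}
    (hη : ∀ k < n, Measurable[(F k).prod inferInstance] (η k)) {i k : ℕ} (hi : i < n) (hik : i < k) :
    Measurable[F k] fun ω => η i (ω, X i ω) := by
  have h1 : Measurable[F k, (F i).prod inferInstance] fun ω => (ω, X i ω) :=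
    @Measurable.prodMk _ (F k) _ _ (F i) _ id (X i) (fun s hs => h.mono hik.le _ hs)
      ((h.meas i).mono (h.mono hik) le_rfl)
  exact @Measurable.comp _ _ _ (F k) ((F i).prod inferInstance) _ _ _ (hη i hi) h1

lemma IsDraw.measurable_selfNorm (h : IsDraw P F X κ n) (lam : ℝ) {x : ℕ → Ω → Fin d → ℝ}
    {η : ℕ → Ω × S → ℝ} (hx : ∀ k < n, Measurable[F k] (x k))
    (hη : ∀ k < n, Measurable[(F k).prod inferInstance] (η k)) {k : ℕ} (hk : k ≤ n) :
    Measurable[F k] (selfNorm lam x η X k) := by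
  have hx' : ∀ i < k, Measurable[F k] (x i) := fun i hi =>
    (hx i (hi.trans_le hk)).mono (h.mono hi.le) le_rfl
  have hs : Measurable[F k] (selfSum x η X k) := @measurable_sum_smul Ω (F k) d _ _ k hx'
    fun i hi => h.measurable_eval hη (hi.trans_le hk) hi
  exact @measurable_wnorm Ω (F k) d _ _ (fun i j => @measurable_inv_apply Ω (F k) d _
    (fun i j => @measurable_gram_apply Ω (F k) d lam x k hx' i j) i j) hs

lemma IsDraw.measurable_nextNorm (h : IsDraw P F X κ n) (lam : ℝ) {x : ℕ → Ω → Fin d → ℝ}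
    (hx : ∀ k < n, Measurable[F k] (x k)) {k : ℕ} (hk : k < n) :
    Measurable[F k] (nextNorm lam x k) := by
  have hx' : ∀ i < k, Measurable[F k] (x i) := fun i hi =>
    (hx i (hi.trans hk)).mono (h.mono hi.le) le_rfl
  exact @measurable_wnorm Ω (F k) d _ _ (fun i j => @measurable_inv_apply Ω (F k) d _
    (fun i j => @measurable_gram_apply Ω (F k) d lam x k hx' i j) i j) (hx k hk)

lemma IsDraw.measurable_nextInner (h : IsDraw P F X κ n) (lam : ℝ) {x : ℕ → Ω → Fin d → ℝ}
    {η : ℕ → Ω × S → ℝ} (hx : ∀ k < n, Measurable[F k] (x k))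
    (hη : ∀ k < n, Measurable[(F k).prod inferInstance] (η k)) {k : ℕ} (hk : k < n) :
    Measurable[F k] (nextInner lam x η X k) := by
  have hx' : ∀ i < k, Measurable[F k] (x i) := fun i hi =>
    (hx i (hi.trans hk)).mono (h.mono hi.le) le_rfl
  have hs : Measurable[F k] (selfSum x η X k) := @measurable_sum_smul Ω (F k) d _ _ k hx'
    fun i hi => h.measurable_eval hη (hi.trans hk) hi
  exact @measurable_quad Ω (F k) d _ _ _ (fun i j => @measurable_inv_apply Ω (F k) d _
    (fun i j => @measurable_gram_apply Ω (F k) d lam x k hx' i j) i j) (hx k hk) hs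

lemma IsDraw.measurable_sum_nextNorm (h : IsDraw P F X κ n) (lam : ℝ) {x : ℕ → Ω → Fin d → ℝ}
    (hx : ∀ k < n, Measurable[F k] (x k)) {f : ℝ → ℝ} (hf : Measurable f) {k : ℕ} (hk : k ≤ n) :
    Measurable[F k] fun ω => ∑ i ∈ Finset.range k, f (nextNorm lam x i ω) :=
  @Finset.measurable_sum _ _ _ _ _ _ (F k) _ _ fun _ hi =>
    have hi' := Finset.mem_range.mp hi
    hf.comp ((h.measurable_nextNorm lam hx (hi'.trans_le hk)).mono (h.mono hi'.le) le_rfl)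

/-- The common part of the two concentration inequalities. If the exponential of
`θ ‖S_k‖² - ∑_{i<k} ψ(‖x_i‖)` is a supermartingale as long as `‖S_k‖² ≤ b_k`, and this exponent
is at least `log (1/δ)` when `‖S_k‖² > b_k`, then `‖S_k‖² ≤ b_k` for all `k` with probability at
least `1 - δ`. -/
lemma IsDraw.measure_selfNorm_le (h : IsDraw P F X κ n) [IsProbabilityMeasure P] {lam : ℝ}
    (hl : 0 < lam) {x : ℕ → Ω → Fin d → ℝ} {η : ℕ → Ω × S → ℝ}
    (hx : ∀ k < n, Measurable[F k] (x k))
    (hη : ∀ k < n, Measurable[(F k).prod inferInstance] (η k)) {θ δ : ℝ} {ψ : ℝ → ℝ}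
    (hψ : Measurable ψ) (hδ : 0 < δ) (b : ℕ → Ω → ℝ) (hb : ∀ k ≤ n, Measurable[F k] (b k))
    (hbad : ∀ k ≤ n, ∀ ω, b k ω < selfNorm lam x η X k ω ^ 2 → Real.log (1 / δ) ≤
      θ * selfNorm lam x η X k ω ^ 2 - ∑ i ∈ Finset.range k, ψ (nextNorm lam x i ω))
    (hstep : ∀ k < n, ∀ ω, selfNorm lam x η X k ω ^ 2 ≤ b k ω →
      ∫⁻ y, ENNReal.ofReal (Real.exp (θ * incr (nextInner lam x η X k ω) (nextNorm lam x k ω)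
        (η k (ω, y)))) ∂(κ k ω) ≤ ENNReal.ofReal (Real.exp (ψ (nextNorm lam x k ω)))) :
    P (⋃ k ≤ n, {ω | b k ω < selfNorm lam x η X k ω ^ 2}) ≤ ENNReal.ofReal δ := by
  let T : ℕ → Ω → ℝ := fun k ω =>
    θ * selfNorm lam x η X k ω ^ 2 - ∑ i ∈ Finset.range k, ψ (nextNorm lam x i ω)
  have hT : ∀ k ≤ n, Measurable[F k] (T k) := by
    intro k hk
    have h1 := h.measurable_selfNorm lam hx hη hk
    have h2 := h.measurable_sum_nextNorm lam hx hψ hk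
    let _ : MeasurableSpace Ω := F k
    exact ((h1.pow_const 2).const_mul θ).sub h2
  have hv := measure_iUnion_le_of_supermartingale P F h.le h.mono (n := n)
    (fun k ω => ENNReal.ofReal (Real.exp (T k ω))) (fun k => {ω | b k ω < selfNorm lam x η X k ω ^ 2})
    (ENNReal.ofReal (1 / δ)) ?_ ?_ ?_ ?_
  · have hc : ENNReal.ofReal (1 / δ) = (ENNReal.ofReal δ)⁻¹ := by
      rw [one_div, ENNReal.ofReal_inv_of_pos hδ]
    rw [hc, mul_comm, ← div_eq_mul_inv] at hv
    have := (ENNReal.div_le_iff (by simpa using hδ) ENNReal.ofReal_ne_top).mp hv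
    simpa using this
  · intro k hk
    have h1 := h.measurable_selfNorm lam hx hη hk
    have h2 := hb k hk
    let _ : MeasurableSpace Ω := F k
    exact measurableSet_lt h2 (h1.pow_const 2)
  · intro k hk A hA hdis
    let G : Ω × S → ENNReal := fun p => ENNReal.ofReal (Real.exp (T k p.1 -
      ψ (nextNorm lam x k p.1) + θ * incr (nextInner lam x η X k p.1) (nextNorm lam x k p.1)
        (η k p)))
    have hG : Measurable[(F k).prod inferInstance] G := by
      have m1 := hT k hk.le
      have m2 := h.measurable_nextNorm lam hx hk
      have m3 := h.measurable_nextInner lam hx hη hk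
      have m4 := hη k hk
      let _ : MeasurableSpace Ω := F k
      exact measurable_exp_incr m1 m2 m3 m4 hψ θ
    have hGe : ∀ ω, ENNReal.ofReal (Real.exp (T (k + 1) ω)) = G (ω, X k ω) := by
      intro ω
      simp only [T, G]
      congr 2
      rw [selfNorm_sq_succ hl, Finset.sum_range_succ]
      ring
    simp_rw [hGe]
    refine h.setLIntegral_le hk hA hG fun ω hω => ?_
    have hω' : selfNorm lam x η X k ω ^ 2 ≤ b k ω := by
      by_contra hcon
      exact Set.disjoint_left.mp hdis hω (not_le.mp hcon)
    have hs := hstep k hk ω hω'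
    simp only [G]
    have e : ∀ y, ENNReal.ofReal (Real.exp (T k ω - ψ (nextNorm lam x k ω) +
        θ * incr (nextInner lam x η X k ω) (nextNorm lam x k ω) (η k (ω, y)))) =
        ENNReal.ofReal (Real.exp (T k ω - ψ (nextNorm lam x k ω))) *
        ENNReal.ofReal (Real.exp (θ * incr (nextInner lam x η X k ω) (nextNorm lam x k ω)
          (η k (ω, y)))) := fun y => by
      rw [← ENNReal.ofReal_mul (Real.exp_pos _).le, ← Real.exp_add]
    simp_rw [e]
    rw [lintegral_const_mul']
    · refine (mul_le_mul_right hs _).trans_eq ?_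
      rw [← ENNReal.ofReal_mul (Real.exp_pos _).le, ← Real.exp_add, sub_add_cancel]
    · exact ENNReal.ofReal_ne_top
  · intro k hk ω hω
    apply ENNReal.ofReal_le_ofReal
    rw [← Real.exp_log (by positivity : 0 < 1 / δ)]
    exact Real.exp_le_exp.mpr (hbad k hk ω hω)
  · simp [T, selfNorm, selfSum, wnorm_zero]

/-- **Self-normalized Hoeffding inequality.** -/
theorem IsDraw.hoeffding (h : IsDraw P F X κ n) [IsProbabilityMeasure P] {lam : ℝ}
    (hl : 0 < lam) {x : ℕ → Ω → Fin d → ℝ} {η g : ℕ → Ω × S → ℝ} {R : ℝ} (hR : 0 < R)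
    (hx : ∀ k < n, Measurable[F k] (x k))
    (hη : ∀ k < n, Measurable[(F k).prod inferInstance] (η k))
    (hg : ∀ k < n, ∀ ω, Measurable fun y => g k (ω, y))
    (hηg : ∀ k < n, ∀ ω y, η k (ω, y) = g k (ω, y) - ∫ z, g k (ω, z) ∂(κ k ω))
    (hg0 : ∀ k < n, ∀ p, 0 ≤ g k p) (hgR : ∀ k < n, ∀ p, g k p ≤ 2 * R) {δ : ℝ} (hδ : 0 < δ) :
    P (⋃ k ≤ n, {ω | R ^ 2 * (2 * Real.log (1 / δ) + ∑ i ∈ Finset.range k,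
      Real.log (1 + nextNorm lam x i ω ^ 2)) < selfNorm lam x η X k ω ^ 2}) ≤
      ENNReal.ofReal δ := by
  refine h.measure_selfNorm_le hl hx hη (θ := 1 / (2 * R ^ 2))
    (ψ := fun w => Real.log (1 + w ^ 2) / 2) (by fun_prop) hδ _ ?_ ?_ ?_
  · intro k hk
    have h1 := h.measurable_sum_nextNorm lam hx (f := fun w => Real.log (1 + w ^ 2))
      (by fun_prop) hk
    let _ : MeasurableSpace Ω := F k
    exact (h1.const_add _).const_mul _
  · intro k hk ω hω
    rw [← Finset.sum_div]
    have : 2 * Real.log (1 / δ) + ∑ i ∈ Finset.range k, Real.log (1 + nextNorm lam x i ω ^ 2) <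
        selfNorm lam x η X k ω ^ 2 / R ^ 2 := by
      rwa [lt_div_iff₀ (by positivity), mul_comm]
    have e : 1 / (2 * R ^ 2) * selfNorm lam x η X k ω ^ 2 =
      (selfNorm lam x η X k ω ^ 2 / R ^ 2) / 2 := by field_simp
    rw [e]
    linarith
  · intro k hk ω _
    have := h.prob k hk ω
    have hw : 0 ≤ nextNorm lam x k ω := wnorm_nonneg _ _
    have h1 := lintegral_exp_incr_hoeffding (κ k ω) (hg k hk ω) (fun y => hg0 k hk (ω, y))
      (fun y => hgR k hk (ω, y)) (by positivity) hR (by linarith)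
      (a := nextInner lam x η X k ω) hw (fun h0 => by
        have := abs_nextInner_le hl x η X k ω
        rw [h0, mul_zero] at this
        exact abs_eq_zero.mp (le_antisymm this (abs_nonneg _)))
    have e : ∀ z : ℝ, 1 / (2 * R ^ 2) * z = z / (2 * R ^ 2) := fun z => by ring
    simp_rw [e, hηg k hk ω]
    refine h1.trans_eq ?_
    congr 1
    rw [Real.sqrt_eq_rpow, Real.rpow_def_of_pos (by positivity)]
    congr 1
    ring

/-- **Self-normalized Bernstein inequality**, for `θ` to be chosen. -/
theorem IsDraw.bernstein_aux (h : IsDraw P F X κ n) [IsProbabilityMeasure P] {lam : ℝ}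
    (hl : 0 < lam) {x : ℕ → Ω → Fin d → ℝ} {η : ℕ → Ω × S → ℝ} {R β s2 θ : ℝ} (hR : 0 ≤ R)
    (hβ : 0 ≤ β) (hs2 : 0 ≤ s2) (hθ : 0 ≤ θ) (hθR : θ * (R * (2 * β + R)) ≤ 2)
    (hx : ∀ k < n, Measurable[F k] (x k))
    (hη : ∀ k < n, Measurable[(F k).prod inferInstance] (η k))
    (hηm : ∀ k < n, ∀ ω, Measurable fun y => η k (ω, y))
    (hηD : ∀ k < n, ∀ ω, ∃ D, ∀ y, |η k (ω, y)| ≤ D)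
    (hmean : ∀ k < n, ∀ ω, ∫ y, η k (ω, y) ∂(κ k ω) = 0)
    (hvar : ∀ k < n, ∀ ω, ∫ y, η k (ω, y) ^ 2 ∂(κ k ω) ≤ s2)
    (hηR : ∀ k < n, ∀ ω y, |η k (ω, y)| * min 1 (nextNorm lam x k ω) ≤ R) {L δ : ℝ} (hδ : 0 < δ)
    (hL : ∀ k ≤ n, ∀ ω, ∑ i ∈ Finset.range k,
      nextNorm lam x i ω ^ 2 / (1 + nextNorm lam x i ω ^ 2) ≤ L)
    (hfin : Real.log (1 / δ) + (θ * s2 + 2 * θ ^ 2 * s2 * (2 * β + R) ^ 2) * L ≤ θ * β ^ 2) :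
    P (⋃ k ≤ n, {ω | β ^ 2 < selfNorm lam x η X k ω ^ 2}) ≤ ENNReal.ofReal δ := by
  set c := θ * s2 + 2 * θ ^ 2 * s2 * (2 * β + R) ^ 2 with hc
  have hc0 : 0 ≤ c := by positivity
  refine h.measure_selfNorm_le hl hx hη (θ := θ) (ψ := fun w => c * (w ^ 2 / (1 + w ^ 2)))
    (by fun_prop) hδ _ (fun k _ => measurable_const) ?_ ?_
  · intro k hk ω hω
    rw [← Finset.mul_sum]
    have h1 := mul_le_mul_of_nonneg_left (hL k hk ω) hc0
    have h2 := mul_le_mul_of_nonneg_left hω.le hθ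
    linarith
  · intro k hk ω hω
    have := h.prob k hk ω
    have hw : 0 ≤ nextNorm lam x k ω := wnorm_nonneg _ _
    obtain ⟨D, hD⟩ := hηD k hk ω
    have hS : selfNorm lam x η X k ω ≤ β := le_of_sq_le_sq hω hβ
    exact lintegral_exp_incr_bernstein (κ k ω) (hηm k hk ω) hD (hmean k hk ω) (hvar k hk ω) hw hβ
      ((abs_nextInner_le hl x η X k ω).trans (mul_le_mul_of_nonneg_right hS hw))
      (hηR k hk ω) hR hθ hθR

/-- **Self-normalized Bernstein inequality.** Up to constants, the norm of the sum is at most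
`√(s² L log(1/δ)) + R log(1/δ)`. -/
theorem IsDraw.bernstein (h : IsDraw P F X κ n) [IsProbabilityMeasure P] {lam : ℝ}
    (hl : 0 < lam) {x : ℕ → Ω → Fin d → ℝ} {η : ℕ → Ω × S → ℝ} {R s2 : ℝ} (hR : 0 < R)
    (hs2 : 0 ≤ s2) (hx : ∀ k < n, Measurable[F k] (x k))
    (hη : ∀ k < n, Measurable[(F k).prod inferInstance] (η k))
    (hηm : ∀ k < n, ∀ ω, Measurable fun y => η k (ω, y))
    (hηD : ∀ k < n, ∀ ω, ∃ D, ∀ y, |η k (ω, y)| ≤ D)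
    (hmean : ∀ k < n, ∀ ω, ∫ y, η k (ω, y) ∂(κ k ω) = 0)
    (hvar : ∀ k < n, ∀ ω, ∫ y, η k (ω, y) ^ 2 ∂(κ k ω) ≤ s2)
    (hηR : ∀ k < n, ∀ ω y, |η k (ω, y)| * min 1 (nextNorm lam x k ω) ≤ R) {L δ : ℝ} (hδ : 0 < δ)
    (hδ1 : 1 ≤ Real.log (1 / δ)) (hL0 : 0 ≤ L)
    (hL : ∀ k ≤ n, ∀ ω, ∑ i ∈ Finset.range k,
      nextNorm lam x i ω ^ 2 / (1 + nextNorm lam x i ω ^ 2) ≤ L) :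
    P (⋃ k ≤ n, {ω | (8 * Real.sqrt (s2 * L * Real.log (1 / δ)) + 2 * R * Real.log (1 / δ)) ^ 2 <
      selfNorm lam x η X k ω ^ 2}) ≤ ENNReal.ofReal δ := by
  set Λ := Real.log (1 / δ) with hΛ
  have hΛ0 : 0 < Λ := by linarith
  have hv0 : 0 ≤ s2 * L := mul_nonneg hs2 hL0
  set τ := Real.sqrt (s2 * L / Λ) with hτ
  have hτ0 : 0 ≤ τ := Real.sqrt_nonneg _
  have hτ2 : τ ^ 2 * Λ = s2 * L := by
    rw [hτ, Real.sq_sqrt (by positivity)]; field_simp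
  have hu : Real.sqrt (s2 * L * Λ) = τ * Λ := by
    rw [← hτ2, show τ ^ 2 * Λ * Λ = (τ * Λ) ^ 2 by ring, Real.sqrt_sq (by positivity)]
  rw [hu]
  set β := 8 * (τ * Λ) + 2 * R * Λ with hβ
  have hβ0 : 0 < β := by positivity
  set m := 2 * β + R with hm
  have hm0 : 0 < m := by positivity
  -- The range condition is `θ m ≤ 2 / R`; from `θ m ≤ 1 / τ` the term `2 θ² m² s² L` is at most `2 Λ`.
  have hq : 0 < m * (R / 2 + τ) := by positivity
  refine h.bernstein_aux hl (β := β) (s2 := s2) (θ := 1 / (m * (R / 2 + τ))) hR.le hβ0.le hs2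
    (by positivity) ?_ hx hη hηm hηD hmean hvar hηR hδ hL ?_
  · rw [div_mul_eq_mul_div, one_mul, div_le_iff₀ hq]
    nlinarith [mul_nonneg hm0.le hτ0]
  · rw [← hΛ]
    have e : (1 / (m * (R / 2 + τ)) * s2 + 2 * (1 / (m * (R / 2 + τ))) ^ 2 * s2 * m ^ 2) * L =
        (s2 * L + 2 * (m * (s2 * L) / (R / 2 + τ))) / (m * (R / 2 + τ)) := by
      field_simp
    rw [e, ← sub_nonneg]
    have e2 : 1 / (m * (R / 2 + τ)) * β ^ 2 - (Λ + (s2 * L + 2 * (m * (s2 * L) / (R / 2 + τ))) /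
        (m * (R / 2 + τ))) = (β ^ 2 - (Λ * (m * (R / 2 + τ)) + s2 * L +
          2 * (m * (s2 * L) / (R / 2 + τ)))) / (m * (R / 2 + τ)) := by
      field_simp
      ring
    rw [e2]
    apply div_nonneg _ hq.le
    have h1 : m * (s2 * L) / (R / 2 + τ) ≤ m * (τ * Λ) := by
      rw [div_le_iff₀ (by positivity), ← hτ2]
      nlinarith [mul_nonneg (mul_nonneg hm0.le (mul_nonneg hτ0 hΛ0.le)) hR.le]
    have h2 : s2 * L ≤ (τ * Λ) ^ 2 := by
      rw [← hτ2]
      nlinarith [mul_nonneg (mul_nonneg hτ0 hτ0) (mul_nonneg hΛ0.le (sub_nonneg.mpr hδ1))]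
    have h3 : R ≤ R * Λ := by nlinarith
    set u := τ * Λ
    set r := R * Λ
    have hu0 : 0 ≤ u := by positivity
    have hr0 : 0 ≤ r := by positivity
    have h4 : m ≤ 16 * u + 5 * r := by rw [hm, hβ]; linarith
    have h5 : Λ * (m * (R / 2 + τ)) = m * (r / 2 + u) := by simp only [u, r]; ring
    have h6 : m * (r / 2 + u) + 2 * (m * u) ≤ (16 * u + 5 * r) * (r / 2 + 3 * u) := by
      have : m * (r / 2 + 3 * u) ≤ (16 * u + 5 * r) * (r / 2 + 3 * u) :=
        mul_le_mul_of_nonneg_right h4 (by positivity)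
      linarith
    have h7 : β ^ 2 = (8 * u + 2 * r) ^ 2 := by rw [hβ]; simp only [r]; ring
    rw [h5, h7]
    nlinarith [mul_nonneg hu0 hr0, sq_nonneg u, sq_nonneg r]

end Concentration

/-! ### Integration against tuples of signed measures -/

section SignedMeasures

variable {S : Type*} [MeasurableSpace S] {d : ℕ}

lemma isFiniteMeasure_variation (μ : SignedMeasure S) : IsFiniteMeasure μ.variation := by
  rw [← SignedMeasure.totalVariation_eq_variation, SignedMeasure.totalVariation]
  infer_instance

lemma integrable_variation (μ : SignedMeasure S) {V : S → ℝ} (hV : Measurable V) {D : ℝ}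
    (hD : ∀ x, |V x| ≤ D) : VectorMeasure.Integrable μ V := by
  have := isFiniteMeasure_variation μ
  exact Integrable.of_bound hV.aestronglyMeasurable D (ae_of_all _ hD)

lemma muApply_zero (μ : Fin d → SignedMeasure S) : muApply μ (fun _ => 0) = 0 := by
  ext i
  simp [muApply]

lemma muApply_sub (μ : Fin d → SignedMeasure S) {V V' : S → ℝ} (hV : Measurable V)
    (hV' : Measurable V') {D D' : ℝ} (hD : ∀ x, |V x| ≤ D) (hD' : ∀ x, |V' x| ≤ D') :
    muApply μ (fun x => V x - V' x) = muApply μ V - muApply μ V' := by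
  ext i
  exact VectorMeasure.integral_fun_sub (integrable_variation (μ i) hV hD)
    (integrable_variation (μ i) hV' hD')

lemma muApply_smul (μ : Fin d → SignedMeasure S) (c : ℝ) (V : S → ℝ) :
    muApply μ (fun x => c * V x) = c • muApply μ V := by
  ext i
  exact VectorMeasure.integral_fun_smul _ _ c V

lemma muApply_sub_measure (μ ν : Fin d → SignedMeasure S) {V : S → ℝ} (hV : Measurable V)
    {D : ℝ} (hD : ∀ x, |V x| ≤ D) : muApply (μ - ν) V = muApply μ V - muApply ν V := by
  ext i
  exact VectorMeasure.integral_sub_vectorMeasure (integrable_variation (μ i) hV hD)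
    (integrable_variation (ν i) hV hD)

lemma muApply_linear_comb {ι : Type*} [Fintype ι] (c : Fin d → ι → ℝ) (ν : ι → SignedMeasure S)
    {V : S → ℝ} (hV : ∀ j, VectorMeasure.Integrable (ν j) V) (i : Fin d) :
    muApply (fun i => ∑ j, c i j • ν j) V i = ∑ j, c i j * ∫ᵛ s, V s ∂•(ν j) := by
  unfold muApply
  rw [VectorMeasure.integral_finsetSum_vectorMeasure fun j _ => (hV j).smul_vectorMeasure (c i j)]
  refine Finset.sum_congr rfl fun j _ => ?_
  rw [VectorMeasure.integral_smul_vectorMeasure, smul_eq_mul]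

end SignedMeasures

/-! ### Expectations and the optimal value function of a linear MDP -/

namespace LinearMDP

variable {S A : Type*} [MeasurableSpace S] {d H : ℕ} {W : ℝ} (M : LinearMDP S A d H W)

lemma expect_eq {h : ℕ} (hh : h < H) {V : S → ℝ} (hV : Measurable V) {D : ℝ}
    (hD : ∀ x, |V x| ≤ D) (s : S) (a : A) :
    M.expect h V s a = muApply (M.mu h) V ⬝ᵥ M.phi s a := by
  have := M.trans_prob h hh s a
  have e : (M.trans h s a).toSignedMeasure = ∑ i, M.phi s a i • M.mu h i := by
    ext B hB
    rw [Measure.toSignedMeasure_apply_measurable hB, M.trans_eq h hh s a B hB]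
    simp
  rw [expect, ← VectorMeasure.integral_toSignedMeasure, e,
    VectorMeasure.integral_finsetSum_vectorMeasure fun j _ => (integrable_variation _ hV hD),
    dotProduct]
  refine Finset.sum_congr rfl fun j _ => ?_
  have hB : (ContinuousLinearMap.lsmul ℝ ℝ (E := ℝ)).flip = ContinuousLinearMap.lsmul ℝ ℝ := by
    ext; simp
  rw [VectorMeasure.integral_smul_vectorMeasure, smul_eq_mul, mul_comm, hB]
  rfl

lemma measurable_expect {h : ℕ} (hh : h < H) {V : S → ℝ} (hV : Measurable V) {D : ℝ}
    (hD : ∀ x, |V x| ≤ D) (a : A) : Measurable fun s => M.expect h V s a := by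
  simp_rw [M.expect_eq hh hV hD, dotProduct]
  exact Finset.measurable_sum _ fun i _ =>
    ((measurable_pi_apply i).comp (M.phi_measurable a)).const_mul _

lemma enorm2_muApply_le {h : ℕ} (hh : h < H) {V : S → ℝ} (hV : Measurable V) {D : ℝ}
    (hD0 : 0 ≤ D) (hD : ∀ x, |V x| ≤ D) : enorm2 (muApply (M.mu h) V) ≤ D * Real.sqrt d := by
  rcases hD0.eq_or_lt with rfl | hD0
  · have : V = fun _ => 0 := funext fun x => abs_nonpos_iff.mp (hD x)
    rw [this, muApply_zero]
    simp [enorm2]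
  · have h1 := M.mu_norm h hh (fun x => D⁻¹ * V x) (hV.const_mul _) fun x => by
      rw [abs_mul, abs_of_pos (inv_pos.mpr hD0), inv_mul_le_iff₀ hD0, mul_one]
      exact hD x
    rw [muApply_smul, enorm2_smul, abs_of_pos (inv_pos.mpr hD0), inv_mul_le_iff₀ hD0] at h1
    exact h1

lemma integrable_trans {h : ℕ} (hh : h < H) {V : S → ℝ} (hV : Measurable V) {D : ℝ}
    (hD : ∀ x, |V x| ≤ D) (s : S) (a : A) : Integrable V (M.trans h s a) := by
  have := M.trans_prob h hh s a
  exact Integrable.of_bound hV.aestronglyMeasurable D (ae_of_all _ hD)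

lemma expect_mono {h : ℕ} (hh : h < H) {V V' : S → ℝ} (hV : Measurable V) (hV' : Measurable V')
    {D D' : ℝ} (hD : ∀ x, |V x| ≤ D) (hD' : ∀ x, |V' x| ≤ D') (hle : ∀ x, V x ≤ V' x) (s : S)
    (a : A) : M.expect h V s a ≤ M.expect h V' s a :=
  integral_mono (M.integrable_trans hh hV hD s a) (M.integrable_trans hh hV' hD' s a) hle

lemma expect_const {h : ℕ} (hh : h < H) (c : ℝ) (s : S) (a : A) :
    M.expect h (fun _ => c) s a = c := by
  have := M.trans_prob h hh s a
  simp [expect]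

lemma expect_nonneg (h : ℕ) {V : S → ℝ} (hV : ∀ x, 0 ≤ V x) (s : S) (a : A) :
    0 ≤ M.expect h V s a := integral_nonneg hV

lemma expect_le {h : ℕ} (hh : h < H) {V : S → ℝ} (hV : Measurable V) {D c : ℝ}
    (hD : ∀ x, |V x| ≤ D) (hc : ∀ x, V x ≤ c) (s : S) (a : A) : M.expect h V s a ≤ c := by
  rw [← M.expect_const hh c s a]
  exact M.expect_mono hh hV measurable_const hD (fun _ => le_rfl) hc s a

lemma expect_sub {h : ℕ} (hh : h < H) {V V' : S → ℝ} (hV : Measurable V) (hV' : Measurable V')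
    {D D' : ℝ} (hD : ∀ x, |V x| ≤ D) (hD' : ∀ x, |V' x| ≤ D') (s : S) (a : A) :
    M.expect h (fun x => V x - V' x) s a = M.expect h V s a - M.expect h V' s a :=
  integral_sub (M.integrable_trans hh hV hD s a) (M.integrable_trans hh hV' hD' s a)

/-- The value of dynamic programming with `n` stages to go. -/
def vOpt [Fintype A] [Nonempty A] : ℕ → S → ℝ
  | 0 => fun _ => 0
  | n + 1 => fun s => Finset.univ.sup' Finset.univ_nonempty fun a =>
      M.reward (H - (n + 1)) s a + M.expect (H - (n + 1)) (vOpt n) s a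

lemma reward_nonneg {h : ℕ} (hh : h < H) (s : S) (a : A) : 0 ≤ M.reward h s a :=
  (M.reward_mem h hh s a).1

lemma reward_le_one {h : ℕ} (hh : h < H) (s : S) (a : A) : M.reward h s a ≤ 1 :=
  (M.reward_mem h hh s a).2

lemma measurable_reward (h : ℕ) (a : A) : Measurable fun s => M.reward h s a := by
  simp_rw [reward, dotProduct]
  exact Finset.measurable_sum _ fun i _ =>
    ((measurable_pi_apply i).comp (M.phi_measurable a)).const_mul _

end LinearMDP

lemma measurable_sup'_univ {Ω A : Type*} [MeasurableSpace Ω] [Fintype A] [Nonempty A]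
    {f : A → Ω → ℝ} (hf : ∀ a, Measurable (f a)) :
    Measurable fun ω => Finset.univ.sup' Finset.univ_nonempty fun a => f a ω := by
  have := Finset.measurable_sup' (s := (Finset.univ : Finset A)) Finset.univ_nonempty
    (f := f) fun a _ => hf a
  convert this using 1
  ext ω
  rw [Finset.sup'_apply]

/-- A finite family of measurable functions has a measurable maximizer. -/
lemma exists_measurable_argmax {S A : Type*} [MeasurableSpace S] [MeasurableSpace A]
    [MeasurableSingletonClass A] [Fintype A] [Nonempty A] {f : A → S → ℝ}
    (hf : ∀ a, Measurable (f a)) : ∃ g : S → A, Measurable g ∧ ∀ s b, f b s ≤ f (g s) s := by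
  classical
  let e := Fintype.equivFin A
  have hex : ∀ s, ∃ a, ∀ b, f b s ≤ f a s := fun s => by
    obtain ⟨a, -, ha⟩ := Finset.exists_max_image Finset.univ (fun a => f a s) Finset.univ_nonempty
    exact ⟨a, fun b => ha b (Finset.mem_univ b)⟩
  have hex' : ∀ s, (Finset.univ.filter fun i => ∀ b, f b s ≤ f (e.symm i) s).Nonempty := fun s => by
    obtain ⟨a, ha⟩ := hex s
    exact ⟨e a, by simpa using ha⟩
  let g : S → A := fun s => e.symm ((Finset.univ.filter fun i => ∀ b, f b s ≤ f (e.symm i) s).min'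
    (hex' s))
  have hg : ∀ s b, f b s ≤ f (g s) s := fun s =>
    (Finset.mem_filter.mp (Finset.min'_mem _ (hex' s))).2
  have hmax : ∀ a, MeasurableSet {s | ∀ b, f b s ≤ f a s} := fun a => by
    simp only [Set.ofPred_forall]
    exact MeasurableSet.iInter fun b => measurableSet_le (hf b) (hf a)
  refine ⟨g, measurable_to_countable' fun a => ?_, hg⟩
  have : g ⁻¹' {a} = {s | ∀ b, f b s ≤ f a s} ∩
      ⋂ i, ⋂ (_ : i < e a), {s | ∀ b, f b s ≤ f (e.symm i) s}ᶜ := by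
    ext s
    simp only [Set.mem_preimage, Set.mem_singleton_iff, Set.mem_inter_iff, Set.mem_ofPred_eq,
      Set.mem_iInter, Set.mem_compl_iff]
    constructor
    · rintro rfl
      refine ⟨hg s, fun i hi hcon => ?_⟩
      have := Finset.min'_le (Finset.univ.filter fun i => ∀ b, f b s ≤ f (e.symm i) s) i
        (Finset.mem_filter.mpr ⟨Finset.mem_univ i, hcon⟩)
      simp only [g, Equiv.apply_symm_apply] at hi
      exact absurd hi (not_lt.mpr this)
    · rintro ⟨h1, h2⟩
      simp only [g]
      rw [Equiv.symm_apply_eq]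
      apply le_antisymm
      · exact Finset.min'_le _ _ (by simpa using h1)
      · apply Finset.le_min'
        intro i hi
        by_contra hlt
        exact h2 i (not_le.mp hlt) (Finset.mem_filter.mp hi).2
  rw [this]
  exact (hmax a).inter (MeasurableSet.iInter fun i => MeasurableSet.iInter fun _ => (hmax _).compl)

namespace LinearMDP

variable {S A : Type*} [MeasurableSpace S] {d H : ℕ} {W : ℝ} (M : LinearMDP S A d H W)

section

variable [Fintype A] [Nonempty A]

lemma vOpt_props : ∀ n ≤ H, Measurable (M.vOpt n) ∧ ∀ s, 0 ≤ M.vOpt n s ∧ M.vOpt n s ≤ n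
  | 0, _ => ⟨measurable_const, fun _ => ⟨le_rfl, by simp [vOpt]⟩⟩
  | n + 1, hn => by
    obtain ⟨h1, h2⟩ := vOpt_props n (by omega)
    have hh : H - (n + 1) < H := by omega
    have hD : ∀ x, |M.vOpt n x| ≤ n := fun x => abs_le.mpr ⟨by linarith [(h2 x).1], (h2 x).2⟩
    refine ⟨measurable_sup'_univ fun a => (M.measurable_reward _ a).add
      (M.measurable_expect hh h1 hD a), fun s => ⟨?_, ?_⟩⟩
    · obtain ⟨a⟩ := ‹Nonempty A›
      refine le_trans ?_ (Finset.le_sup' _ (Finset.mem_univ a))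
      exact add_nonneg (M.reward_nonneg hh s a) (M.expect_nonneg _ (fun x => (h2 x).1) s a)
    · refine Finset.sup'_le Finset.univ_nonempty _ fun a _ => ?_
      push_cast
      linarith [M.reward_le_one hh s a, M.expect_le hh h1 hD (fun x => (h2 x).2) s a]

variable [MeasurableSpace A] [MeasurableSingletonClass A]

lemma polToGo_props {π : ℕ → S → A} (hπ : ∀ h, Measurable (π h)) :
    ∀ n ≤ H, Measurable (M.polToGo π n) ∧ ∀ s, 0 ≤ M.polToGo π n s ∧ M.polToGo π n s ≤ M.vOpt n s
  | 0, _ => ⟨measurable_const, fun _ => ⟨le_rfl, le_rfl⟩⟩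
  | n + 1, hn => by
    obtain ⟨h1, h2⟩ := polToGo_props hπ n (by omega)
    obtain ⟨h3, h4⟩ := M.vOpt_props n (by omega)
    have hh : H - (n + 1) < H := by omega
    have hD' : ∀ x, |M.vOpt n x| ≤ n := fun x => abs_le.mpr ⟨by linarith [(h4 x).1], (h4 x).2⟩
    have hD : ∀ x, |M.polToGo π n x| ≤ n := fun x =>
      abs_le.mpr ⟨by linarith [(h2 x).1, Nat.cast_nonneg (α := ℝ) n], (h2 x).2.trans (h4 x).2⟩
    refine ⟨?_, fun s => ⟨?_, ?_⟩⟩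
    · have hm : Measurable fun p : S × A => M.reward (H - (n + 1)) p.1 p.2 +
          M.expect (H - (n + 1)) (M.polToGo π n) p.1 p.2 :=
        measurable_from_prod_countable_left fun a => (M.measurable_reward _ a).add
          (M.measurable_expect hh h1 hD a)
      exact hm.comp (measurable_id.prodMk (hπ _))
    · exact add_nonneg (M.reward_nonneg hh s _) (M.expect_nonneg _ (fun x => (h2 x).1) s _)
    · refine le_trans ?_ (Finset.le_sup' (fun a => M.reward (H - (n + 1)) s a +
        M.expect (H - (n + 1)) (M.vOpt n) s a) (Finset.mem_univ (π (H - (n + 1)) s)))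
      exact add_le_add le_rfl (M.expect_mono hh h1 h3 hD hD' (fun x => (h2 x).2) s _)

lemma exists_greedy : ∃ π : ℕ → S → A, (∀ h, Measurable (π h)) ∧
    ∀ n ≤ H, M.polToGo π n = M.vOpt n := by
  have hex : ∀ h : ℕ, ∃ g : S → A, Measurable g ∧ (h < H → ∀ s b,
      M.reward h s b + M.expect h (M.vOpt (H - (h + 1))) s b ≤
      M.reward h s (g s) + M.expect h (M.vOpt (H - (h + 1))) s (g s)) := by
    intro h
    by_cases hh : h < H
    · obtain ⟨h1, h2⟩ := M.vOpt_props (H - (h + 1)) (by omega)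
      obtain ⟨g, hg, hg'⟩ := exists_measurable_argmax
        (f := fun a s => M.reward h s a + M.expect h (M.vOpt (H - (h + 1))) s a)
        fun a => (M.measurable_reward _ a).add (M.measurable_expect hh h1
          (D := ((H - (h + 1) : ℕ) : ℝ)) (fun x => abs_le.mpr ⟨by
            linarith [(h2 x).1, Nat.cast_nonneg (α := ℝ) (H - (h + 1))], (h2 x).2⟩) a)
      exact ⟨g, hg, fun _ => hg'⟩
    · exact ⟨fun _ => Classical.arbitrary A, measurable_const, fun h' => absurd h' hh⟩
  choose π hπ hmax using hex
  refine ⟨π, hπ, fun n => ?_⟩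
  induction n with
  | zero => intro _; rfl
  | succ n ih =>
    intro hn
    have e : H - (H - (n + 1) + 1) = n := by omega
    have hm := hmax (H - (n + 1)) (by omega)
    rw [e] at hm
    ext s
    simp only [polToGo, vOpt, ih (by omega)]
    exact le_antisymm (Finset.le_sup' (fun a => M.reward (H - (n + 1)) s a +
        M.expect (H - (n + 1)) (M.vOpt n) s a) (Finset.mem_univ (π (H - (n + 1)) s)))
      (Finset.sup'_le _ _ fun b _ => hm s b)

/-- The optimal value function is computed by dynamic programming. -/
lemma vStar_eq_vOpt (h : ℕ) : M.vStar h = M.vOpt (H - h) := by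
  ext s
  obtain ⟨π, hπ, hopt⟩ := M.exists_greedy
  have hle : ∀ π : {π : ℕ → S → A // ∀ h', Measurable (π h')}, M.vPol π.1 h s ≤ M.vOpt (H - h) s :=
    fun π => ((M.polToGo_props π.2 (H - h) (Nat.sub_le _ _)).2 s).2
  have : Nonempty {π : ℕ → S → A // ∀ h', Measurable (π h')} := ⟨⟨π, hπ⟩⟩
  apply le_antisymm (ciSup_le hle)
  refine le_ciSup_of_le ⟨_, Set.forall_mem_range.mpr hle⟩ ⟨π, hπ⟩ ?_
  rw [vPol, hopt _ (Nat.sub_le _ _)]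

lemma measurable_vStar (h : ℕ) : Measurable (M.vStar h) := by
  rw [vStar_eq_vOpt]
  exact (M.vOpt_props _ (Nat.sub_le _ _)).1

lemma vStar_nonneg (h : ℕ) (s : S) : 0 ≤ M.vStar h s := by
  rw [vStar_eq_vOpt]
  exact ((M.vOpt_props _ (Nat.sub_le _ _)).2 s).1

lemma vStar_le (h : ℕ) (s : S) : M.vStar h s ≤ H := by
  rw [vStar_eq_vOpt]
  refine ((M.vOpt_props _ (Nat.sub_le _ _)).2 s).2.trans ?_
  exact_mod_cast Nat.sub_le _ _

lemma vStar_last (s : S) : M.vStar H s = 0 := by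
  rw [vStar_eq_vOpt, Nat.sub_self]
  rfl

/-- The Bellman optimality equation. -/
lemma vStar_bellman {h : ℕ} (hh : h < H) (s : S) : M.vStar h s =
    Finset.univ.sup' Finset.univ_nonempty fun a =>
      M.reward h s a + M.expect h (M.vStar (h + 1)) s a := by
  rw [vStar_eq_vOpt, vStar_eq_vOpt]
  obtain ⟨n, hn⟩ : ∃ n, H - h = n + 1 := ⟨H - h - 1, by omega⟩
  have e1 : H - (h + 1) = n := by omega
  have e2 : H - (n + 1) = h := by omega
  rw [hn, e1, vOpt, e2]

end

end LinearMDP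

/-! ### The run of the algorithm on a fixed trajectory -/

section Run

variable {S A : Type*} [MeasurableSpace S] {d : ℕ} [Fintype A] [Nonempty A]

namespace State

variable (st : State S A d) (c : Config S A d)

lemma vHat_of_lt {h : ℕ} (hh : h < c.H) (x : S) : st.vHat c h x =
    Finset.univ.sup' Finset.univ_nonempty fun b => st.qHat c h x b := by
  obtain ⟨n, hn⟩ : ∃ n, c.H - h = n + 1 := ⟨c.H - h - 1, by omega⟩
  have e1 : c.H - (h + 1) = n := by omega
  have e2 : c.H - (n + 1) = h := by omega
  simp only [vHat, qHat, hn, e1, vHatToGo, e2]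

lemma vHat_of_ge {h : ℕ} (hh : c.H ≤ h) : st.vHat c h = fun _ => 0 := by
  rw [vHat, Nat.sub_eq_zero_of_le hh]
  rfl

lemma vChk_of_lt {h : ℕ} (hh : h < c.H) (x : S) : st.vChk c h x =
    max (Finset.univ.sup' Finset.univ_nonempty
      fun b => st.qChkOf c h (st.vChk c (h + 1)) x b) 0 := by
  obtain ⟨n, hn⟩ : ∃ n, c.H - h = n + 1 := ⟨c.H - h - 1, by omega⟩
  have e1 : c.H - (h + 1) = n := by omega
  have e2 : c.H - (n + 1) = h := by omega
  simp only [vChk, hn, e1, vChkToGo, e2]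

lemma vChk_of_ge {h : ℕ} (hh : c.H ≤ h) : st.vChk c h = fun _ => 0 := by
  rw [vChk, Nat.sub_eq_zero_of_le hh]
  rfl

lemma vChk_nonneg (h : ℕ) (x : S) : 0 ≤ st.vChk c h x := by
  rcases lt_or_ge h c.H with hh | hh
  · rw [st.vChk_of_lt c hh]; exact le_max_right _ _
  · rw [st.vChk_of_ge c hh]

lemma sigTil_sq (h : ℕ) (s : S) (a : A) : st.sigTil c h s a ^ 2 =
    max (max (c.H : ℝ) (c.H * d ^ 3 * st.offE c h s a)) (st.varHat c h s a + st.offU c h s a) := by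
  rw [sigTil, Real.sq_sqrt]
  exact (Nat.cast_nonneg _).trans ((le_max_left _ _).trans (le_max_left _ _))

lemma sigHat_sq (h : ℕ) (s : S) (a : A) : st.sigHat c h s a ^ 2 =
    max (max (st.sigMin c h s a ^ 2) (d ^ 3 * c.H * st.offE c h s a))
      (st.varHat c h s a + st.offU c h s a) := by
  rw [sigHat, Real.sq_sqrt]
  exact (sq_nonneg _).trans ((le_max_left _ _).trans (le_max_left _ _))

lemma sigHat_nonneg (h : ℕ) (s : S) (a : A) : 0 ≤ st.sigHat c h s a := Real.sqrt_nonneg _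

lemma sigTil_nonneg (h : ℕ) (s : S) (a : A) : 0 ≤ st.sigTil c h s a := Real.sqrt_nonneg _

lemma le_sigTil_sq (h : ℕ) (s : S) (a : A) : (c.H : ℝ) ≤ st.sigTil c h s a ^ 2 := by
  rw [sigTil_sq]
  exact (le_max_left _ _).trans (le_max_left _ _)

variable {c}

lemma sigMin_sq_bounds (hH : 0 < c.H) (hd : 0 < d) (h : ℕ) (s : S) (a : A) :
    (c.H : ℝ) ≤ st.sigMin c h s a ^ 2 ∧ st.sigMin c h s a ^ 2 ≤ (c.H : ℝ) ^ 4 * d ^ 5 := by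
  have h1 : (1 : ℝ) ≤ c.H := by exact_mod_cast hH
  have h2 : (1 : ℝ) ≤ d := by exact_mod_cast hd
  have h3 : (1 : ℝ) ≤ (d : ℝ) ^ 5 := one_le_pow₀ h2
  have h4 : (c.H : ℝ) ≤ (c.H : ℝ) ^ 4 := le_self_pow₀ h1 (by norm_num)
  have h5 : (c.H : ℝ) ≤ (c.H : ℝ) ^ 4 * d ^ 5 := by nlinarith
  rw [sigMin]
  split_ifs
  · rw [Real.sq_sqrt (by positivity)]
    exact ⟨le_rfl, h5⟩
  · rw [mul_pow, Real.sq_sqrt (by positivity), ← pow_mul]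
    exact ⟨h5, le_rfl⟩

lemma le_sigHat_sq (hH : 0 < c.H) (hd : 0 < d) (h : ℕ) (s : S) (a : A) :
    (c.H : ℝ) ≤ st.sigHat c h s a ^ 2 := by
  rw [sigHat_sq]
  exact (st.sigMin_sq_bounds hH hd h s a).1.trans ((le_max_left _ _).trans (le_max_left _ _))

lemma sigHat_pos (hH : 0 < c.H) (hd : 0 < d) (h : ℕ) (s : S) (a : A) : 0 < st.sigHat c h s a := by
  have h1 : (0 : ℝ) < c.H := by exact_mod_cast hH
  exact pos_of_sq_pos (st.sigHat_nonneg c h s a) (h1.trans_le (st.le_sigHat_sq hH hd h s a))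
where
  pos_of_sq_pos {y : ℝ} (hy : 0 ≤ y) (h : 0 < y ^ 2) : 0 < y := by
    rcases hy.eq_or_lt with rfl | hy
    · simp at h
    · exact hy

lemma sigTil_pos (hH : 0 < c.H) (h : ℕ) (s : S) (a : A) : 0 < st.sigTil c h s a := by
  have h1 : (0 : ℝ) < c.H := by exact_mod_cast hH
  have h2 := h1.trans_le (st.le_sigTil_sq c h s a)
  rcases (st.sigTil_nonneg c h s a).eq_or_lt with h0 | h0
  · rw [← h0] at h2; simp at h2
  · exact h0

lemma offE_le_sigHat_sq (h : ℕ) (s : S) (a : A) :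
    d ^ 3 * c.H * st.offE c h s a ≤ st.sigHat c h s a ^ 2 := by
  rw [sigHat_sq]
  exact (le_max_right _ _).trans (le_max_left _ _)

lemma varHat_add_offU_le_sigHat_sq (h : ℕ) (s : S) (a : A) :
    st.varHat c h s a + st.offU c h s a ≤ st.sigHat c h s a ^ 2 := by
  rw [sigHat_sq]
  exact le_max_right _ _

lemma sigTil_le_sigHat (hH : 0 < c.H) (hd : 0 < d) (h : ℕ) (s : S) (a : A) :
    st.sigTil c h s a ≤ st.sigHat c h s a := by
  apply Real.sqrt_le_sqrt
  refine max_le_max (max_le_max (st.sigMin_sq_bounds hH hd h s a).1 ?_) le_rfl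
  rw [mul_comm (c.H : ℝ)]

/-- The weights differ only in their lower bounds, which are at most `H² √(d⁵)` for `σ̂` and equal to
`√H` for `σ̃`. -/
lemma sigHat_sq_le (hH : 0 < c.H) (hd : 0 < d) (h : ℕ) (s : S) (a : A) :
    st.sigHat c h s a ^ 2 ≤ ((c.H : ℝ) ^ 3 * d ^ 5) * st.sigTil c h s a ^ 2 := by
  have h1 : (1 : ℝ) ≤ c.H := by exact_mod_cast hH
  have h2 : (1 : ℝ) ≤ d := by exact_mod_cast hd
  have h3 : (1 : ℝ) ≤ (c.H : ℝ) ^ 3 * d ^ 5 :=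
    one_le_mul_of_one_le_of_one_le (one_le_pow₀ h1) (one_le_pow₀ h2)
  have h4 := le_mul_of_one_le_left (sq_nonneg (st.sigTil c h s a)) h3
  rw [sigHat_sq]
  refine max_le (max_le ?_ ?_) ?_
  · refine (st.sigMin_sq_bounds hH hd h s a).2.trans ?_
    have := mul_le_mul_of_nonneg_left (st.le_sigTil_sq c h s a) (zero_le_one.trans h3)
    calc (c.H : ℝ) ^ 4 * d ^ 5 = (c.H : ℝ) ^ 3 * d ^ 5 * c.H := by ring
      _ ≤ _ := this
  · refine le_trans ?_ h4
    rw [sigTil_sq, mul_comm ((d : ℝ) ^ 3)]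
    exact (le_max_right _ _).trans (le_max_left _ _)
  · refine le_trans ?_ h4
    rw [sigTil_sq]
    exact le_max_right _ _

end State

variable (c : Config S A d) (s : ℕ → ℕ → S) (a : ℕ → ℕ → A)

/-- The weight `σ̂_{k,h}` along a trajectory. -/
def sigSeq (h k : ℕ) : ℝ := (c.run s a k).sigHat c h (s k h) (a k h)

/-- The weighted feature `σ̂_{k,h}⁻¹ φ(s_h^k, a_h^k)`. -/
def xHat (h k : ℕ) : Fin d → ℝ := (sigSeq c s a h k)⁻¹ • c.phi (s k h) (a k h)

/-- The weighted feature `σ̃_{k,h}⁻¹ φ(s_h^k, a_h^k)`. -/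
def xTil (h k : ℕ) : Fin d → ℝ :=
  ((c.run s a k).sigTil c h (s k h) (a k h))⁻¹ • c.phi (s k h) (a k h)

/-- The norm `‖σ̂_{k,h}⁻¹ φ(s_h^k, a_h^k)‖` with respect to `Λ̂_{k,h}⁻¹`. -/
def wSeq (h k : ℕ) : ℝ := wnorm (gram c.lam (xHat c s a h) k)⁻¹ (xHat c s a h k)

lemma vecMulVec_smul_self (t : ℝ) (x : Fin d → ℝ) :
    vecMulVec (t⁻¹ • x) (t⁻¹ • x) = (t ^ 2)⁻¹ • vecMulVec x x := by
  ext i j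
  simp [vecMulVec_apply, sq]
  ring

lemma run_lamHat (h k : ℕ) : (c.run s a k).lamHat h = gram c.lam (xHat c s a h) k := by
  induction k with
  | zero => rw [gram_zero]; rfl
  | succ k ih =>
    rw [gram_succ, ← ih, xHat, vecMulVec_smul_self]
    rfl

lemma run_lamTil (h k : ℕ) : (c.run s a k).lamTil h = gram c.lam (xTil c s a h) k := by
  induction k with
  | zero => rw [gram_zero]; rfl
  | succ k ih =>
    rw [gram_succ, ← ih, xTil, vecMulVec_smul_self]
    rfl

lemma integrable_dirac_vectorMeasure {V : S → ℝ} (hV : Measurable V) (x : S) (v : ℝ) :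
    VectorMeasure.Integrable (VectorMeasure.dirac x v) V := by
  rw [VectorMeasure.Integrable, VectorMeasure.variation_dirac]
  exact (integrable_dirac' hV.stronglyMeasurable (by simp)).smul_measure (by simp)

lemma run_resp_succ (h k : ℕ) (j : Fin d) : (c.run s a (k + 1)).resp h j =
    (c.run s a k).resp h j +
      VectorMeasure.dirac (s k (h + 1)) ((sigSeq c s a h k ^ 2)⁻¹ * c.phi (s k h) (a k h) j) :=
  rfl

/-- Every measurable function is integrable, as the responses are finite sums of point masses. -/
lemma integrable_run_resp (h k : ℕ) (j : Fin d) {V : S → ℝ} (hV : Measurable V) :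
    VectorMeasure.Integrable ((c.run s a k).resp h j) V := by
  induction k with
  | zero => exact VectorMeasure.Integrable.zero_vectorMeasure
  | succ k ih =>
    rw [run_resp_succ]
    exact ih.add_vectorMeasure (integrable_dirac_vectorMeasure hV _ _)

lemma integral_run_resp (h k : ℕ) (j : Fin d) {V : S → ℝ} (hV : Measurable V) :
    ∫ᵛ x, V x ∂•((c.run s a k).resp h j) =
      ∑ i ∈ Finset.range k, ((sigSeq c s a h i)⁻¹ * V (s i (h + 1))) * xHat c s a h i j := by
  induction k with
  | zero => simp [Config.run, Config.init]
  | succ k ih =>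
    rw [Finset.sum_range_succ, ← ih, run_resp_succ, VectorMeasure.integral_add_vectorMeasure
      (integrable_run_resp c s a h k j hV) (integrable_dirac_vectorMeasure hV _ _)]
    congr 1
    rw [VectorMeasure.integral_dirac' hV.stronglyMeasurable]
    simp [xHat]
    ring

lemma muApply_muHat (h k : ℕ) {V : S → ℝ} (hV : Measurable V) :
    muApply ((c.run s a k).muHat h) V = (gram c.lam (xHat c s a h) k)⁻¹ *ᵥ
      ∑ i ∈ Finset.range k, ((sigSeq c s a h i)⁻¹ * V (s i (h + 1))) • xHat c s a h i := by
  ext i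
  have := muApply_linear_comb (fun i j => ((c.run s a k).lamHat h)⁻¹ i j)
    ((c.run s a k).resp h) (fun j => integrable_run_resp c s a h k j hV) i
  refine this.trans ?_
  rw [run_lamHat, mulVec, dotProduct]
  refine Finset.sum_congr rfl fun j _ => ?_
  rw [integral_run_resp c s a h k j hV]
  simp

lemma gram_mulVec (lam : ℝ) (x : ℕ → Fin d → ℝ) (k : ℕ) (v : Fin d → ℝ) :
    gram lam x k *ᵥ v = lam • v + ∑ i ∈ Finset.range k, (x i ⬝ᵥ v) • x i := by
  induction k with
  | zero => simp [gram_zero, smul_mulVec]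
  | succ k ih =>
    rw [gram_succ, add_mulVec, ih, Finset.sum_range_succ, vecMulVec_mulVec, add_assoc]
    simp

variable {c}

lemma sigSeq_pos (hH : 0 < c.H) (hd : 0 < d) (h k : ℕ) : 0 < sigSeq c s a h k :=
  State.sigHat_pos _ hH hd _ _ _

lemma le_sigSeq_sq (hH : 0 < c.H) (hd : 0 < d) (h k : ℕ) : (c.H : ℝ) ≤ sigSeq c s a h k ^ 2 :=
  State.le_sigHat_sq _ hH hd _ _ _

lemma inv_sigSeq_sq_le (hH : 0 < c.H) (hd : 0 < d) (h k : ℕ) :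
    (sigSeq c s a h k)⁻¹ ^ 2 ≤ (c.H : ℝ)⁻¹ := by
  rw [inv_pow]
  exact inv_anti₀ (by exact_mod_cast hH) (le_sigSeq_sq s a hH hd h k)

lemma enorm2_xHat (hH : 0 < c.H) (hd : 0 < d) (h k : ℕ) : enorm2 (xHat c s a h k) =
    (sigSeq c s a h k)⁻¹ * enorm2 (c.phi (s k h) (a k h)) := by
  rw [xHat, enorm2_smul, abs_of_pos (inv_pos.mpr (sigSeq_pos s a hH hd h k))]

lemma enorm2_xHat_le (hH : 0 < c.H) (hd : 0 < d) (hphi : ∀ x b, enorm2 (c.phi x b) ≤ 1) (h k : ℕ) :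
    enorm2 (xHat c s a h k) ≤ (sigSeq c s a h k)⁻¹ := by
  rw [enorm2_xHat s a hH hd]
  exact mul_le_of_le_one_right (inv_pos.mpr (sigSeq_pos s a hH hd h k)).le (hphi _ _)

lemma enorm2_xHat_sq_le (hH : 0 < c.H) (hd : 0 < d) (hphi : ∀ x b, enorm2 (c.phi x b) ≤ 1)
    (h k : ℕ) : enorm2 (xHat c s a h k) ^ 2 ≤ (c.H : ℝ)⁻¹ :=
  (pow_le_pow_left₀ (enorm2_nonneg _) (enorm2_xHat_le s a hH hd hphi h k) 2).trans
    (inv_sigSeq_sq_le s a hH hd h k)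

/-- Small features have small width also with respect to `Λ̂`, because the weights `σ̂` exceed `σ̃`
at most by the factor `√(H³ d⁵)`. -/
lemma sigSeq_or_wSeq (hH : 0 < c.H) (hd : 0 < d) (hl : 0 < c.lam) (h k : ℕ) :
    (c.H : ℝ) ^ 2 * Real.sqrt ((d : ℝ) ^ 5) ≤ sigSeq c s a h k ∨
      wSeq c s a h k ≤ 1 / Real.sqrt ((c.H : ℝ) ^ 3 * d ^ 5) := by
  have hHr : (0 : ℝ) < c.H := by exact_mod_cast hH
  have hdr : (0 : ℝ) < d := by exact_mod_cast hd
  set st := c.run s a k with hst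
  by_cases hcase : wnorm (st.lamTil h)⁻¹
      ((st.sigTil c h (s k h) (a k h))⁻¹ • c.phi (s k h) (a k h)) ≤ 1 / ((c.H : ℝ) ^ 3 * d ^ 5)
  · right
    set B := (c.H : ℝ) ^ 3 * d ^ 5 with hB
    have hB0 : 0 < B := by positivity
    have h1 : wSeq c s a h k ≤ wnorm (gram c.lam (xHat c s a h) k)⁻¹ (xTil c s a h k) := by
      rw [wSeq, xHat, xTil, wnorm_smul, wnorm_smul]
      apply mul_le_mul_of_nonneg_right _ (wnorm_nonneg _ _)
      rw [abs_of_pos (inv_pos.mpr (sigSeq_pos s a hH hd h k)),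
        abs_of_pos (inv_pos.mpr (State.sigTil_pos _ hH _ _ _))]
      exact inv_anti₀ (State.sigTil_pos _ hH _ _ _) (State.sigTil_le_sigHat _ hH hd _ _ _)
    have h2 := wnorm_inv_le_of_quad_le (gram_posDef hl (xTil c s a h) k)
      (gram_posDef hl (xHat c s a h) k) hB0.le (fun v => ?_) (xTil c s a h k)
    · have h3 : wnorm (gram c.lam (xTil c s a h) k)⁻¹ (xTil c s a h k) ≤ 1 / B := by
        rw [← run_lamTil]; exact hcase
      refine h1.trans (h2.trans ((mul_le_mul_of_nonneg_left h3 (Real.sqrt_nonneg _)).trans_eq ?_))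
      have h4 := Real.mul_self_sqrt hB0.le
      have h5 : 0 < Real.sqrt B := Real.sqrt_pos.mpr hB0
      field_simp
      nlinarith
    · rw [quad_gram, quad_gram, mul_add, Finset.mul_sum]
      have hB1 : 1 ≤ B := by
        have h1 : (1 : ℝ) ≤ c.H := by exact_mod_cast hH
        have h2 : (1 : ℝ) ≤ d := by exact_mod_cast hd
        exact one_le_mul_of_one_le_of_one_le (one_le_pow₀ h1) (one_le_pow₀ h2)
      have hvv : 0 ≤ v ⬝ᵥ v := by rw [← enorm2_sq]; positivity
      refine add_le_add (le_mul_of_one_le_left (mul_nonneg hl.le hvv) hB1)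
        (Finset.sum_le_sum fun i _ => ?_)
      rw [xTil, xHat, smul_dotProduct, smul_dotProduct, smul_eq_mul, smul_eq_mul, mul_pow, mul_pow,
        ← mul_assoc]
      apply mul_le_mul_of_nonneg_right _ (sq_nonneg _)
      have h6 := (c.run s a i).sigHat_sq_le hH hd h (s i h) (a i h)
      have h7 := (c.run s a i).sigTil_pos hH h (s i h) (a i h)
      have h8 := sigSeq_pos s a hH hd h i
      rw [inv_pow, inv_pow, ← div_eq_mul_inv, le_div_iff₀ (by positivity), inv_mul_le_iff₀
        (by positivity), mul_comm]
      exact h6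
  · left
    have e : st.sigMin c h (s k h) (a k h) = (c.H : ℝ) ^ 2 * Real.sqrt ((d : ℝ) ^ 5) := by
      rw [State.sigMin, if_neg hcase]
    apply le_of_sq_le_sq _ (sigSeq_pos s a hH hd h k).le
    rw [← e, sigSeq, State.sigHat_sq]
    exact (le_max_left _ _).trans (le_max_left _ _)

/-- A weighted noise variable is bounded by `H / σ̂`. The factor `1 / (H √(d⁵))` comes from `σ̂` when
`σ̂ ≥ H² √(d⁵)`, and from the small width of the feature otherwise. -/
lemma noise_range_le (hH : 0 < c.H) (hd : 0 < d) (hl : 0 < c.lam) (h k : ℕ) :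
    ((sigSeq c s a h k)⁻¹ * c.H) * min 1 (wSeq c s a h k) ≤
      1 / ((c.H : ℝ) * Real.sqrt ((d : ℝ) ^ 5)) := by
  have hHr : (0 : ℝ) < c.H := by exact_mod_cast hH
  have hdr : (0 : ℝ) < d := by exact_mod_cast hd
  have hσ := sigSeq_pos s a hH hd h k
  have hw : 0 ≤ wSeq c s a h k := wnorm_nonneg _ _
  have hs5 : 0 < Real.sqrt ((d : ℝ) ^ 5) := Real.sqrt_pos.mpr (by positivity)
  rcases sigSeq_or_wSeq s a hH hd hl h k with hA | hB
  · calc _ ≤ ((sigSeq c s a h k)⁻¹ * c.H) * 1 :=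
          mul_le_mul_of_nonneg_left (min_le_left _ _) (by positivity)
      _ ≤ ((c.H : ℝ) ^ 2 * Real.sqrt ((d : ℝ) ^ 5))⁻¹ * c.H * 1 := by gcongr
      _ = _ := by field_simp
  · have h1 : (sigSeq c s a h k)⁻¹ ≤ (Real.sqrt c.H)⁻¹ := by
      apply inv_anti₀ (Real.sqrt_pos.mpr hHr)
      rw [Real.sqrt_le_left hσ.le]
      exact le_sigSeq_sq s a hH hd h k
    calc _ ≤ ((Real.sqrt c.H)⁻¹ * c.H) * (1 / Real.sqrt ((c.H : ℝ) ^ 3 * d ^ 5)) := by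
          apply mul_le_mul _ ((min_le_right _ _).trans hB) (le_min zero_le_one hw) (by positivity)
          gcongr
      _ = _ := by
          have e : Real.sqrt ((c.H : ℝ) ^ 3 * d ^ 5) =
              c.H * Real.sqrt c.H * Real.sqrt ((d : ℝ) ^ 5) := by
            rw [Real.sqrt_mul (by positivity), show (c.H : ℝ) ^ 3 = c.H ^ 2 * c.H by ring,
              Real.sqrt_mul (by positivity), Real.sqrt_sq hHr.le]
          have h2 := Real.mul_self_sqrt hHr.le
          have h3 : 0 < Real.sqrt c.H := Real.sqrt_pos.mpr hHr
          rw [e]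
          field_simp
          nlinarith

/-- The elliptical potential `∑_{i<k} log(1 + ‖x_i‖²)` is at most `d log(1 + K/(H d λ))`. -/
lemma sum_log_wSeq_le (hH : 0 < c.H) (hd : 0 < d) (hl : 0 < c.lam)
    (hphi : ∀ x b, enorm2 (c.phi x b) ≤ 1) {K : ℕ} (h : ℕ) {k : ℕ} (hk : k ≤ K) :
    ∑ i ∈ Finset.range k, Real.log (1 + wSeq c s a h i ^ 2) ≤
      d * Real.log (1 + K / (c.H * d * c.lam)) := by
  have hHr : (0 : ℝ) < c.H := by exact_mod_cast hH
  have hdr : (0 : ℝ) < d := by exact_mod_cast hd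
  refine (sum_log_le hd hl (xHat c s a h) k).trans ?_
  have h1 : ∑ i ∈ Finset.range k, enorm2 (xHat c s a h i) ^ 2 ≤ K * (c.H : ℝ)⁻¹ := by
    refine (Finset.sum_le_card_nsmul _ _ _ fun i _ => enorm2_xHat_sq_le s a hH hd hphi h i).trans ?_
    rw [Finset.card_range, nsmul_eq_mul]
    gcongr
  have h2 : 0 ≤ ∑ i ∈ Finset.range k, enorm2 (xHat c s a h i) ^ 2 :=
    Finset.sum_nonneg fun i _ => sq_nonneg _
  apply mul_le_mul_of_nonneg_left _ hdr.le
  apply Real.log_le_log (by positivity)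
  have : (K : ℝ) / (c.H * d * c.lam) = (K * (c.H : ℝ)⁻¹) / (d * c.lam) := by field_simp
  rw [this]
  gcongr

lemma sum_wSeq_ratio_le (hH : 0 < c.H) (hd : 0 < d) (hl : 0 < c.lam)
    (hphi : ∀ x b, enorm2 (c.phi x b) ≤ 1) {K : ℕ} (h : ℕ) {k : ℕ} (hk : k ≤ K) :
    ∑ i ∈ Finset.range k, wSeq c s a h i ^ 2 / (1 + wSeq c s a h i ^ 2) ≤
      d * Real.log (1 + K / (c.H * d * c.lam)) :=
  (Finset.sum_le_sum fun _ _ => div_one_add_le_log (sq_nonneg _)).trans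
    (sum_log_wSeq_le s a hH hd hl hphi h hk)

end Run

/-! ### The number of updates and the shape of the optimistic value functions -/

section Updates

lemma log_growth_aux {H K : ℝ} (hH : 2 ≤ H) (hK : 1 ≤ K) (hKH : K ≤ H ^ 3) :
    Real.log (1 + K / H ^ 2) + K / H ^ 3 ≤ Real.log (1 + K) := by
  have h1 : K / H ^ 2 ≤ K / 4 := by
    apply div_le_div_of_nonneg_left (by linarith) (by norm_num)
    nlinarith
  set q := K / H ^ 3 with hq
  have hq0 : 0 ≤ q := by positivity
  have hq1 : q ≤ 1 := div_le_one_of_le₀ hKH (by positivity)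
  have hq2 : q ≤ K / 8 := by
    apply div_le_div_of_nonneg_left (by linarith) (by norm_num)
    calc (8 : ℝ) = 2 ^ 3 := by norm_num
      _ ≤ H ^ 3 := by gcongr
  have h2 : Real.exp q ≤ 1 + q + q ^ 2 := by
    have := (abs_le.mp (Real.abs_exp_sub_one_sub_id_le (x := q)
      (abs_le.mpr ⟨by linarith, hq1⟩))).2
    linarith
  have h3 : (1 + K / 4) * (1 + q + q ^ 2) ≤ 1 + K := by
    rcases le_or_gt K 8 with hK8 | hK8
    · have : 1 + q + q ^ 2 ≤ 1 + K / 8 + (K / 8) ^ 2 := by nlinarith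
      have h4 := mul_le_mul_of_nonneg_left this (by linarith : 0 ≤ 1 + K / 4)
      nlinarith [mul_nonneg (sub_nonneg.mpr hK) (sub_nonneg.mpr hK8), sq_nonneg K,
        mul_nonneg (mul_nonneg (by linarith : 0 ≤ K) (by linarith : 0 ≤ K)) (sub_nonneg.mpr hK8)]
    · have : 1 + q + q ^ 2 ≤ 3 := by nlinarith
      have h4 := mul_le_mul_of_nonneg_left this (by linarith : 0 ≤ 1 + K / 4)
      linarith
  have h4 : (1 + K / H ^ 2) * Real.exp q ≤ 1 + K :=
    (mul_le_mul (by linarith) h2 (Real.exp_pos _).le (by linarith)).trans h3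
  have h5 := Real.log_le_log (by positivity) h4
  rwa [Real.log_mul (by positivity) (Real.exp_pos _).ne', Real.log_exp] at h5

lemma log_growth_aux' {H K : ℝ} (hH : 1 ≤ H) (hKH : H ^ 3 ≤ K) :
    3 * Real.log (1 + K * H) ≤ 4 * Real.log (1 + K) := by
  have hK : 1 ≤ K := (one_le_pow₀ hH).trans hKH
  have hH2 : H ^ 2 ≤ K := (pow_le_pow_right₀ hH (by norm_num)).trans hKH
  have hH1 : H ≤ K := (le_self_pow₀ hH (by norm_num)).trans hKH
  have h : (1 + K * H) ^ 3 ≤ (1 + K) ^ 4 := by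
    have e1 : K * H ≤ K * K := by gcongr
    have e2 : K ^ 2 * H ^ 2 ≤ K ^ 2 * K := by gcongr
    have e3 : K ^ 3 * H ^ 3 ≤ K ^ 3 * K := by gcongr
    nlinarith [sq_nonneg K, pow_pos (by linarith : 0 < K) 3]
  have hl := Real.log_le_log (by positivity) h
  rw [Real.log_pow, Real.log_pow] at hl
  exact_mod_cast hl

variable {S A : Type*} [MeasurableSpace S] {d : ℕ} [Fintype A] [Nonempty A] {c : Config S A d}
  (s : ℕ → ℕ → S) (a : ℕ → ℕ → A)

/-- For `K ≤ H³` the elliptical potential is at most `d log(1 + K)`: steps with a large weight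
`σ̂ ≥ H² √(d⁵)` contribute like a Gram matrix of small trace, the others are individually small. -/
lemma sum_log_wSeq_le_of_le (hH : 2 ≤ c.H) (hd : 0 < d)
    (hl : 1 / ((c.H : ℝ) ^ 2 * Real.sqrt d) ≤ c.lam)
    (hphi : ∀ x b, enorm2 (c.phi x b) ≤ 1) {K : ℕ} (hK0 : 0 < K) (hKH : (K : ℝ) ≤ (c.H : ℝ) ^ 3)
    (h : ℕ) {k : ℕ} (hk : k ≤ K) :
    ∑ i ∈ Finset.range k, Real.log (1 + wSeq c s a h i ^ 2) ≤ d * Real.log (1 + K) := by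
  classical
  have hHr : (2 : ℝ) ≤ c.H := by exact_mod_cast hH
  have hdr : (1 : ℝ) ≤ d := by exact_mod_cast hd
  have hKr : (1 : ℝ) ≤ K := by exact_mod_cast hK0
  have hsd : 0 < Real.sqrt d := Real.sqrt_pos.mpr (by linarith)
  have hl0 : 0 < c.lam := lt_of_lt_of_le (by positivity) hl
  have hH0 : 0 < c.H := by omega
  set B := (c.H : ℝ) ^ 2 * Real.sqrt ((d : ℝ) ^ 5) with hB
  -- Only the steps with a large weight are kept.
  let xA : ℕ → Fin d → ℝ := fun i => if B ≤ sigSeq c s a h i then xHat c s a h i else 0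
  have hstep : ∀ i, Real.log (1 + wSeq c s a h i ^ 2) ≤
      Real.log (1 + wnorm (gram c.lam xA i)⁻¹ (xA i) ^ 2) + 1 / ((c.H : ℝ) ^ 3 * d ^ 5) := by
    intro i
    by_cases hi : B ≤ sigSeq c s a h i
    · have e : xA i = xHat c s a h i := if_pos hi
      have h1 := wnorm_inv_le_of_quad_le (gram_posDef hl0 xA i)
        (gram_posDef hl0 (xHat c s a h) i) zero_le_one (fun v => ?_) (xHat c s a h i)
      · rw [Real.sqrt_one, one_mul] at h1
        have h2 : Real.log (1 + wSeq c s a h i ^ 2) ≤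
            Real.log (1 + wnorm (gram c.lam xA i)⁻¹ (xA i) ^ 2) := by
          rw [e]
          apply Real.log_le_log (by positivity)
          have := pow_le_pow_left₀ (wnorm_nonneg _ _) h1 2
          rw [wSeq]
          linarith
        have : 0 ≤ 1 / ((c.H : ℝ) ^ 3 * d ^ 5) := by positivity
        linarith
      · rw [quad_gram, quad_gram, one_mul]
        refine add_le_add le_rfl (Finset.sum_le_sum fun j _ => ?_)
        simp only [xA]
        split_ifs
        · exact le_rfl
        · simp [sq_nonneg]
    · have hw := (sigSeq_or_wSeq s a hH0 hd hl0 h i).resolve_left hi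
      have h1 : 0 ≤ Real.log (1 + wnorm (gram c.lam xA i)⁻¹ (xA i) ^ 2) :=
        Real.log_nonneg (by nlinarith [sq_nonneg (wnorm (gram c.lam xA i)⁻¹ (xA i))])
      have h2 : Real.log (1 + wSeq c s a h i ^ 2) ≤ wSeq c s a h i ^ 2 := by
        have := Real.log_le_sub_one_of_pos (show 0 < 1 + wSeq c s a h i ^ 2 by positivity)
        linarith
      have hw0 : 0 ≤ wSeq c s a h i := wnorm_nonneg _ _
      have h3 : wSeq c s a h i ^ 2 ≤ (1 / Real.sqrt ((c.H : ℝ) ^ 3 * d ^ 5)) ^ 2 :=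
        pow_le_pow_left₀ hw0 hw 2
      rw [div_pow, one_pow, Real.sq_sqrt (by positivity)] at h3
      linarith
  refine (Finset.sum_le_sum fun i _ => hstep i).trans ?_
  rw [Finset.sum_add_distrib, Finset.sum_const, Finset.card_range, nsmul_eq_mul]
  have hA := sum_log_le hd hl0 xA k
  have hxA : ∀ i, enorm2 (xA i) ^ 2 ≤ 1 / ((c.H : ℝ) ^ 4 * d ^ 5) := by
    intro i
    simp only [xA]
    split_ifs with hi
    · have h1 := enorm2_xHat_le s a hH0 hd hphi h i
      have hB0 : 0 < B := by positivity
      have h2 := h1.trans (inv_anti₀ hB0 hi)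
      have h3 := pow_le_pow_left₀ (enorm2_nonneg _) h2 2
      refine h3.trans_eq ?_
      rw [hB, inv_pow, mul_pow, Real.sq_sqrt (by positivity), one_div]
      ring
    · have : enorm2 (0 : Fin d → ℝ) = 0 := by simp [enorm2]
      rw [this]
      simp only [ne_eq, OfNat.ofNat_ne_zero, not_false_eq_true, zero_pow]
      positivity
  have hsum : (∑ i ∈ Finset.range k, enorm2 (xA i) ^ 2) / (d * c.lam) ≤ K / (c.H : ℝ) ^ 2 := by
    have h1 : ∑ i ∈ Finset.range k, enorm2 (xA i) ^ 2 ≤ K * (1 / ((c.H : ℝ) ^ 4 * d ^ 5)) := by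
      refine (Finset.sum_le_card_nsmul _ _ _ fun i _ => hxA i).trans ?_
      rw [Finset.card_range, nsmul_eq_mul]
      gcongr
    rw [div_le_iff₀ (by positivity)]
    refine h1.trans ?_
    have h2 : (K : ℝ) / (c.H : ℝ) ^ 2 * (d * (1 / ((c.H : ℝ) ^ 2 * Real.sqrt d))) ≤
        K / (c.H : ℝ) ^ 2 * (d * c.lam) := by gcongr
    refine le_trans ?_ h2
    have h3 : Real.sqrt d ≤ (d : ℝ) ^ 6 := by
      have h4 : Real.sqrt d ≤ d := by
        rw [Real.sqrt_le_left (by linarith)]; nlinarith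
      exact h4.trans (le_self_pow₀ hdr (by norm_num))
    rw [show (K : ℝ) / (c.H : ℝ) ^ 2 * (d * (1 / ((c.H : ℝ) ^ 2 * Real.sqrt d))) =
      K * (1 / ((c.H : ℝ) ^ 4 * (Real.sqrt d / d))) by field_simp]
    gcongr
    rw [div_le_iff₀ (by linarith)]
    calc Real.sqrt d ≤ (d : ℝ) ^ 6 := h3
      _ = _ := by ring
  have hA2 : (d : ℝ) * Real.log (1 + (∑ i ∈ Finset.range k, enorm2 (xA i) ^ 2) / (d * c.lam)) ≤
      d * Real.log (1 + K / (c.H : ℝ) ^ 2) := by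
    apply mul_le_mul_of_nonneg_left _ (by linarith)
    apply Real.log_le_log _ (by linarith)
    have : 0 ≤ (∑ i ∈ Finset.range k, enorm2 (xA i) ^ 2) / (d * c.lam) :=
      div_nonneg (Finset.sum_nonneg fun i _ => sq_nonneg _) (by positivity)
    linarith
  have hB2 : (k : ℝ) * (1 / ((c.H : ℝ) ^ 3 * d ^ 5)) ≤ d * (K / (c.H : ℝ) ^ 3) := by
    have h1 : (k : ℝ) ≤ K := by exact_mod_cast hk
    have h2 : (1 : ℝ) ≤ (d : ℝ) ^ 5 := one_le_pow₀ hdr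
    calc (k : ℝ) * (1 / ((c.H : ℝ) ^ 3 * d ^ 5)) ≤ K * (1 / ((c.H : ℝ) ^ 3 * 1)) := by gcongr
      _ = 1 * (K / (c.H : ℝ) ^ 3) := by ring
      _ ≤ _ := by gcongr
  have hfin := mul_le_mul_of_nonneg_left (log_growth_aux hHr hKr hKH) (by linarith : (0 : ℝ) ≤ d)
  linarith

/-- The elliptical potential is at most `2 log 2 · d log(1 + K)`, uniformly in `H`. -/
lemma sum_log_wSeq_le_log_two (hH : 2 ≤ c.H) (hd : 0 < d)
    (hl : 1 / ((c.H : ℝ) ^ 2 * Real.sqrt d) ≤ c.lam)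
    (hphi : ∀ x b, enorm2 (c.phi x b) ≤ 1) {K : ℕ} (hK0 : 0 < K) (h : ℕ) {k : ℕ} (hk : k ≤ K) :
    ∑ i ∈ Finset.range k, Real.log (1 + wSeq c s a h i ^ 2) ≤
      2 * Real.log 2 * (d * Real.log (1 + K)) := by
  have hHr : (2 : ℝ) ≤ c.H := by exact_mod_cast hH
  have hdr : (1 : ℝ) ≤ d := by exact_mod_cast hd
  have hKr : (1 : ℝ) ≤ K := by exact_mod_cast hK0
  have hsd : 0 < Real.sqrt d := Real.sqrt_pos.mpr (by linarith)
  have hl0 : 0 < c.lam := lt_of_lt_of_le (by positivity) hl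
  have hlog : 0 ≤ Real.log (1 + (K : ℝ)) := Real.log_nonneg (by linarith)
  have hl2 := Real.log_two_gt_d9
  rcases le_or_gt (K : ℝ) ((c.H : ℝ) ^ 3) with hKH | hKH
  · refine (sum_log_wSeq_le_of_le s a hH hd hl hphi hK0 hKH h hk).trans ?_
    exact le_mul_of_one_le_left (by positivity) (by linarith)
  · refine (sum_log_wSeq_le s a (by omega) hd hl0 hphi h hk).trans ?_
    have h1 : (K : ℝ) / (c.H * d * c.lam) ≤ K * c.H := by
      rw [div_le_iff₀ (by positivity)]
      have h2 : (K : ℝ) * c.H * (c.H * d * (1 / ((c.H : ℝ) ^ 2 * Real.sqrt d))) ≤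
        K * c.H * (c.H * d * c.lam) := by gcongr
      refine le_trans ?_ h2
      have h3 : Real.sqrt d * Real.sqrt d = d := Real.mul_self_sqrt (by linarith)
      have h4 : (K : ℝ) * c.H * (c.H * d * (1 / ((c.H : ℝ) ^ 2 * Real.sqrt d))) =
          K * Real.sqrt d := by
        field_simp
        nlinarith
      rw [h4]
      exact le_mul_of_one_le_right (by linarith) (Real.one_le_sqrt.mpr hdr)
    have h2 := Real.log_le_log (by positivity)
      (show 1 + (K : ℝ) / (c.H * d * c.lam) ≤ 1 + K * c.H by linarith)
    have h3 := log_growth_aux' (by linarith : (1 : ℝ) ≤ c.H) hKH.le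
    have h4 : Real.log (1 + (K : ℝ) / (c.H * d * c.lam)) ≤ 2 * Real.log 2 * Real.log (1 + K) := by
      nlinarith
    calc _ ≤ (d : ℝ) * (2 * Real.log 2 * Real.log (1 + K)) := by gcongr
      _ = _ := by ring

open Classical in
/-- The episodes before `k` in which the optimistic value functions are updated. -/
def updSet (c : Config S A d) (s : ℕ → ℕ → S) (a : ℕ → ℕ → A) (k : ℕ) : Finset ℕ :=
  (Finset.range k).filter fun j => (c.run s a j).Updates c

lemma updSet_succ_of_updates {k : ℕ} (hu : (c.run s a k).Updates c) :
    updSet c s a (k + 1) = insert k (updSet c s a k) := by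
  rw [updSet, updSet, Finset.range_add_one, Finset.filter_insert, if_pos hu]

lemma updSet_succ_of_not_updates {k : ℕ} (hu : ¬(c.run s a k).Updates c) :
    updSet c s a (k + 1) = updSet c s a k := by
  rw [updSet, updSet, Finset.range_add_one, Finset.filter_insert, if_neg hu]

lemma det_lamHat_mono (hl : 0 < c.lam) (h : ℕ) {j k : ℕ} (hjk : j ≤ k) :
    ((c.run s a j).lamHat h).det ≤ ((c.run s a k).lamHat h).det := by
  rw [run_lamHat, run_lamHat]
  induction k, hjk using Nat.le_induction with
  | base => exact le_rfl
  | succ k _ ih =>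
    rw [det_gram_succ hl]
    exact ih.trans (le_mul_of_one_le_right (gram_posDef hl _ k).det_pos.le
      (by nlinarith [sq_nonneg (wnorm (gram c.lam (xHat c s a h) k)⁻¹ (xHat c s a h k))]))

open Classical in
lemma run_lamLast (k : ℕ) : ∃ j ≤ k, (c.run s a k).lamLast = (c.run s a j).lamHat := by
  induction k with
  | zero => exact ⟨0, le_rfl, rfl⟩
  | succ k ih =>
    obtain ⟨j, hj, he⟩ := ih
    by_cases hu : (c.run s a k).Updates c
    · refine ⟨k, Nat.le_succ k, ?_⟩
      change (if (c.run s a k).Updates c then _ else _) = _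
      rw [if_pos hu]
    · refine ⟨j, hj.trans (Nat.le_succ k), ?_⟩
      change (if (c.run s a k).Updates c then _ else _) = _
      rw [if_neg hu, he]

open Classical in
/-- Each update doubles one of the determinants. -/
lemma card_updSet_mul_log_two_le (hl : 0 < c.lam) (k : ℕ) :
    ((updSet c s a k).card : ℝ) * Real.log 2 + c.H * Real.log (c.lam ^ d) ≤
      ∑ h ∈ Finset.range c.H, Real.log ((c.run s a k).lamLast h).det := by
  induction k with
  | zero =>
    simp [updSet, Config.run, Config.init]
  | succ k ih =>
    by_cases hu : (c.run s a k).Updates c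
    · have e : (c.run s a (k + 1)).lamLast = (c.run s a k).lamHat := by
        change (if (c.run s a k).Updates c then _ else _) = _
        rw [if_pos hu]
      rw [updSet_succ_of_updates s a hu, e, Finset.card_insert_of_notMem (by simp [updSet])]
      obtain ⟨h0, hh0, hdet⟩ := hu
      obtain ⟨j, hj, he⟩ := run_lamLast (c := c) s a k
      have hpos : ∀ h, 0 < ((c.run s a k).lamLast h).det := fun h => by
        rw [he, run_lamHat]; exact (gram_posDef hl _ _).det_pos
      have h1 : ∀ h ∈ Finset.range c.H, Real.log ((c.run s a k).lamLast h).det +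
          (if h = h0 then Real.log 2 else 0) ≤ Real.log ((c.run s a k).lamHat h).det := by
        intro h _
        split_ifs with hh
        · subst hh
          rw [add_comm, ← Real.log_mul (by norm_num) (hpos h).ne']
          exact Real.log_le_log (mul_pos (by norm_num) (hpos h)) hdet
        · rw [add_zero]
          apply Real.log_le_log (hpos h)
          rw [he]
          exact det_lamHat_mono s a hl h hj
      have h2 := Finset.sum_le_sum h1
      rw [Finset.sum_add_distrib, Finset.sum_ite_eq' (Finset.range c.H) h0,
        if_pos (Finset.mem_range.mpr hh0)] at h2
      push_cast
      linarith
    · have e : (c.run s a (k + 1)).lamLast = (c.run s a k).lamLast := by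
        change (if (c.run s a k).Updates c then _ else _) = _
        rw [if_neg hu]
      rw [updSet_succ_of_not_updates s a hu, e]
      exact ih

/-- The number of updates is at most `2 J`. -/
lemma card_updSet_le (hH : 2 ≤ c.H) (hd : 0 < d)
    (hl : 1 / ((c.H : ℝ) ^ 2 * Real.sqrt d) ≤ c.lam)
    (hphi : ∀ x b, enorm2 (c.phi x b) ≤ 1) {K : ℕ} (hK0 : 0 < K) {k : ℕ} (hk : k ≤ K) :
    ((updSet c s a k).card : ℝ) ≤ 2 * numJ d c.H K := by
  have hHr : (2 : ℝ) ≤ c.H := by exact_mod_cast hH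
  have hdr : (1 : ℝ) ≤ d := by exact_mod_cast hd
  have hsd : 0 < Real.sqrt d := Real.sqrt_pos.mpr (by linarith)
  have hl0 : 0 < c.lam := lt_of_lt_of_le (by positivity) hl
  have h1 := card_updSet_mul_log_two_le s a hl0 k
  obtain ⟨j, hj, he⟩ := run_lamLast (c := c) s a k
  have h2 : ∀ h ∈ Finset.range c.H, Real.log ((c.run s a k).lamLast h).det ≤
      Real.log (c.lam ^ d) + 2 * Real.log 2 * (d * Real.log (1 + K)) := by
    intro h _
    rw [he, run_lamHat, log_det_gram hl0]
    exact add_le_add le_rfl (sum_log_wSeq_le_log_two s a hH hd hl hphi hK0 h (hj.trans hk))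
  have h3 := h1.trans (Finset.sum_le_card_nsmul _ _ _ h2)
  rw [Finset.card_range, nsmul_eq_mul] at h3
  have hl2 : 0 < Real.log 2 := Real.log_pos (by norm_num)
  apply le_of_mul_le_mul_right _ hl2
  rw [numJ]
  linarith

/-- The function that enters the minimum `Q̂` when an update is made in episode `j`. -/
def updPiece (c : Config S A d) (s : ℕ → ℕ → S) (a : ℕ → ℕ → A) (j h : ℕ) (x : S) (b : A) : ℝ :=
  c.reward h x b + (c.run s a j).pHat c h ((c.run s a j).vHat c (h + 1)) x b +
    c.bHat * (c.run s a j).width c h x b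

lemma le_qPrev_iff (k h : ℕ) (x : S) (b : A) (y : ℝ) :
    y ≤ (c.run s a k).qPrev h x b ↔ y ≤ c.H ∧ ∀ j ∈ updSet c s a k, y ≤ updPiece c s a j h x b := by
  induction k with
  | zero =>
    simp [Config.run, Config.init, updSet]
  | succ k ih =>
    change y ≤ (c.run s a k).qHatOf c h ((c.run s a k).vHat c (h + 1)) x b ↔ _
    rw [State.qHatOf]
    by_cases hu : (c.run s a k).Updates c
    · rw [if_pos hu, le_min_iff, le_min_iff, ih, updSet_succ_of_updates s a hu,
        Finset.forall_mem_insert, updPiece]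
      tauto
    · rw [if_neg hu, ih, updSet_succ_of_not_updates s a hu]

lemma qPrev_succ (k : ℕ) : (c.run s a (k + 1)).qPrev = (c.run s a k).qHat c := rfl

lemma qHat_le_qPrev (k h : ℕ) (x : S) (b : A) :
    (c.run s a k).qHat c h x b ≤ (c.run s a k).qPrev h x b := by
  rw [State.qHat, State.qHatOf]
  split_ifs
  · exact (min_le_left _ _).trans (min_le_right _ _)
  · exact le_rfl

lemma qPrev_anti (h : ℕ) (x : S) (b : A) : Antitone fun k => (c.run s a k).qPrev h x b :=
  antitone_nat_of_succ_le fun k => qHat_le_qPrev s a k h x b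

lemma qHat_le_H (k h : ℕ) (x : S) (b : A) : (c.run s a k).qHat c h x b ≤ c.H :=
  ((le_qPrev_iff s a (k + 1) h x b _).mp le_rfl).1

lemma vHat_anti (h : ℕ) (x : S) : Antitone fun k => (c.run s a k).vHat c h x := by
  intro i k hik
  rcases lt_or_ge h c.H with hh | hh
  · simp only [State.vHat_of_lt _ _ hh]
    refine Finset.sup'_le _ _ fun b _ => ?_
    refine le_trans ?_ (Finset.le_sup' (fun b => (c.run s a i).qHat c h x b) (Finset.mem_univ b))
    exact qPrev_anti s a h x b (Nat.succ_le_succ hik)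
  · simp only [State.vHat_of_ge _ _ hh]
    exact le_rfl

lemma vHat_le_H (k h : ℕ) (x : S) : (c.run s a k).vHat c h x ≤ c.H := by
  rcases lt_or_ge h c.H with hh | hh
  · rw [State.vHat_of_lt _ _ hh]
    exact Finset.sup'_le _ _ fun b _ => qHat_le_H s a k h x b
  · rw [State.vHat_of_ge _ _ hh]
    exact Nat.cast_nonneg _

end Updates

/-! ### Measurability of the run in the trajectory -/

section RunMeasurable

variable {S A Ω : Type*} [MeasurableSpace S] [Fintype A] [Nonempty A] {d : ℕ} {c : Config S A d}

/-- The state of the learner in episode `k`, as a function of the outcome. -/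
def runAt (c : Config S A d) (s : ℕ → ℕ → Ω → S) (a : ℕ → ℕ → Ω → A) (k : ℕ) (ω : Ω) :
    State S A d :=
  c.run (fun i l => s i l ω) (fun i l => a i l ω) k

omit [Nonempty A] in
lemma measurable_uncurry_of_finite [MeasurableSpace A] [MeasurableSingletonClass A]
    {Ω' : Type*} [MeasurableSpace Ω'] {f : Ω' → S → A → ℝ}
    (hf : ∀ b, Measurable fun p : Ω' × S => f p.1 p.2 b) {x : Ω' → S} (hx : Measurable x)
    {b : Ω' → A} (hb : Measurable b) : Measurable fun ω => f ω (x ω) (b ω) := by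
  have h : Measurable fun q : (Ω' × S) × A => f q.1.1 q.1.2 q.2 :=
    measurable_from_prod_countable_left hf
  exact h.comp ((measurable_id.prodMk hx).prodMk hb)

variable [MeasurableSpace Ω] {s : ℕ → ℕ → Ω → S} {a : ℕ → ℕ → Ω → A}

/-- Measurability of the data from which the state in episode `k` is built. -/
structure RunMeas (c : Config S A d) (s : ℕ → ℕ → Ω → S) (a : ℕ → ℕ → Ω → A) (k : ℕ) : Prop where
  state : ∀ j < k, ∀ l < c.H, Measurable (s j l)
  sig : ∀ j < k, ∀ h < c.H, Measurable fun ω =>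
    sigSeq c (fun i l => s i l ω) (fun i l => a i l ω) h j
  xHat : ∀ j < k, ∀ h < c.H, Measurable fun ω =>
    xHat c (fun i l => s i l ω) (fun i l => a i l ω) h j
  xTil : ∀ j < k, ∀ h < c.H, Measurable fun ω =>
    xTil c (fun i l => s i l ω) (fun i l => a i l ω) h j
  lamLast : ∀ h < c.H, ∀ i j, Measurable fun ω => (runAt c s a k ω).lamLast h i j
  qPrev : ∀ h < c.H, ∀ b, Measurable fun p : Ω × S => (runAt c s a k p.1).qPrev h p.2 b

namespace RunMeas

variable {k : ℕ} (hm : RunMeas c s a k) (hphi : ∀ b, Measurable fun x => c.phi x b)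
  (hr : ∀ h b, Measurable fun x => c.reward h x b)

include hm

lemma lamHat {h : ℕ} (hh : h < c.H) (i j : Fin d) :
    Measurable fun ω => (runAt c s a k ω).lamHat h i j := by
  simp only [runAt, run_lamHat]
  exact measurable_gram_apply (x := fun l ω => LinMDP.xHat c (fun i l => s i l ω)
    (fun i l => a i l ω) h l) c.lam (fun l hl => hm.xHat l hl h hh) i j

lemma lamTil {h : ℕ} (hh : h < c.H) (i j : Fin d) :
    Measurable fun ω => (runAt c s a k ω).lamTil h i j := by
  simp only [runAt, run_lamTil]
  exact measurable_gram_apply (x := fun l ω => LinMDP.xTil c (fun i l => s i l ω)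
    (fun i l => a i l ω) h l) c.lam (fun l hl => hm.xTil l hl h hh) i j

lemma updates : MeasurableSet {ω | (runAt c s a k ω).Updates c} := by
  have : {ω | (runAt c s a k ω).Updates c} = ⋃ h, ⋃ (_ : h < c.H),
      {ω | 2 * ((runAt c s a k ω).lamLast h).det ≤ ((runAt c s a k ω).lamHat h).det} := by
    ext ω
    simp [State.Updates]
  rw [this]
  refine MeasurableSet.iUnion fun h => MeasurableSet.iUnion fun hh => ?_
  exact measurableSet_le ((measurable_det (hm.lamLast h hh)).const_mul 2)
    (measurable_det fun i j => hm.lamHat hh i j)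

include hphi

lemma width {h : ℕ} (hh : h < c.H) (b : A) :
    Measurable fun p : Ω × S => (runAt c s a k p.1).width c h p.2 b :=
  measurable_wnorm (fun i j => (measurable_inv_apply (fun i j => hm.lamHat hh i j) i j).comp
    measurable_fst) ((hphi b).comp measurable_snd)

/-- The state `s_{k,H}` at the end of an episode is not part of the history, but it matters only
through value functions that vanish. -/
lemma pHat {h : ℕ} (hh : h < c.H) {V : Ω → S → ℝ} (hV : Measurable fun p : Ω × S => V p.1 p.2)
    (hV0 : c.H ≤ h + 1 → ∀ ω, V ω = fun _ => 0) (b : A) :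
    Measurable fun p : Ω × S => (runAt c s a k p.1).pHat c h (V p.1) p.2 b := by
  by_cases hh1 : c.H ≤ h + 1
  · simp only [State.pHat, hV0 hh1, muApply_zero, zero_dotProduct]
    exact measurable_const
  · have hVω : ∀ ω, Measurable (V ω) := fun ω => hV.comp measurable_prodMk_left
    have hsum : Measurable fun ω => ∑ i ∈ Finset.range k,
        ((sigSeq c (fun i l => s i l ω) (fun i l => a i l ω) h i)⁻¹ * V ω (s i (h + 1) ω)) •
          LinMDP.xHat c (fun i l => s i l ω) (fun i l => a i l ω) h i := by
      refine Finset.measurable_sum _ fun i hi => ?_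
      have hi' := Finset.mem_range.mp hi
      exact ((hm.sig i hi' h hh).inv.mul (hV.comp (measurable_id.prodMk
        (hm.state i hi' (h + 1) (by omega))))).smul (hm.xHat i hi' h hh)
    have hq := measurable_quad (Ω := Ω × S) (A := fun p => ((runAt c s a k p.1).lamHat h)⁻¹)
      (u := fun p => c.phi p.2 b) (fun i j => (measurable_inv_apply (fun i j => hm.lamHat hh i j)
        i j).comp measurable_fst) ((hphi b).comp measurable_snd) (hsum.comp measurable_fst)
    convert hq using 2 with p
    rw [State.pHat, runAt, muApply_muHat _ _ _ _ _ (hVω _), dotProduct_comm, run_lamHat]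
    rfl

include hr

lemma qHatOf {h : ℕ} (hh : h < c.H) {V : Ω → S → ℝ} (hV : Measurable fun p : Ω × S => V p.1 p.2)
    (hV0 : c.H ≤ h + 1 → ∀ ω, V ω = fun _ => 0) (b : A) :
    Measurable fun p : Ω × S => (runAt c s a k p.1).qHatOf c h (V p.1) p.2 b := by
  unfold State.qHatOf
  refine Measurable.ite (hm.updates.preimage measurable_fst) ?_ (hm.qPrev h hh b)
  exact (((((hr h b).comp measurable_snd).add (hm.pHat hphi hh hV hV0 b)).add
    ((hm.width hphi hh b).const_mul _)).min (hm.qPrev h hh b)).min measurable_const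

lemma qChkOf {h : ℕ} (hh : h < c.H) {V : Ω → S → ℝ} (hV : Measurable fun p : Ω × S => V p.1 p.2)
    (hV0 : c.H ≤ h + 1 → ∀ ω, V ω = fun _ => 0) (b : A) :
    Measurable fun p : Ω × S => (runAt c s a k p.1).qChkOf c h (V p.1) p.2 b :=
  (((hr h b).comp measurable_snd).add (hm.pHat hphi hh hV hV0 b)).sub
    ((hm.width hphi hh b).const_mul _)

lemma vHat (h : ℕ) : Measurable fun p : Ω × S => (runAt c s a k p.1).vHat c h p.2 := by
  have key : ∀ n h, c.H ≤ h + n →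
      Measurable fun p : Ω × S => (runAt c s a k p.1).vHat c h p.2 := by
    intro n
    induction n with
    | zero => intro h hn; simp only [State.vHat_of_ge _ _ (by omega : c.H ≤ h)]; exact measurable_const
    | succ n ih =>
      intro h hn
      by_cases hh : h < c.H
      · simp only [State.vHat_of_lt _ _ hh]
        exact measurable_sup'_univ fun b => hm.qHatOf hphi hr hh
          (V := fun ω => (runAt c s a k ω).vHat c (h + 1)) (ih (h + 1) (by omega))
          (fun h1 ω => State.vHat_of_ge _ _ h1) b
      · simp only [State.vHat_of_ge _ _ (by omega : c.H ≤ h)]; exact measurable_const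
  exact key c.H h (by omega)

lemma vChk (h : ℕ) : Measurable fun p : Ω × S => (runAt c s a k p.1).vChk c h p.2 := by
  have key : ∀ n h, c.H ≤ h + n →
      Measurable fun p : Ω × S => (runAt c s a k p.1).vChk c h p.2 := by
    intro n
    induction n with
    | zero => intro h hn; simp only [State.vChk_of_ge _ _ (by omega : c.H ≤ h)]; exact measurable_const
    | succ n ih =>
      intro h hn
      by_cases hh : h < c.H
      · simp only [State.vChk_of_lt _ _ hh]
        exact (measurable_sup'_univ fun b => hm.qChkOf hphi hr hh
          (V := fun ω => (runAt c s a k ω).vChk c (h + 1)) (ih (h + 1) (by omega))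
          (fun h1 ω => State.vChk_of_ge _ _ h1) b).max measurable_const
      · simp only [State.vChk_of_ge _ _ (by omega : c.H ≤ h)]; exact measurable_const
  exact key c.H h (by omega)

lemma pHat_vHat {h : ℕ} (hh : h < c.H) (b : A) : Measurable fun p : Ω × S =>
    (runAt c s a k p.1).pHat c h ((runAt c s a k p.1).vHat c (h + 1)) p.2 b :=
  hm.pHat hphi hh (V := fun ω => (runAt c s a k ω).vHat c (h + 1)) (hm.vHat hphi hr (h + 1))
    (fun h1 _ => State.vHat_of_ge _ _ h1) b

lemma varHat {h : ℕ} (hh : h < c.H) (b : A) :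
    Measurable fun p : Ω × S => (runAt c s a k p.1).varHat c h p.2 b := by
  have h2 := hm.pHat hphi hh (V := fun ω x => (runAt c s a k ω).vHat c (h + 1) x ^ 2)
    ((hm.vHat hphi hr (h + 1)).pow_const 2)
    (fun h1 ω => by ext x; rw [State.vHat_of_ge _ _ h1]; simp) b
  unfold State.varHat clip
  exact (measurable_const.max (h2.min measurable_const)).sub
    ((measurable_const.max ((hm.pHat_vHat hphi hr hh b).min measurable_const)).pow_const 2)

lemma offU {h : ℕ} (hh : h < c.H) (b : A) :
    Measurable fun p : Ω × S => (runAt c s a k p.1).offU c h p.2 b := by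
  have h2 := hm.pHat hphi hh (V := fun ω x => (runAt c s a k ω).vHat c (h + 1) x -
      (runAt c s a k ω).vChk c (h + 1) x)
    ((hm.vHat hphi hr (h + 1)).sub (hm.vChk hphi hr (h + 1)))
    (fun h1 ω => by ext x; rw [State.vHat_of_ge _ _ h1, State.vChk_of_ge _ _ h1]; simp) b
  have hw := hm.width hphi hh b
  unfold State.offU
  refine (Measurable.add (hw.const_mul _) (Measurable.const_mul ?_ _)).min measurable_const
  exact ((continuous_abs.measurable.comp h2).add (hw.const_mul _)).add (hw.const_mul _)

lemma offE {h : ℕ} (hh : h < c.H) (b : A) :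
    Measurable fun p : Ω × S => (runAt c s a k p.1).offE c h p.2 b := by
  have h2 := hm.pHat hphi hh (V := fun ω => (runAt c s a k ω).vChk c (h + 1))
    (hm.vChk hphi hr (h + 1)) (fun h1 ω => State.vChk_of_ge _ _ h1) b
  have hw := hm.width hphi hh b
  unfold State.offE
  exact ((((((hm.pHat_vHat hphi hr hh b).sub h2).add (hw.const_mul _)).add
    (hw.const_mul _)).add measurable_const).const_mul _).min measurable_const

lemma sigTil {h : ℕ} (hh : h < c.H) (b : A) :
    Measurable fun p : Ω × S => (runAt c s a k p.1).sigTil c h p.2 b := by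
  unfold State.sigTil
  exact ((measurable_const.max ((hm.offE hphi hr hh b).const_mul _)).max
    ((hm.varHat hphi hr hh b).add (hm.offU hphi hr hh b))).sqrt

lemma sigHat {h : ℕ} (hh : h < c.H) (b : A) :
    Measurable fun p : Ω × S => (runAt c s a k p.1).sigHat c h p.2 b := by
  have hmin : Measurable fun p : Ω × S => (runAt c s a k p.1).sigMin c h p.2 b := by
    unfold State.sigMin
    refine Measurable.ite (measurableSet_le (measurable_wnorm (fun i j =>
      (measurable_inv_apply (fun i j => hm.lamTil hh i j) i j).comp measurable_fst) ?_)
      measurable_const) measurable_const measurable_const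
    exact (hm.sigTil hphi hr hh b).inv.smul ((hphi b).comp measurable_snd)
  unfold State.sigHat
  exact (((hmin.pow_const 2).max ((hm.offE hphi hr hh b).const_mul _)).max
    ((hm.varHat hphi hr hh b).add (hm.offU hphi hr hh b))).sqrt

variable [MeasurableSpace A] [MeasurableSingletonClass A]

lemma sigHat_at {h : ℕ} (hh : h < c.H) {x : Ω → S} (hx : Measurable x) {b : Ω → A}
    (hb : Measurable b) : Measurable fun ω => (runAt c s a k ω).sigHat c h (x ω) (b ω) :=
  measurable_uncurry_of_finite (f := fun ω x b => (runAt c s a k ω).sigHat c h x b)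
    (fun b => hm.sigHat hphi hr hh b) hx hb

omit hm hr in
omit [MeasurableSpace Ω] [Nonempty A] in
lemma _root_.LinMDP.measurable_phi_at {Ω' : Type*} [MeasurableSpace Ω'] {x : Ω' → S}
    (hx : Measurable x) {b : Ω' → A} (hb : Measurable b) :
    Measurable fun ω => c.phi (x ω) (b ω) := by
  have h : Measurable fun q : S × A => c.phi q.1 q.2 := measurable_from_prod_countable_left hphi
  exact h.comp (hx.prodMk hb)

open Classical in
lemma succ (hs : ∀ l < c.H, Measurable (s k l)) (ha : ∀ l < c.H, Measurable (a k l)) :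
    RunMeas c s a (k + 1) := by
  have hsig : ∀ h < c.H, Measurable fun ω =>
      sigSeq c (fun i l => s i l ω) (fun i l => a i l ω) h k := fun h hh =>
    hm.sigHat_at hphi hr hh (hs h hh) (ha h hh)
  refine ⟨?_, ?_, ?_, ?_, ?_, ?_⟩
  · intro j hj
    rcases Nat.lt_succ_iff_lt_or_eq.mp hj with hj | rfl
    exacts [hm.state j hj, hs]
  · intro j hj
    rcases Nat.lt_succ_iff_lt_or_eq.mp hj with hj | rfl
    exacts [hm.sig j hj, hsig]
  · intro j hj
    rcases Nat.lt_succ_iff_lt_or_eq.mp hj with hj | rfl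
    · exact hm.xHat j hj
    · exact fun h hh => (hsig h hh).inv.smul (measurable_phi_at hphi (hs h hh) (ha h hh))
  · intro j hj
    rcases Nat.lt_succ_iff_lt_or_eq.mp hj with hj | rfl
    · exact hm.xTil j hj
    · exact fun h hh => (measurable_uncurry_of_finite
        (f := fun ω x b => (runAt c s a j ω).sigTil c h x b) (fun b => hm.sigTil hphi hr hh b)
        (hs h hh) (ha h hh)).inv.smul (measurable_phi_at hphi (hs h hh) (ha h hh))
  · intro h hh i j
    have e : ∀ ω, (runAt c s a (k + 1) ω).lamLast h i j =
        if (runAt c s a k ω).Updates c then (runAt c s a k ω).lamHat h i j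
        else (runAt c s a k ω).lamLast h i j := by
      intro ω
      change (if (runAt c s a k ω).Updates c then (runAt c s a k ω).lamHat
        else (runAt c s a k ω).lamLast) h i j = _
      split_ifs <;> rfl
    simp_rw [e]
    exact Measurable.ite hm.updates (hm.lamHat hh i j) (hm.lamLast h hh i j)
  · intro h hh b
    exact hm.qHatOf hphi hr hh (V := fun ω => (runAt c s a k ω).vHat c (h + 1))
      (hm.vHat hphi hr (h + 1)) (fun h1 ω => State.vHat_of_ge _ _ h1) b

end RunMeas

lemma runMeas [MeasurableSpace A] [MeasurableSingletonClass A]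
    (hphi : ∀ b, Measurable fun x => c.phi x b)
    (hr : ∀ h b, Measurable fun x => c.reward h x b) {k : ℕ}
    (hs : ∀ j < k, ∀ l < c.H, Measurable (s j l)) (ha : ∀ j < k, ∀ l < c.H, Measurable (a j l)) :
    RunMeas c s a k := by
  induction k with
  | zero =>
    refine ⟨by simp, by simp, by simp, by simp, fun h _ i j => ?_, fun h _ b => ?_⟩
    · exact measurable_const
    · exact measurable_const
  | succ k ih =>
    exact (ih (fun j hj => hs j (hj.trans k.lt_succ_self))
      (fun j hj => ha j (hj.trans k.lt_succ_self))).succ hphi hr (hs k k.lt_succ_self)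
      (ha k k.lt_succ_self)

end RunMeasurable

/-! ### The conditional law of the next state -/

section Law

variable {Ω S : Type*} [MeasurableSpace S]

/-- A kernel that gives the conditional probabilities of `X` given `m` also gives the integrals of
functions of the past and of `X`. -/
lemma lintegral_eq_of_condExp {m mΩ : MeasurableSpace Ω} (hm : m ≤ mΩ)
    (P : Measure Ω) [IsProbabilityMeasure P] {X : Ω → S} (hX : Measurable X) (κ : Ω → Measure S)
    (hκp : ∀ ω, IsProbabilityMeasure (κ ω)) (hκ : Measurable[m] κ)
    (hlaw : ∀ B, MeasurableSet B → P⟦X ⁻¹' B | m⟧ =ᵐ[P] fun ω => (κ ω).real B)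
    {g : Ω × S → ENNReal} (hg : Measurable[m.prod inferInstance] g) :
    ∫⁻ ω, g (ω, X ω) ∂P = ∫⁻ ω, ∫⁻ y, g (ω, y) ∂(κ ω) ∂P := by
  let k : @Kernel Ω S m _ := @Kernel.mk Ω S m _ κ hκ
  have hk : @IsMarkovKernel Ω S m _ k := @IsMarkovKernel.mk Ω S m _ k hκp
  have hpair : Measurable[mΩ, m.prod inferInstance] fun ω => (ω, X ω) :=
    @Measurable.prodMk _ mΩ _ _ m _ id X
      (measurable_id.mono hm le_rfl) hX
  have key : @Measure.map Ω (Ω × S) mΩ (m.prod inferInstance) (fun ω => (ω, X ω)) P =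
      @Measure.compProd Ω S m _ (P.trim hm) k := by
    refine @Measure.ext_prod Ω S m _ _ _ ?_ ?_
    · exact @Measure.isFiniteMeasure_map _ _ (m.prod inferInstance) mΩ P _ _
    intro A B hA hB
    have hAB : MeasurableSet[m.prod inferInstance] (A ×ˢ B) := @MeasurableSet.prod _ _ m _ _ _ hA hB
    rw [Measure.map_apply hpair hAB, @Measure.compProd_apply_prod Ω S m _ _ _ _ _ A B hA hB]
    have hpre : (fun ω => (ω, X ω)) ⁻¹' (A ×ˢ B) = A ∩ X ⁻¹' B := rfl
    have hA' := hm A hA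
    have hXB := hX hB
    have h1 := setIntegral_condExp hm (μ := P) (f := (X ⁻¹' B).indicator fun _ => (1 : ℝ))
      ((integrable_const 1).indicator hXB) hA
    rw [setIntegral_congr_ae hA' ((hlaw B hB).mono fun ω hω _ => hω),
      show (fun _ : Ω => (1 : ℝ)) = 1 from rfl, integral_indicator_one hXB,
      measureReal_restrict_apply hXB, Set.inter_comm] at h1
    have hmeas : Measurable[m] fun ω => κ ω B := (Measure.measurable_coe hB).comp hκ
    have h2 : ∫⁻ ω in A, κ ω B ∂(P.trim hm) = ∫⁻ ω in A, κ ω B ∂P :=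
      setLIntegral_trim hm hmeas hA
    rw [hpre]
    refine Eq.trans ?_ h2.symm
    have h3 : ∫ ω in A, (κ ω).real B ∂P = (∫⁻ ω in A, κ ω B ∂P).toReal :=
      integral_toReal (hmeas.mono hm le_rfl).aemeasurable
        (ae_of_all _ fun ω => measure_lt_top _ _)
    rw [h3, measureReal_def] at h1
    refine ((ENNReal.toReal_eq_toReal_iff' ?_ ?_).mp h1).symm
    · refine ne_top_of_le_ne_top (ENNReal.one_ne_top) ?_
      calc ∫⁻ ω in A, κ ω B ∂P ≤ ∫⁻ ω, κ ω B ∂P := setLIntegral_le_lintegral _ _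
        _ ≤ ∫⁻ _, 1 ∂P := lintegral_mono fun ω => prob_le_one
        _ = 1 := by simp
    · exact measure_ne_top _ _
  rw [← @lintegral_map Ω (Ω × S) mΩ (m.prod inferInstance) P g _ hg hpair, key,
    @Measure.lintegral_compProd Ω S m _ _ _ _ _ g hg]
  exact lintegral_trim hm (@Measurable.lintegral_kernel_prod_right' Ω S m _ k _ g hg)

end Law

section History

variable {S A Ω : Type*} [MeasurableSpace S] [MeasurableSpace A]
  {s : ℕ → ℕ → Ω → S} {a : ℕ → ℕ → Ω → A} {H : ℕ}

lemma measurable_pair_history {k h j l : ℕ} (hl : l < H) (hjl : j < k ∨ (j = k ∧ l ≤ h)) :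
    Measurable[history H s a k h] fun ω => (s j l ω, a j l ω) := by
  rw [measurable_iff_comap_le]
  exact le_iSup_of_le j (le_iSup_of_le l (le_iSup_of_le ⟨hl, hjl⟩ le_rfl))

lemma measurable_state_history {k h j l : ℕ} (hl : l < H) (hjl : j < k ∨ (j = k ∧ l ≤ h)) :
    Measurable[history H s a k h] (s j l) :=
  measurable_fst.comp (measurable_pair_history hl hjl)

lemma measurable_action_history {k h j l : ℕ} (hl : l < H) (hjl : j < k ∨ (j = k ∧ l ≤ h)) :
    Measurable[history H s a k h] (a j l) :=
  measurable_snd.comp (measurable_pair_history hl hjl)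

lemma history_mono (h : ℕ) : Monotone fun k => history H s a k h := by
  intro k k' hk
  refine iSup_le fun j => iSup_le fun l => iSup_le fun hjl => ?_
  exact le_iSup_of_le j (le_iSup_of_le l (le_iSup_of_le ⟨hjl.1, by omega⟩ le_rfl))

lemma history_le [mΩ : MeasurableSpace Ω] (hs : ∀ k h, Measurable (s k h))
    (ha : ∀ k h, Measurable (a k h)) (k h : ℕ) : history H s a k h ≤ mΩ :=
  iSup_le fun j => iSup_le fun l => iSup_le fun _ => ((hs j l).prodMk (ha j l)).comap_le

variable {d : ℕ} {W : ℝ} (M : LinearMDP S A d H W)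

lemma LinearMDP.measurable_trans [MeasurableSingletonClass A] [Fintype A] {h : ℕ} (hh : h < H) :
    Measurable fun p : S × A => M.trans h p.1 p.2 := by
  refine Measure.measurable_of_measurable_coe _ fun B hB => ?_
  refine measurable_from_prod_countable_left fun b => ?_
  have e : ∀ x, M.trans h x b B = ENNReal.ofReal (∑ i, M.phi x b i * M.mu h i B) := fun x => by
    have := M.trans_prob h hh x b
    rw [← M.trans_eq h hh x b B hB, ofReal_measureReal]
  simp_rw [e]
  exact (Finset.measurable_sum _ fun i _ =>
    ((measurable_pi_apply i).comp (M.phi_measurable b)).mul_const _).ennreal_ofReal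

/-- The state that follows stage `h` is drawn from `ℙ_h` given the history. -/
lemma IsInteraction.isDraw [MeasurableSpace Ω] [MeasurableSingletonClass A] [Fintype A] [Nonempty A]
    {M : LinearMDP S A d H W} {c : Config S A d} {P : Measure Ω} [IsProbabilityMeasure P]
    (hI : IsInteraction M c P s a) {h : ℕ} (hh : h + 1 < H) :
    IsDraw P (fun k => history H s a k h) (fun k => s k (h + 1))
      (fun k ω => M.trans h (s k h ω) (a k h ω)) c.K where
  le k := history_le hI.measurable_state hI.measurable_action k h
  mono := history_mono h
  prob k _ ω := M.trans_prob h (by omega) _ _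
  meas k := measurable_state_history hh (Or.inl (Nat.lt_succ_self k))
  lintegral_eq k hk g hg := by
    refine lintegral_eq_of_condExp (history_le hI.measurable_state hI.measurable_action k h) P
      (hI.measurable_state k (h + 1)) _ (fun ω => M.trans_prob h (by omega) _ _) ?_
      (hI.transition k hk h (by omega)) hg
    exact (M.measurable_trans (by omega)).comp
      (measurable_pair_history (by omega) (Or.inr ⟨rfl, le_rfl⟩))

end History

/-! ### The error of the estimated transitions -/

section Noise

variable {S A : Type*} [MeasurableSpace S] [Fintype A] [Nonempty A] {d : ℕ} {c : Config S A d} {W : ℝ}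
  (M : LinearMDP S A d c.H W) (s : ℕ → ℕ → S) (a : ℕ → ℕ → A)

/-- The weighted noise `∑_{i<k} σ̂_i⁻² (V(s_{h+1}^i) - ℙ_h V(s_h^i,a_h^i)) φ_h^i`. -/
def noiseSum (h : ℕ) (V : S → ℝ) (k : ℕ) : Fin d → ℝ :=
  ∑ i ∈ Finset.range k,
    ((sigSeq c s a h i)⁻¹ * (V (s i (h + 1)) - M.expect h V (s i h) (a i h))) • xHat c s a h i

/-- The norm of the weighted noise with respect to `Λ̂⁻¹`. -/
def noiseNorm (h : ℕ) (V : S → ℝ) (k : ℕ) : ℝ :=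
  wnorm (gram c.lam (xHat c s a h) k)⁻¹ (noiseSum M s a h V k)

lemma muApply_mu_sub_muHat (hphi : c.phi = M.phi) (hl : 0 < c.lam) {h : ℕ} (hh : h < c.H) (k : ℕ)
    {V : S → ℝ} (hV : Measurable V) {D : ℝ} (hD : ∀ x, |V x| ≤ D) :
    muApply (M.mu h - (c.run s a k).muHat h) V = (gram c.lam (xHat c s a h) k)⁻¹ *ᵥ
      (c.lam • muApply (M.mu h) V - noiseSum M s a h V k) := by
  have hG := gram_posDef hl (xHat c s a h) k
  rw [muApply_sub_measure _ _ hV hD, muApply_muHat _ _ _ _ _ hV]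
  conv_lhs => rw [← inv_mulVec_mulVec hG (muApply (M.mu h) V)]
  rw [← mulVec_sub, gram_mulVec]
  congr 1
  rw [add_sub_assoc, sub_eq_add_neg (c.lam • _), ← Finset.sum_sub_distrib, noiseSum,
    ← Finset.sum_neg_distrib]
  congr 1
  refine Finset.sum_congr rfl fun i _ => ?_
  have e : xHat c s a h i ⬝ᵥ muApply (M.mu h) V =
      (sigSeq c s a h i)⁻¹ * M.expect h V (s i h) (a i h) := by
    rw [M.expect_eq hh hV hD, xHat, smul_dotProduct, smul_eq_mul, dotProduct_comm, hphi]
  rw [e, ← sub_smul, ← neg_smul]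
  congr 1
  ring

/-- The error of the estimator splits into the bias of the ridge regression and the noise. -/
lemma wnorm_mu_sub_muHat_le (hphi : c.phi = M.phi) (hl : 0 < c.lam) {h : ℕ} (hh : h < c.H) (k : ℕ)
    {V : S → ℝ} (hV : Measurable V) {D : ℝ} (hD0 : 0 ≤ D) (hD : ∀ x, |V x| ≤ D) :
    wnorm ((c.run s a k).lamHat h) (muApply (M.mu h - (c.run s a k).muHat h) V) ≤
      D * Real.sqrt (c.lam * d) + noiseNorm M s a h V k := by
  have hG := gram_posDef hl (xHat c s a h) k
  rw [muApply_mu_sub_muHat M s a hphi hl hh k hV hD, run_lamHat, wnorm_inv_mulVec hG, sub_eq_add_neg]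
  refine (wnorm_add_le hG.inv.posSemidef _ _).trans (add_le_add ?_ (wnorm_neg _ _).le)
  rw [wnorm_smul, abs_of_pos hl]
  have h1 := wnorm_inv_gram_le hl (xHat c s a h) k (muApply (M.mu h) V)
  have h2 := M.enorm2_muApply_le hh hV hD0 hD
  have hs : 0 < Real.sqrt c.lam := Real.sqrt_pos.mpr hl
  calc c.lam * wnorm (gram c.lam (xHat c s a h) k)⁻¹ (muApply (M.mu h) V)
      ≤ c.lam * (D * Real.sqrt d / Real.sqrt c.lam) := by
        refine mul_le_mul_of_nonneg_left (h1.trans ?_) hl.le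
        gcongr
    _ = D * Real.sqrt (c.lam * d) := by
        rw [Real.sqrt_mul hl.le]
        field_simp
        rw [Real.sq_sqrt hl.le]
        ring

/-- Replacing `V` by a function at distance `ε` changes the noise only a little. -/
lemma noiseNorm_le_of_abs_sub_le (hphi : c.phi = M.phi) (hl : 0 < c.lam) (hd : 0 < d) {h : ℕ}
    (hh : h < c.H) {k : ℕ} (hk : k ≤ c.K) {V V' : S → ℝ} (hV : Measurable V) (hV' : Measurable V')
    {D D' ε : ℝ} (hD : ∀ x, |V x| ≤ D) (hD' : ∀ x, |V' x| ≤ D') (hε0 : 0 ≤ ε)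
    (hε : ∀ x, |V x - V' x| ≤ ε) :
    noiseNorm M s a h V k ≤ noiseNorm M s a h V' k + 2 * ε * c.K / (c.H * Real.sqrt c.lam) := by
  have hG := gram_posDef hl (xHat c s a h) k
  have hH : 0 < c.H := by omega
  have hHr : (0 : ℝ) < c.H := by exact_mod_cast hH
  have hs : 0 < Real.sqrt c.lam := Real.sqrt_pos.mpr hl
  have e : noiseSum M s a h V k = noiseSum M s a h V' k +
      noiseSum M s a h (fun x => V x - V' x) k := by
    rw [noiseSum, noiseSum, noiseSum, ← Finset.sum_add_distrib]
    refine Finset.sum_congr rfl fun i _ => ?_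
    rw [M.expect_sub hh hV hV' hD hD', ← add_smul]
    congr 1
    ring
  rw [noiseNorm, e]
  refine (wnorm_add_le hG.inv.posSemidef _ _).trans (add_le_add le_rfl ?_)
  refine (wnorm_sum_le hG.inv.posSemidef _ _).trans ?_
  have hterm : ∀ i ∈ Finset.range k, wnorm (gram c.lam (xHat c s a h) k)⁻¹
      (((sigSeq c s a h i)⁻¹ * ((fun x => V x - V' x) (s i (h + 1)) -
        M.expect h (fun x => V x - V' x) (s i h) (a i h))) • xHat c s a h i) ≤
      2 * ε / (c.H * Real.sqrt c.lam) := by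
    intro i _
    have hσ := inv_pos.mpr (sigSeq_pos s a hH hd h i)
    have h1 : |(V (s i (h + 1)) - V' (s i (h + 1))) -
        M.expect h (fun x => V x - V' x) (s i h) (a i h)| ≤ 2 * ε := by
      have b1 := abs_le.mp (hε (s i (h + 1)))
      have hm : Measurable fun x => V x - V' x := hV.sub hV'
      have b2 := M.expect_le hh hm hε (fun x => (abs_le.mp (hε x)).2) (s i h) (a i h)
      have b3 : -ε ≤ M.expect h (fun x => V x - V' x) (s i h) (a i h) := by
        rw [← M.expect_const hh (-ε) (s i h) (a i h)]
        exact M.expect_mono hh measurable_const hm (fun _ => le_rfl) hε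
          (fun x => (abs_le.mp (hε x)).1) _ _
      exact abs_le.mpr ⟨by linarith [b1.1], by linarith [b1.2]⟩
    have h2 : wnorm (gram c.lam (xHat c s a h) k)⁻¹ (xHat c s a h i) ≤
        (sigSeq c s a h i)⁻¹ / Real.sqrt c.lam :=
      (wnorm_inv_gram_le hl _ _ _).trans (div_le_div_of_nonneg_right
        (enorm2_xHat_le s a hH hd (fun x b => by rw [hphi]; exact M.phi_norm x b) h i) hs.le)
    rw [wnorm_smul, abs_mul, abs_of_pos hσ]
    calc (sigSeq c s a h i)⁻¹ * |(V (s i (h + 1)) - V' (s i (h + 1))) -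
            M.expect h (fun x => V x - V' x) (s i h) (a i h)| *
          wnorm (gram c.lam (xHat c s a h) k)⁻¹ (xHat c s a h i)
        ≤ (sigSeq c s a h i)⁻¹ * (2 * ε) * ((sigSeq c s a h i)⁻¹ / Real.sqrt c.lam) :=
          mul_le_mul (mul_le_mul_of_nonneg_left h1 hσ.le) h2 (wnorm_nonneg _ _) (by positivity)
      _ = (sigSeq c s a h i)⁻¹ ^ 2 * (2 * ε / Real.sqrt c.lam) := by ring
      _ ≤ (c.H : ℝ)⁻¹ * (2 * ε / Real.sqrt c.lam) :=
          mul_le_mul_of_nonneg_right (inv_sigSeq_sq_le s a hH hd h i) (by positivity)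
      _ = 2 * ε / (c.H * Real.sqrt c.lam) := by field_simp
  refine (Finset.sum_le_sum hterm).trans ?_
  rw [Finset.sum_const, Finset.card_range, nsmul_eq_mul]
  have hk' : (k : ℝ) ≤ c.K := by exact_mod_cast hk
  calc (k : ℝ) * (2 * ε / (c.H * Real.sqrt c.lam)) ≤ c.K * (2 * ε / (c.H * Real.sqrt c.lam)) :=
        mul_le_mul_of_nonneg_right hk' (by positivity)
    _ = _ := by ring

/-- Pointwise prediction errors are controlled by the confidence width. -/
lemma abs_pHat_sub_expect_le (hphi : c.phi = M.phi) (hl : 0 < c.lam) {h : ℕ} (hh : h < c.H) (k : ℕ)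
    {V : S → ℝ} (hV : Measurable V) {D β : ℝ} (hD : ∀ x, |V x| ≤ D)
    (hβ : M.mu h ∈ (c.run s a k).confSet h V β) (x : S) (b : A) :
    |(c.run s a k).pHat c h V x b - M.expect h V x b| ≤ β * (c.run s a k).width c h x b := by
  have e : (c.run s a k).pHat c h V x b - M.expect h V x b =
      -(muApply (M.mu h - (c.run s a k).muHat h) V ⬝ᵥ c.phi x b) := by
    rw [State.pHat, M.expect_eq hh hV hD, muApply_mu_sub_muHat M s a hphi hl hh k hV hD,
      ← muApply_mu_sub_muHat M s a hphi hl hh k hV hD, muApply_sub_measure _ _ hV hD,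
      sub_dotProduct, hphi]
    ring
  rw [e, abs_neg]
  have hG : ((c.run s a k).lamHat h).PosDef := by rw [run_lamHat]; exact gram_posDef hl _ _
  exact (abs_dotProduct_le hG _ _).trans (mul_le_mul_of_nonneg_right hβ (wnorm_nonneg _ _))

end Noise

namespace LinearMDP

variable {S A : Type*} [MeasurableSpace S] {d H : ℕ} {W : ℝ} (M : LinearMDP S A d H W)

/-- The second moment of the centred function is the variance. -/
lemma integral_sub_expect_sq {h : ℕ} (hh : h < H)
    {V : S → ℝ} (hV : Measurable V)
    {D : ℝ} (hD : ∀ x, |V x| ≤ D) (x : S) (b : A) :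
    ∫ y, (V y - M.expect h V x b) ^ 2 ∂(M.trans h x b) = M.var h V x b := by
  have := M.trans_prob h hh x b
  have i1 := M.integrable_trans hh hV hD x b
  have i2 : Integrable (fun y => V y ^ 2) (M.trans h x b) :=
    M.integrable_trans hh (hV.pow_const 2) (D := D ^ 2) (fun y => by
      rw [abs_pow]; exact pow_le_pow_left₀ (abs_nonneg _) (hD y) 2) x b
  set m := M.expect h V x b with hm
  have e : ∀ y, (V y - m) ^ 2 = V y ^ 2 - 2 * m * V y + m ^ 2 := fun y => by ring
  simp_rw [e]
  have i3 : Integrable (fun y => V y ^ 2 - 2 * m * V y) (M.trans h x b) := i2.sub (i1.const_mul _)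
  rw [integral_add i3 (integrable_const _), integral_sub i2 (i1.const_mul _),
    integral_const_mul, integral_const]
  simp only [LinearMDP.var, ← hm, probReal_univ, smul_eq_mul, one_mul]
  rw [show ∫ a, V a ∂M.trans h x b = m from rfl]
  simp only [LinearMDP.expect]
  ring

lemma var_nonneg {h : ℕ} (hh : h < H)
    {V : S → ℝ} (hV : Measurable V)
    {D : ℝ} (hD : ∀ x, |V x| ≤ D) (x : S) (b : A) : 0 ≤ M.var h V x b := by
  rw [← M.integral_sub_expect_sq hh hV hD x b]
  exact integral_nonneg fun y => sq_nonneg _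

end LinearMDP

section Probability

variable {S A Ω : Type*} [MeasurableSpace S] [MeasurableSpace A] [MeasurableSingletonClass A]
  [Fintype A] [Nonempty A] [mΩ : MeasurableSpace Ω] {d : ℕ} {c : Config S A d} {W : ℝ}
  {M : LinearMDP S A d c.H W} {P : Measure Ω} [IsProbabilityMeasure P]
  {s : ℕ → ℕ → Ω → S} {a : ℕ → ℕ → Ω → A}

omit mΩ in
lemma runMeas_history (hphi : c.phi = M.phi) (hr : c.reward = M.reward) (k h : ℕ) :
    @RunMeas S A Ω _ _ _ d (history c.H s a k h) c s a k := by
  let _ : MeasurableSpace Ω := history c.H s a k h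
  exact runMeas (fun b => by rw [hphi]; exact M.phi_measurable b)
    (fun h b => by rw [hr]; exact M.measurable_reward h b)
    (fun j hj l hl => measurable_state_history hl (Or.inl hj))
    (fun j hj l hl => measurable_action_history hl (Or.inl hj))

omit mΩ in
lemma measurable_sigSeq (hphi : c.phi = M.phi) (hr : c.reward = M.reward) (k : ℕ)
    {h : ℕ} (hh : h < c.H) : Measurable[history c.H s a k h]
      fun ω => sigSeq c (fun i l => s i l ω) (fun i l => a i l ω) h k := by
  have hm := runMeas_history (s := s) (a := a) hphi hr k h
  have h1 := measurable_state_history (s := s) (a := a) (k := k) hh (Or.inr ⟨rfl, le_refl h⟩)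
  have h2 := measurable_action_history (s := s) (a := a) (k := k) hh (Or.inr ⟨rfl, le_refl h⟩)
  let _ : MeasurableSpace Ω := history c.H s a k h
  exact hm.sigHat_at (fun b => by rw [hphi]; exact M.phi_measurable b)
    (fun h b => by rw [hr]; exact M.measurable_reward h b) hh h1 h2

omit mΩ in
lemma measurable_xHat (hphi : c.phi = M.phi) (hr : c.reward = M.reward) (k : ℕ)
    {h : ℕ} (hh : h < c.H) : Measurable[history c.H s a k h]
      fun ω => xHat c (fun i l => s i l ω) (fun i l => a i l ω) h k := by
  have h0 := measurable_sigSeq (s := s) (a := a) hphi hr k hh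
  have h1 := measurable_state_history (s := s) (a := a) (k := k) hh (Or.inr ⟨rfl, le_refl h⟩)
  have h2 := measurable_action_history (s := s) (a := a) (k := k) hh (Or.inr ⟨rfl, le_refl h⟩)
  let _ : MeasurableSpace Ω := history c.H s a k h
  exact h0.inv.smul (measurable_phi_at (fun b => by rw [hphi]; exact M.phi_measurable b) h1 h2)

omit mΩ [Nonempty A] in
lemma measurable_expect_history (k : ℕ) {h : ℕ} (hh : h < c.H) {V : S → ℝ}
    (hV : Measurable V) {D : ℝ} (hD : ∀ x, |V x| ≤ D) : Measurable[history c.H s a k h]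
      fun ω => M.expect h V (s k h ω) (a k h ω) := by
  have h1 := measurable_state_history (s := s) (a := a) (k := k) hh (Or.inr ⟨rfl, le_refl h⟩)
  have h2 := measurable_action_history (s := s) (a := a) (k := k) hh (Or.inr ⟨rfl, le_refl h⟩)
  let _ : MeasurableSpace Ω := history c.H s a k h
  exact measurable_uncurry_of_finite (f := fun _ x b => M.expect h V x b)
    (fun b => (M.measurable_expect hh hV hD b).comp measurable_snd) h1 h2

/-- The Hoeffding bound for the noise of a fixed function. -/
lemma IsInteraction.measure_noise_hoeffding (hI : IsInteraction M c P s a) (hphi : c.phi = M.phi)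
    (hr : c.reward = M.reward) (hl : 0 < c.lam) (hd : 0 < d) {h : ℕ} (hh : h + 1 < c.H)
    {V : S → ℝ} (hV : Measurable V) {D : ℝ} (hD0 : 0 < D) (hV0 : ∀ x, 0 ≤ V x)
    (hVD : ∀ x, V x ≤ D) {δ : ℝ} (hδ : 0 < δ) :
    P {ω | ∃ k ≤ c.K, D ^ 2 / (4 * c.H) * (2 * Real.log (1 / δ) +
        d * Real.log (1 + c.K / (c.H * d * c.lam))) <
      noiseNorm M (fun i l => s i l ω) (fun i l => a i l ω) h V k ^ 2} ≤ ENNReal.ofReal δ := by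
  have hH : 0 < c.H := by omega
  have hHr : (0 : ℝ) < c.H := by exact_mod_cast hH
  have hDV : ∀ x, |V x| ≤ D := fun x => abs_le.mpr ⟨by linarith [hV0 x], hVD x⟩
  have hn : ∀ x b, enorm2 (c.phi x b) ≤ 1 := fun x b => by rw [hphi]; exact M.phi_norm x b
  have hdraw := hI.isDraw hh
  let x : ℕ → Ω → Fin d → ℝ := fun k ω => xHat c (fun i l => s i l ω) (fun i l => a i l ω) h k
  let σ : ℕ → Ω → ℝ := fun k ω => (sigSeq c (fun i l => s i l ω) (fun i l => a i l ω) h k)⁻¹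
  have hσ0 : ∀ k ω, 0 < σ k ω := fun k ω => inv_pos.mpr (sigSeq_pos _ _ hH hd h k)
  have hσ2 : ∀ k ω, σ k ω ≤ 1 / Real.sqrt c.H := fun k ω => by
    rw [one_div, ← Real.sqrt_inv]
    exact Real.le_sqrt_of_sq_le (inv_sigSeq_sq_le _ _ hH hd h k)
  let g : ℕ → Ω × S → ℝ := fun k p => σ k p.1 * V p.2
  let η : ℕ → Ω × S → ℝ := fun k p => σ k p.1 * (V p.2 - M.expect h V (s k h p.1) (a k h p.1))
  have hsH : 0 < Real.sqrt c.H := Real.sqrt_pos.mpr hHr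
  have hmain := hdraw.hoeffding hl (x := x) (η := η) (g := g) (R := D / (2 * Real.sqrt c.H))
    (by positivity)
    (fun k _ => measurable_xHat hphi hr k (by omega)) ?_ ?_ ?_ ?_ ?_ hδ
  · refine (measure_mono ?_).trans hmain
    rintro ω ⟨k, hk, hω⟩
    simp only [Set.mem_iUnion]
    refine ⟨k, hk, ?_⟩
    simp only [Set.mem_ofPred_eq]
    refine lt_of_le_of_lt ?_ hω
    rw [div_pow, mul_pow, Real.sq_sqrt hHr.le, show (2 : ℝ) ^ 2 = 4 by norm_num]
    refine mul_le_mul_of_nonneg_left (add_le_add le_rfl ?_) (by positivity)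
    exact sum_log_wSeq_le _ _ hH hd hl hn h hk
  · intro k _
    have h1 := measurable_sigSeq (s := s) (a := a) hphi hr k (by omega : h < c.H)
    have h2 := measurable_expect_history (M := M) (s := s) (a := a) k (by omega : h < c.H) hV hDV
    let _ : MeasurableSpace Ω := history c.H s a k h
    exact (h1.inv.comp measurable_fst).mul ((hV.comp measurable_snd).sub (h2.comp measurable_fst))
  · exact fun k _ ω => hV.const_mul (σ k ω)
  · intro k _ ω y
    simp only [η, g, LinearMDP.expect]
    rw [integral_const_mul]
    ring
  · exact fun k _ p => mul_nonneg (hσ0 _ _).le (hV0 _)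
  · intro k _ p
    calc σ k p.1 * V p.2 ≤ 1 / Real.sqrt c.H * D :=
          mul_le_mul (hσ2 _ _) (hVD _) (hV0 _) (by positivity)
      _ = 2 * (D / (2 * Real.sqrt c.H)) := by ring

open Classical in
/-- The Bernstein bound for the noise of a fixed function, as long as the variances are small
compared with the weights. -/
lemma IsInteraction.measure_noise_bernstein (hI : IsInteraction M c P s a) (hphi : c.phi = M.phi)
    (hr : c.reward = M.reward) (hl : 0 < c.lam) (hd : 0 < d) {h : ℕ} (hh : h + 1 < c.H)
    {V : S → ℝ} (hV : Measurable V) (hV0 : ∀ x, 0 ≤ V x) (hVH : ∀ x, V x ≤ c.H) {s2 δ : ℝ}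
    (hs2 : 0 ≤ s2) (hδ : 0 < δ) (hδ1 : 1 ≤ Real.log (1 / δ)) :
    P {ω | ∃ k ≤ c.K, (∀ i < k, M.var h V (s i h ω) (a i h ω) ≤
        s2 * sigSeq c (fun i l => s i l ω) (fun i l => a i l ω) h i ^ 2) ∧
      (8 * Real.sqrt (s2 * (d * Real.log (1 + c.K / (c.H * d * c.lam))) * Real.log (1 / δ)) +
        2 * (1 / (c.H * Real.sqrt ((d : ℝ) ^ 5))) * Real.log (1 / δ)) ^ 2 <
      noiseNorm M (fun i l => s i l ω) (fun i l => a i l ω) h V k ^ 2} ≤ ENNReal.ofReal δ := by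
  have hH : 0 < c.H := by omega
  have hh' : h < c.H := by omega
  have hHr : (0 : ℝ) < c.H := by exact_mod_cast hH
  have hdr : (0 : ℝ) < d := by exact_mod_cast hd
  have hDV : ∀ x, |V x| ≤ c.H := fun x => abs_le.mpr ⟨by linarith [hV0 x], hVH x⟩
  have hn : ∀ x b, enorm2 (c.phi x b) ≤ 1 := fun x b => by rw [hphi]; exact M.phi_norm x b
  have hdraw := hI.isDraw hh
  let x : ℕ → Ω → Fin d → ℝ := fun k ω => xHat c (fun i l => s i l ω) (fun i l => a i l ω) h k
  let σ : ℕ → Ω → ℝ := fun k ω => sigSeq c (fun i l => s i l ω) (fun i l => a i l ω) h k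
  have hσ0 : ∀ k ω, 0 < σ k ω := fun k ω => sigSeq_pos _ _ hH hd h k
  -- The variance condition at step `k` is known before the draw, so that the noise can be set to `0`
  -- where it fails.
  let B : ℕ → Set Ω := fun k => {ω | M.var h V (s k h ω) (a k h ω) ≤ s2 * σ k ω ^ 2}
  let f : ℕ → Ω → ℝ := fun k ω => if ω ∈ B k then (σ k ω)⁻¹ else 0
  have hf0 : ∀ k ω, 0 ≤ f k ω := fun k ω => by
    simp only [f]; split_ifs; exacts [(inv_pos.mpr (hσ0 _ _)).le, le_rfl]
  have hfσ : ∀ k ω, f k ω ≤ (σ k ω)⁻¹ := fun k ω => by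
    simp only [f]; split_ifs; exacts [le_rfl, (inv_pos.mpr (hσ0 _ _)).le]
  let η : ℕ → Ω × S → ℝ := fun k p => f k p.1 * (V p.2 - M.expect h V (s k h p.1) (a k h p.1))
  have habs : ∀ k ω y, |V y - M.expect h V (s k h ω) (a k h ω)| ≤ c.H := fun k ω y => by
    have b1 := M.expect_nonneg h hV0 (s k h ω) (a k h ω)
    have b2 := M.expect_le hh' hV hDV hVH (s k h ω) (a k h ω)
    exact abs_le.mpr ⟨by linarith [hV0 y], by linarith [hVH y]⟩
  have hmain := hdraw.bernstein hl (x := x) (η := η) (R := 1 / (c.H * Real.sqrt ((d : ℝ) ^ 5)))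
    (s2 := s2) (L := d * Real.log (1 + c.K / (c.H * d * c.lam))) (by positivity) hs2
    (fun k _ => measurable_xHat hphi hr k hh') ?_ ?_ ?_ ?_ ?_ ?_ hδ hδ1 ?_ ?_
  · refine (measure_mono ?_).trans hmain
    rintro ω ⟨k, hk, hB, hω⟩
    simp only [Set.mem_iUnion]
    refine ⟨k, hk, ?_⟩
    simp only [Set.mem_ofPred_eq]
    convert hω using 2
    rw [selfNorm, noiseNorm]
    congr 1
    refine Finset.sum_congr rfl fun i hi => ?_
    have : ω ∈ B i := hB i (Finset.mem_range.mp hi)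
    simp only [η, f, if_pos this, x, σ]
  · intro k _
    have h1 := measurable_sigSeq (s := s) (a := a) hphi hr k hh'
    have h2 := measurable_expect_history (M := M) (s := s) (a := a) k hh' hV hDV
    have h3 := measurable_expect_history (M := M) (s := s) (a := a) k hh' (hV.pow_const 2)
      (D := (c.H : ℝ) ^ 2)
      (fun y => by rw [abs_pow]; exact pow_le_pow_left₀ (abs_nonneg _) (hDV y) 2)
    let _ : MeasurableSpace Ω := history c.H s a k h
    have h4 : Measurable (f k) := Measurable.ite (measurableSet_le (h3.sub (h2.pow_const 2))
      ((h1.pow_const 2).const_mul s2)) h1.inv measurable_const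
    exact (h4.comp measurable_fst).mul ((hV.comp measurable_snd).sub (h2.comp measurable_fst))
  · exact fun k _ ω => (hV.sub_const (M.expect h V (s k h ω) (a k h ω))).const_mul (f k ω)
  · intro k _ ω
    refine ⟨f k ω * c.H, fun y => ?_⟩
    simp only [η]
    rw [abs_mul, abs_of_nonneg (hf0 k ω)]
    exact mul_le_mul_of_nonneg_left (habs k ω y) (hf0 k ω)
  · intro k _ ω
    have := M.trans_prob h hh' (s k h ω) (a k h ω)
    simp only [η]
    rw [integral_const_mul, integral_sub (M.integrable_trans hh' hV hDV _ _) (integrable_const _),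
      integral_const]
    simp [LinearMDP.expect]
  · intro k _ ω
    simp only [η, mul_pow]
    rw [integral_const_mul, M.integral_sub_expect_sq hh' hV hDV]
    by_cases hω : ω ∈ B k
    · simp only [f, if_pos hω, inv_pow]
      rw [inv_mul_le_iff₀ (by have := hσ0 k ω; positivity), mul_comm]
      exact hω
    · simp only [f, if_neg hω]
      simpa using hs2
  · intro k _ ω y
    simp only [η]
    rw [abs_mul, abs_of_nonneg (hf0 k ω)]
    refine le_trans ?_ (noise_range_le (fun i l => s i l ω) (fun i l => a i l ω) hH hd hl h k)
    refine mul_le_mul_of_nonneg_right ?_ (le_min zero_le_one (wnorm_nonneg _ _))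
    exact mul_le_mul (hfσ k ω) (habs k ω y) (abs_nonneg _) (inv_pos.mpr (hσ0 _ _)).le
  · refine mul_nonneg hdr.le (Real.log_nonneg ?_)
    have : (0 : ℝ) ≤ c.K / (c.H * d * c.lam) := by positivity
    linarith
  · exact fun k hk ω => sum_wSeq_ratio_le _ _ hH hd hl hn h hk

end Probability

/-! ### Nets for the value functions of the algorithm -/

section Pieces

variable {d : ℕ}

lemma sqrt_le_sqrt_add (x y : ℝ) : Real.sqrt x ≤ Real.sqrt y + Real.sqrt |x - y| := by
  refine Real.sqrt_le_iff.mpr ⟨add_nonneg (Real.sqrt_nonneg _) (Real.sqrt_nonneg _), ?_⟩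
  have h1 : y ≤ Real.sqrt y ^ 2 := by
    rcases le_total 0 y with h | h
    · rw [Real.sq_sqrt h]
    · exact h.trans (sq_nonneg _)
  have h2 : |x - y| = Real.sqrt |x - y| ^ 2 := (Real.sq_sqrt (abs_nonneg _)).symm
  have h3 := le_abs_self (x - y)
  have h4 := mul_nonneg (Real.sqrt_nonneg y) (Real.sqrt_nonneg |x - y|)
  nlinarith

lemma abs_sqrt_sub_sqrt_le (x y : ℝ) : |Real.sqrt x - Real.sqrt y| ≤ Real.sqrt |x - y| := by
  have h1 := sqrt_le_sqrt_add x y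
  have h2 := sqrt_le_sqrt_add y x
  rw [abs_sub_comm y x] at h2
  exact abs_le.mpr ⟨by linarith, by linarith⟩

lemma enorm2_inv_gram_mulVec_le {lam : ℝ} (hl : 0 < lam) (x : ℕ → Fin d → ℝ) (k : ℕ)
    (v : Fin d → ℝ) : enorm2 ((gram lam x k)⁻¹ *ᵥ v) ≤ enorm2 v / lam := by
  set u := (gram lam x k)⁻¹ *ᵥ v with hu
  have h1 := quad_gram lam x k u
  rw [hu, mulVec_inv_mulVec (gram_posDef hl x k), ← hu, ← enorm2_sq] at h1
  have h2 : 0 ≤ ∑ i ∈ Finset.range k, (x i ⬝ᵥ u) ^ 2 := Finset.sum_nonneg fun _ _ => sq_nonneg _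
  have h3 := (le_abs_self _).trans (dotProduct_le_enorm2 u v)
  rw [le_div_iff₀ hl]
  rcases (enorm2_nonneg u).eq_or_lt with h0 | h0
  · rw [← h0, zero_mul]; exact enorm2_nonneg v
  · have h4 : enorm2 u * (enorm2 u * lam) ≤ enorm2 u * enorm2 v := by nlinarith
    exact le_of_mul_le_mul_left h4 h0

/-- The parameters `(θ, A)` of a function `φ ↦ ⟨θ, φ⟩ ± √(φᵀ A φ)`. -/
abbrev PieceParam (d : ℕ) : Type := EuclideanSpace ℝ (Fin d) × EuclideanSpace ℝ (Fin d × Fin d)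

/-- The function `φ ↦ ⟨θ, φ⟩ + t √(φᵀ A φ)`, where the root of a negative number is `0`. -/
def pieceVal (t : ℝ) (p : PieceParam d) (φ : Fin d → ℝ) : ℝ :=
  p.1.ofLp ⬝ᵥ φ + t * Real.sqrt (∑ q : Fin d × Fin d, p.2 q * (φ q.1 * φ q.2))

lemma measurable_pieceVal (t : ℝ) (p : PieceParam d) : Measurable (pieceVal t p) := by
  unfold pieceVal dotProduct
  fun_prop

lemma abs_pieceVal_sub_le {t : ℝ} (ht : |t| ≤ 1) {p p' : PieceParam d} {ε : ℝ} (hε : 0 ≤ ε)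
    (h1 : ‖p.1 - p'.1‖ ≤ ε / 2) (h2 : ‖p.2 - p'.2‖ ≤ ε ^ 2 / 4) {φ : Fin d → ℝ}
    (hφ : enorm2 φ ≤ 1) : |pieceVal t p φ - pieceVal t p' φ| ≤ ε := by
  have e1 : |p.1.ofLp ⬝ᵥ φ - p'.1.ofLp ⬝ᵥ φ| ≤ ε / 2 := by
    rw [← sub_dotProduct]
    refine (dotProduct_le_enorm2 _ _).trans ?_
    have : enorm2 (p.1.ofLp - p'.1.ofLp) ≤ ε / 2 := h1
    calc _ ≤ ε / 2 * 1 := mul_le_mul this hφ (enorm2_nonneg _) (by linarith)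
      _ = ε / 2 := mul_one _
  have e2 : |∑ q : Fin d × Fin d, p.2 q * (φ q.1 * φ q.2) -
      ∑ q : Fin d × Fin d, p'.2 q * (φ q.1 * φ q.2)| ≤ (ε / 2) ^ 2 := by
    rw [← Finset.sum_sub_distrib]
    let y : EuclideanSpace ℝ (Fin d × Fin d) := WithLp.toLp 2 fun q => φ q.1 * φ q.2
    have hy : ‖y‖ ≤ 1 := by
      have : ‖y‖ ^ 2 = (enorm2 φ ^ 2) ^ 2 := by
        rw [EuclideanSpace.norm_sq_eq, enorm2_sq, Fintype.sum_prod_type, dotProduct, sq,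
          Finset.sum_mul_sum]
        simp only [y, Real.norm_eq_abs, sq_abs]
        refine Finset.sum_congr rfl fun i _ => Finset.sum_congr rfl fun j _ => by ring
      have h3 : (enorm2 φ ^ 2) ^ 2 ≤ 1 :=
        pow_le_one₀ (sq_nonneg _) (pow_le_one₀ (enorm2_nonneg _) hφ)
      exact (sq_le_one_iff₀ (norm_nonneg _)).mp (this.trans_le h3)
    have h4 := abs_real_inner_le_norm (p.2 - p'.2) y
    have h5 : inner ℝ (p.2 - p'.2) y = ∑ q : Fin d × Fin d,
        (p.2 q * (φ q.1 * φ q.2) - p'.2 q * (φ q.1 * φ q.2)) := by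
      rw [PiLp.inner_apply]
      refine Finset.sum_congr rfl fun q _ => ?_
      simp [y]
      ring
    rw [← h5]
    calc _ ≤ ‖p.2 - p'.2‖ * ‖y‖ := h4
      _ ≤ (ε ^ 2 / 4) * 1 := mul_le_mul h2 hy (norm_nonneg _) (by positivity)
      _ = (ε / 2) ^ 2 := by ring
  have e3 := (abs_sqrt_sub_sqrt_le (∑ q : Fin d × Fin d, p.2 q * (φ q.1 * φ q.2))
    (∑ q : Fin d × Fin d, p'.2 q * (φ q.1 * φ q.2))).trans (Real.sqrt_le_sqrt e2)
  rw [Real.sqrt_sq (by linarith)] at e3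
  rw [pieceVal, pieceVal, add_sub_add_comm, ← mul_sub]
  refine (abs_add_le _ _).trans ?_
  rw [abs_mul]
  have : |t| * |Real.sqrt (∑ q : Fin d × Fin d, p.2 q * (φ q.1 * φ q.2)) -
      Real.sqrt (∑ q : Fin d × Fin d, p'.2 q * (φ q.1 * φ q.2))| ≤ 1 * (ε / 2) :=
    mul_le_mul ht e3 (abs_nonneg _) zero_le_one
  linarith

/-- The logarithm of the size of an `ε`-net for the functions `φ ↦ ⟨θ, φ⟩ ± √(φᵀ A φ)` with
`‖θ‖ ≤ L` and `‖A‖ ≤ B² √d / λ`. -/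
def netExp (d : ℕ) (lam L B ε : ℝ) : ℝ :=
  d * Real.log (1 + 4 * L / ε) + d ^ 2 * Real.log (1 + 8 * B ^ 2 * Real.sqrt d / (lam * ε ^ 2))

lemma netExp_nonneg {lam L B ε : ℝ} (hl : 0 < lam) (hL : 0 ≤ L) (hε : 0 < ε) :
    0 ≤ netExp d lam L B ε := by
  have h1 : (0 : ℝ) ≤ 4 * L / ε := by positivity
  have h2 : (0 : ℝ) ≤ 8 * B ^ 2 * Real.sqrt d / (lam * ε ^ 2) := by positivity
  exact add_nonneg (mul_nonneg (by positivity) (Real.log_nonneg (by linarith)))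
    (mul_nonneg (by positivity) (Real.log_nonneg (by linarith)))

lemma exists_piece_net {lam L B ε : ℝ} (hl : 0 < lam) (hL : 0 ≤ L) (hε : 0 < ε) :
    ∃ N : Finset (PieceParam d), N.Nonempty ∧ Real.log N.card ≤ netExp d lam L B ε ∧
      ∀ p : PieceParam d, ‖p.1‖ ≤ L → ‖p.2‖ ≤ B ^ 2 * Real.sqrt d / lam →
        ∃ p' ∈ N, ‖p.1 - p'.1‖ ≤ ε / 2 ∧ ‖p.2 - p'.2‖ ≤ ε ^ 2 / 4 := by
  have hρ : 0 ≤ B ^ 2 * Real.sqrt d / lam := by positivity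
  obtain ⟨N1, hc1, hN1⟩ := exists_net (ι := Fin d) hL (half_pos hε)
  obtain ⟨N2, hc2, hN2⟩ := exists_net (ι := Fin d × Fin d) hρ (show 0 < ε ^ 2 / 4 by positivity)
  have hcov : ∀ p : PieceParam d, ‖p.1‖ ≤ L → ‖p.2‖ ≤ B ^ 2 * Real.sqrt d / lam →
      ∃ p' ∈ N1 ×ˢ N2, ‖p.1 - p'.1‖ ≤ ε / 2 ∧ ‖p.2 - p'.2‖ ≤ ε ^ 2 / 4 := by
    intro p hp1 hp2
    obtain ⟨y1, hy1, h1⟩ := hN1 p.1 hp1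
    obtain ⟨y2, hy2, h2⟩ := hN2 p.2 hp2
    exact ⟨(y1, y2), Finset.mk_mem_product hy1 hy2, h1, h2⟩
  have hne : (N1 ×ˢ N2).Nonempty := by
    obtain ⟨p', hp', -⟩ := hcov 0 (by simpa using hL) (by simpa using hρ)
    exact ⟨p', hp'⟩
  refine ⟨N1 ×ˢ N2, hne, ?_, hcov⟩
  have hpos : (0 : ℝ) < (N1 ×ˢ N2).card := by exact_mod_cast hne.card_pos
  have b1 : (0 : ℝ) ≤ 4 * L / ε := by positivity
  have b2 : (0 : ℝ) ≤ 8 * B ^ 2 * Real.sqrt d / (lam * ε ^ 2) := by positivity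
  have hle : ((N1 ×ˢ N2).card : ℝ) ≤
      (1 + 4 * L / ε) ^ d * (1 + 8 * B ^ 2 * Real.sqrt d / (lam * ε ^ 2)) ^ (d ^ 2) := by
    rw [Finset.card_product, Nat.cast_mul]
    rw [show 2 * L / (ε / 2) = 4 * L / ε by field_simp; ring, Fintype.card_fin] at hc1
    rw [show 2 * (B ^ 2 * Real.sqrt d / lam) / (ε ^ 2 / 4) =
      8 * B ^ 2 * Real.sqrt d / (lam * ε ^ 2) by field_simp; ring, Fintype.card_prod,
      Fintype.card_fin, ← sq] at hc2
    exact mul_le_mul hc1 hc2 (by positivity) (by positivity)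
  refine (Real.log_le_log hpos hle).trans_eq ?_
  rw [Real.log_mul (by positivity) (by positivity), Real.log_pow, Real.log_pow, netExp]
  push_cast
  ring

end Pieces

section Clip

lemma clip_nonneg (m x : ℝ) : 0 ≤ clip m x := le_max_left _ _

lemma clip_le {m : ℝ} (hm : 0 ≤ m) (x : ℝ) : clip m x ≤ m := max_le hm (min_le_right _ _)

lemma clip_eq_self {m x : ℝ} (h0 : 0 ≤ x) (hm : x ≤ m) : clip m x = x := by
  rw [clip, min_eq_left hm, max_eq_right h0]

lemma abs_clip_sub_clip_le (m x y : ℝ) : |clip m x - clip m y| ≤ |x - y| := by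
  rw [clip, clip, max_comm 0, max_comm 0]
  refine (abs_max_sub_max_le_abs _ _ _).trans ((abs_min_sub_min_le_max _ _ _ _).trans ?_)
  rw [sub_self, abs_zero, max_eq_left (abs_nonneg _)]

lemma abs_sup'_sub_sup'_le {A : Type*} [Fintype A] [Nonempty A] {f g : A → ℝ} {ε : ℝ}
    (h : ∀ b, |f b - g b| ≤ ε) : |Finset.univ.sup' Finset.univ_nonempty f -
      Finset.univ.sup' Finset.univ_nonempty g| ≤ ε := by
  have key : ∀ {f g : A → ℝ}, (∀ b, |f b - g b| ≤ ε) →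
      Finset.univ.sup' Finset.univ_nonempty f ≤ Finset.univ.sup' Finset.univ_nonempty g + ε := by
    intro f g h
    refine Finset.sup'_le _ _ fun b _ => ?_
    have := Finset.le_sup' g (Finset.mem_univ b)
    linarith [(abs_le.mp (h b)).2]
  have h1 := key h
  have h2 := key fun b => (abs_sub_comm (g b) (f b)).trans_le (h b)
  exact abs_le.mpr ⟨by linarith, by linarith⟩

end Clip

section ValueNets

variable {S A : Type*} [MeasurableSpace S] [MeasurableSpace A] [MeasurableSingletonClass A]
  [Fintype A] [Nonempty A] {d : ℕ} {c : Config S A d} {W : ℝ}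
  (M : LinearMDP S A d c.H W) (s : ℕ → ℕ → S) (a : ℕ → ℕ → A)

omit [MeasurableSpace A] [MeasurableSingletonClass A] in
lemma enorm2_muApply_muHat_le (hphi : c.phi = M.phi) (hl : 0 < c.lam) (hd : 0 < d) {h : ℕ}
    (hh : h < c.H) {k : ℕ} (hk : k ≤ c.K) {V : S → ℝ} (hV : Measurable V)
    (hVH : ∀ x, |V x| ≤ c.H) :
    enorm2 (muApply ((c.run s a k).muHat h) V) ≤ c.K / c.lam := by
  have hH : 0 < c.H := by omega
  have hHr : (0 : ℝ) < c.H := by exact_mod_cast hH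
  rw [muApply_muHat _ _ _ _ _ hV]
  refine (enorm2_inv_gram_mulVec_le hl _ _ _).trans (div_le_div_of_nonneg_right ?_ hl.le)
  have hsum : ∀ n : ℕ, enorm2 (∑ i ∈ Finset.range n,
      ((sigSeq c s a h i)⁻¹ * V (s i (h + 1))) • xHat c s a h i) ≤ n := by
    intro n
    induction n with
    | zero => simp [enorm2]
    | succ n ih =>
      rw [Finset.sum_range_succ, Nat.cast_succ]
      refine (enorm2_add_le _ _).trans (add_le_add ih ?_)
      have hσ := inv_pos.mpr (sigSeq_pos s a hH hd h n)
      have hx := enorm2_xHat_le s a hH hd (fun x b => by rw [hphi]; exact M.phi_norm x b) h n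
      rw [enorm2_smul, abs_mul, abs_of_pos hσ]
      calc (sigSeq c s a h n)⁻¹ * |V (s n (h + 1))| * enorm2 (xHat c s a h n)
          ≤ (sigSeq c s a h n)⁻¹ * c.H * (sigSeq c s a h n)⁻¹ :=
            mul_le_mul (mul_le_mul_of_nonneg_left (hVH _) hσ.le) hx (enorm2_nonneg _) (by positivity)
        _ = (sigSeq c s a h n)⁻¹ ^ 2 * c.H := by ring
        _ ≤ (c.H : ℝ)⁻¹ * c.H :=
            mul_le_mul_of_nonneg_right (inv_sigSeq_sq_le s a hH hd h n) hHr.le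
        _ = 1 := inv_mul_cancel₀ hHr.ne'
  exact (hsum k).trans (by exact_mod_cast hk)

/-- The entries of the matrix `b² (gram lam x k)⁻¹`, as a vector. -/
def gramParam (lam : ℝ) (x : ℕ → Fin d → ℝ) (k : ℕ) (b : ℝ) : EuclideanSpace ℝ (Fin d × Fin d) :=
  WithLp.toLp 2 fun q => b ^ 2 * (gram lam x k)⁻¹ q.1 q.2

lemma norm_gramParam_le {lam : ℝ} (hl : 0 < lam) (x : ℕ → Fin d → ℝ) (k : ℕ) {b B : ℝ}
    (hb : 0 ≤ b) (hbB : b ≤ B) : ‖gramParam lam x k b‖ ≤ B ^ 2 * Real.sqrt d / lam := by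
  have hcol : ∀ j, ∑ i, (gram lam x k)⁻¹ i j ^ 2 ≤ (1 / lam) ^ 2 := by
    intro j
    have h1 := enorm2_inv_gram_mulVec_le hl x k (Pi.single j 1)
    have h2 : enorm2 (Pi.single j 1 : Fin d → ℝ) = 1 := by
      have : enorm2 (Pi.single j 1 : Fin d → ℝ) ^ 2 = 1 := by rw [enorm2_sq]; simp
      exact (pow_eq_one_iff_of_nonneg (enorm2_nonneg _) two_ne_zero).mp this
    rw [h2] at h1
    have h3 := pow_le_pow_left₀ (enorm2_nonneg _) h1 2
    rw [enorm2_sq] at h3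
    refine le_trans (le_of_eq ?_) h3
    simp [dotProduct, sq]
  have hsq : ‖gramParam lam x k b‖ ^ 2 ≤ (b ^ 2 * Real.sqrt d / lam) ^ 2 := by
    rw [EuclideanSpace.norm_sq_eq, Fintype.sum_prod_type_right]
    simp only [gramParam, Real.norm_eq_abs, sq_abs, mul_pow]
    calc ∑ j, ∑ i, (b ^ 2) ^ 2 * (gram lam x k)⁻¹ i j ^ 2
        ≤ ∑ _j : Fin d, (b ^ 2) ^ 2 * (1 / lam) ^ 2 := by
          refine Finset.sum_le_sum fun j _ => ?_
          rw [← Finset.mul_sum]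
          exact mul_le_mul_of_nonneg_left (hcol j) (by positivity)
      _ = (b ^ 2 * Real.sqrt d / lam) ^ 2 := by
          rw [Finset.sum_const, Finset.card_univ, Fintype.card_fin, nsmul_eq_mul,
            div_pow (b ^ 2 * _), mul_pow (b ^ 2), Real.sq_sqrt (Nat.cast_nonneg d)]
          ring
  have h0 := abs_le_of_sq_le_sq hsq (by positivity)
  refine (le_abs_self _).trans (h0.trans ?_)
  have := pow_le_pow_left₀ hb hbB 2
  gcongr

lemma pieceVal_gramParam {lam : ℝ} (x : ℕ → Fin d → ℝ) (k : ℕ) {b : ℝ}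
    (hb : 0 ≤ b) (t : ℝ) (θ φ : Fin d → ℝ) :
    pieceVal t (WithLp.toLp 2 θ, gramParam lam x k b) φ =
      θ ⬝ᵥ φ + t * (b * wnorm (gram lam x k)⁻¹ φ) := by
  have e : ∑ q : Fin d × Fin d, gramParam lam x k b q * (φ q.1 * φ q.2) =
      b ^ 2 * (φ ⬝ᵥ (gram lam x k)⁻¹ *ᵥ φ) := by
    rw [Fintype.sum_prod_type]
    simp only [gramParam, dotProduct, mulVec, Finset.mul_sum]
    exact Finset.sum_congr rfl fun i _ => Finset.sum_congr rfl fun j _ => by ring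
  rw [pieceVal, e, Real.sqrt_mul (sq_nonneg b), Real.sqrt_sq hb]
  rfl

omit [MeasurableSpace A] [MeasurableSingletonClass A] in
/-- The functions `r_h + ℙ̂_{k,h} V ± b ‖φ‖` are of the form covered by the nets. -/
lemma exists_pieceVal_eq (hphi : c.phi = M.phi) (hr : c.reward = M.reward) (hl : 0 < c.lam)
    (hd : 0 < d) {h : ℕ} (hh : h < c.H) {k : ℕ} (hk : k ≤ c.K) {V : S → ℝ} (hV : Measurable V)
    (hVH : ∀ x, |V x| ≤ c.H) {b B : ℝ} (hb : 0 ≤ b) (hbB : b ≤ B) :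
    ∃ p : PieceParam d, ‖p.1‖ ≤ bigL c.K c.lam W ∧ ‖p.2‖ ≤ B ^ 2 * Real.sqrt d / c.lam ∧
      ∀ t x u, c.reward h x u + (c.run s a k).pHat c h V x u + t * (b * (c.run s a k).width c h x u) =
        pieceVal t p (M.phi x u) := by
  refine ⟨(WithLp.toLp 2 (M.theta h + muApply ((c.run s a k).muHat h) V),
    gramParam c.lam (xHat c s a h) k b), ?_, norm_gramParam_le hl _ _ hb hbB, fun t x u => ?_⟩
  · exact (enorm2_add_le _ _).trans (add_le_add (M.theta_norm h hh)
      (enorm2_muApply_muHat_le M s a hphi hl hd hh hk hV hVH))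
  · rw [pieceVal_gramParam _ _ hb, State.width, run_lamHat, State.pHat, add_dotProduct, hr, hphi]
    rfl

omit [MeasurableSpace A] [MeasurableSingletonClass A] in
/-- A finite set of functions that approximates every pessimistic value function up to `ε`. -/
lemma exists_net_vChk (hphi : c.phi = M.phi) (hr : c.reward = M.reward) (hl : 0 < c.lam)
    (hd : 0 < d) (hW : 0 ≤ W) (hb : 0 ≤ c.bChk) {B : ℝ} (hbB : c.bChk ≤ B) {h : ℕ} (hh : h < c.H)
    {ε : ℝ} (hε : 0 < ε) : ∃ N : Finset (S → ℝ), N.Nonempty ∧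
      Real.log N.card ≤ netExp d c.lam (bigL c.K c.lam W) B ε ∧
      (∀ V ∈ N, Measurable V ∧ ∀ x, 0 ≤ V x ∧ V x ≤ c.H) ∧
      ∀ s a, ∀ k ≤ c.K, Measurable ((c.run s a k).vChk c (h + 1)) →
        (∀ x, |(c.run s a k).vChk c (h + 1) x| ≤ c.H) → (∀ x, (c.run s a k).vChk c h x ≤ c.H) →
        ∃ V ∈ N, ∀ x, |(c.run s a k).vChk c h x - V x| ≤ ε := by
  classical
  have hL : 0 ≤ bigL c.K c.lam W := add_nonneg hW (by positivity)
  obtain ⟨N, hne, hcard, hN⟩ := exists_piece_net (d := d) (B := B) hl hL hε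
  let val : PieceParam d → S → ℝ := fun p x => clip c.H (Finset.univ.sup' Finset.univ_nonempty
    fun b => pieceVal (-1) p (M.phi x b))
  refine ⟨N.image val, hne.image _, ?_, ?_, ?_⟩
  · refine le_trans (Real.log_le_log ?_ ?_) hcard
    · exact_mod_cast (hne.image val).card_pos
    · exact_mod_cast Finset.card_image_le
  · intro V hV
    obtain ⟨p, -, rfl⟩ := Finset.mem_image.mp hV
    refine ⟨?_, fun x => ⟨clip_nonneg _ _, clip_le (Nat.cast_nonneg _) _⟩⟩
    have := measurable_sup'_univ fun b => (measurable_pieceVal (-1) p).comp (M.phi_measurable b)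
    exact measurable_const.max (this.min measurable_const)
  · intro s a k hk hVm hVH hle
    obtain ⟨p, hp1, hp2, hp⟩ := exists_pieceVal_eq M s a hphi hr hl hd hh hk hVm hVH hb hbB
    obtain ⟨p', hp', h1, h2⟩ := hN p hp1 hp2
    refine ⟨val p', Finset.mem_image_of_mem _ hp', fun x => ?_⟩
    have e : (c.run s a k).vChk c h x = clip c.H (Finset.univ.sup' Finset.univ_nonempty
        fun b => pieceVal (-1) p (M.phi x b)) := by
      rw [← clip_eq_self (State.vChk_nonneg _ c h x) (hle x), State.vChk_of_lt _ _ hh]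
      have e2 : (fun b => (c.run s a k).qChkOf c h ((c.run s a k).vChk c (h + 1)) x b) =
          fun b => pieceVal (-1) p (M.phi x b) := by
        funext b
        rw [← hp (-1) x b, State.qChkOf]
        ring
      rw [e2]
      set y := Finset.univ.sup' Finset.univ_nonempty fun b => pieceVal (-1) p (M.phi x b)
      have hyH : y ≤ c.H := by
        have := hle x
        rw [State.vChk_of_lt _ _ hh, e2] at this
        exact (le_max_left _ _).trans this
      rw [clip, clip, min_eq_left (max_le hyH (Nat.cast_nonneg _)), min_eq_left hyH, max_comm y,
        ← max_assoc, max_self]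
    rw [e]
    refine (abs_clip_sub_clip_le _ _ _).trans (abs_sup'_sub_sup'_le fun b => ?_)
    exact abs_pieceVal_sub_le (by simp) hε.le h1 h2 (M.phi_norm x b)

/-- The minimum of `m` and of finitely many functions; without functions it is `m`. -/
def capMin {n : ℕ} (m : ℝ) (T : Option (Fin n → PieceParam d)) (φ : Fin d → ℝ) : ℝ :=
  T.elim m fun T => Finset.univ.inf' Finset.univ_nonempty
    fun o : Option (Fin n) => o.elim m fun i => pieceVal 1 (T i) φ

lemma measurable_capMin {n : ℕ} (m : ℝ) (T : Option (Fin n → PieceParam d)) :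
    Measurable (capMin m T) := by
  rcases T with _ | T
  · exact measurable_const
  · have : Measurable (Finset.univ.inf' Finset.univ_nonempty fun (o : Option (Fin n)) φ =>
        (o.elim m fun i => pieceVal 1 (T i) φ : ℝ)) := by
      refine Finset.inf'_induction _ _ (fun _ h1 _ h2 => h1.inf h2) fun o _ => ?_
      rcases o with _ | i
      exacts [measurable_const, measurable_pieceVal 1 (T i)]
    convert this using 1
    ext φ
    rw [Finset.inf'_apply]
    rfl

lemma le_capMin_some_iff {n : ℕ} (m : ℝ) (T : Fin n → PieceParam d) (φ : Fin d → ℝ) (y : ℝ) :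
    y ≤ capMin m (some T) φ ↔ y ≤ m ∧ ∀ i, y ≤ pieceVal 1 (T i) φ := by
  simp only [capMin, Option.elim_some, Finset.le_inf'_iff, Finset.mem_univ, true_imp_iff]
  exact ⟨fun h => ⟨h none, fun i => h (some i)⟩, fun h o => by cases o; exacts [h.1, h.2 _]⟩

omit [MeasurableSpace A] [MeasurableSingletonClass A] in
/-- A finite set of functions that approximates every optimistic value function up to `ε`, as long
as these functions have been updated at most `n` times. -/
lemma exists_net_vHat (hphi : c.phi = M.phi) (hr : c.reward = M.reward) (hl : 0 < c.lam)
    (hd : 0 < d) (hW : 0 ≤ W) (hb : 0 ≤ c.bHat) {B : ℝ} (hbB : c.bHat ≤ B) {h : ℕ} (hh : h < c.H)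
    {ε : ℝ} (hε : 0 < ε) (n : ℕ) : ∃ N : Finset (S → ℝ), N.Nonempty ∧
      Real.log N.card ≤ Real.log 2 + n * netExp d c.lam (bigL c.K c.lam W) B ε ∧
      (∀ V ∈ N, Measurable V ∧ ∀ x, 0 ≤ V x ∧ V x ≤ c.H) ∧
      ∀ s a, ∀ k ≤ c.K, (∀ j ≤ k, Measurable ((c.run s a j).vHat c (h + 1)) ∧
        ∀ x, |(c.run s a j).vHat c (h + 1) x| ≤ c.H) → (∀ x, 0 ≤ (c.run s a k).vHat c h x) →
        (updSet c s a (k + 1)).card ≤ n →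
        ∃ V ∈ N, ∀ x, |(c.run s a k).vHat c h x - V x| ≤ ε := by
  classical
  have hL : 0 ≤ bigL c.K c.lam W := add_nonneg hW (by positivity)
  obtain ⟨N, hne, hcard, hN⟩ := exists_piece_net (d := d) (B := B) hl hL hε
  let val : Option (Fin n → PieceParam d) → S → ℝ := fun T x =>
    clip c.H (Finset.univ.sup' Finset.univ_nonempty fun b => capMin c.H T (M.phi x b))
  let NT : Finset (Option (Fin n → PieceParam d)) :=
    Finset.insertNone (Fintype.piFinset fun _ : Fin n => N)
  have hNT : NT.Nonempty := ⟨none, by simp [NT]⟩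
  have hg0 := netExp_nonneg (d := d) (B := B) hl hL hε
  refine ⟨NT.image val, hNT.image _, ?_, ?_, ?_⟩
  · have hcN : (1 : ℝ) ≤ N.card := by exact_mod_cast hne.card_pos
    have hcN' : (1 : ℝ) ≤ (N.card : ℝ) ^ n := one_le_pow₀ hcN
    have h1 : ((NT.image val).card : ℝ) ≤ 2 * (N.card : ℝ) ^ n := by
      calc ((NT.image val).card : ℝ) ≤ NT.card := by exact_mod_cast Finset.card_image_le
        _ = (N.card : ℝ) ^ n + 1 := by simp [NT]
        _ ≤ 2 * (N.card : ℝ) ^ n := by linarith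
    refine (Real.log_le_log (by exact_mod_cast (hNT.image val).card_pos) h1).trans ?_
    rw [Real.log_mul (by norm_num) (by positivity), Real.log_pow]
    gcongr
  · intro V hV
    obtain ⟨T, -, rfl⟩ := Finset.mem_image.mp hV
    refine ⟨?_, fun x => ⟨clip_nonneg _ _, clip_le (Nat.cast_nonneg _) _⟩⟩
    have := measurable_sup'_univ fun b => (measurable_capMin (c.H : ℝ) T).comp (M.phi_measurable b)
    exact measurable_const.max (this.min measurable_const)
  · intro s a k hk hV hV0 hn
    suffices hT : ∃ T ∈ NT, ∀ x b, |(c.run s a k).qHat c h x b - capMin c.H T (M.phi x b)| ≤ ε by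
      obtain ⟨T, hT, hTε⟩ := hT
      refine ⟨val T, Finset.mem_image_of_mem _ hT, fun x => ?_⟩
      rw [← clip_eq_self (hV0 x) (vHat_le_H s a k h x), State.vHat_of_lt _ _ hh]
      exact (abs_clip_sub_clip_le _ _ _).trans (abs_sup'_sub_sup'_le fun b => hTε x b)
    have hq := fun x b y => le_qPrev_iff (c := c) s a (k + 1) h x b y
    rw [qPrev_succ] at hq
    rcases (updSet c s a (k + 1)).eq_empty_or_nonempty with he | hne'
    · refine ⟨none, by simp [NT], fun x b => ?_⟩
      have h1 := (hq x b c.H).mpr ⟨le_rfl, by simp [he]⟩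
      have h2 := qHat_le_H (c := c) s a k h x b
      rw [show capMin (c.H : ℝ) (none : Option (Fin n → PieceParam d)) (M.phi x b) = c.H from rfl,
        le_antisymm h2 h1, sub_self, abs_zero]
      exact hε.le
    · -- The updating episodes are enumerated, with repetitions, by `Fin n`.
      have : Nonempty (updSet c s a (k + 1)) := hne'.to_subtype
      obtain ⟨e⟩ : Nonempty ((updSet c s a (k + 1)) ↪ Fin n) :=
        Function.Embedding.nonempty_of_card_le (by simpa using hn)
      let g : Fin n → updSet c s a (k + 1) := Function.invFun e
      have hg : Function.Surjective g := Function.invFun_surjective e.injective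
      have hpiece : ∀ i : Fin n, ∃ p' ∈ N, ∀ x b,
          |updPiece c s a (g i) h x b - pieceVal 1 p' (M.phi x b)| ≤ ε := by
        intro i
        have hj : (g i : ℕ) ≤ k := by
          have := (Finset.mem_filter.mp (g i).2).1
          exact Nat.lt_succ_iff.mp (Finset.mem_range.mp this)
        obtain ⟨p, hp1, hp2, hp⟩ := exists_pieceVal_eq M s a hphi hr hl hd hh (hj.trans hk)
          (hV _ hj).1 (hV _ hj).2 hb hbB
        obtain ⟨p', hp', h1, h2⟩ := hN p hp1 hp2
        refine ⟨p', hp', fun x b => ?_⟩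
        rw [updPiece, ← one_mul (c.bHat * _), hp 1 x b]
        exact abs_pieceVal_sub_le (by simp) hε.le h1 h2 (M.phi_norm x b)
      choose T hTN hT using hpiece
      refine ⟨some T, by simpa [NT, Fintype.mem_piFinset] using hTN, fun x b => ?_⟩
      have h1 := (le_capMin_some_iff (c.H : ℝ) T (M.phi x b) _).mp le_rfl
      have h2 := (hq x b _).mp le_rfl
      refine abs_le.mpr ⟨?_, ?_⟩
      · have : capMin c.H (some T) (M.phi x b) - ε ≤ (c.run s a k).qHat c h x b := by
          refine (hq x b _).mpr ⟨by linarith [h1.1], fun j hj => ?_⟩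
          obtain ⟨i, hi⟩ := hg ⟨j, hj⟩
          have b1 := abs_le.mp (hT i x b)
          rw [hi] at b1
          linarith [h1.2 i, b1.1]
        linarith
      · have : (c.run s a k).qHat c h x b - ε ≤ capMin c.H (some T) (M.phi x b) := by
          refine (le_capMin_some_iff _ _ _ _).mpr ⟨by linarith [h2.1], fun i => ?_⟩
          have b1 := abs_le.mp (hT i x b)
          linarith [h2.2 _ (g i).2, b1.2]
        linarith

end ValueNets

/-! ### The radii -/

section Radii

variable {d H K : ℕ} {lam W δ : ℝ}

lemma numJ_nonneg (d H K : ℕ) : 0 ≤ numJ d H K :=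
  mul_nonneg (by positivity) (Real.log_nonneg (by linarith [(Nat.cast_nonneg K : (0 : ℝ) ≤ K)]))

/-- The covering term is `J` times the size of a net with the accuracy `H √λ / K`. -/
lemma coverTerm_eq (hl : 0 < lam) (d H K : ℕ) (W B : ℝ) : coverTerm d H K lam W B =
    numJ d H K * netExp d lam (bigL K lam W) B (H * Real.sqrt lam / K) := by
  have e : 8 * B ^ 2 * Real.sqrt d / (lam * (H * Real.sqrt lam / K) ^ 2) =
      8 * K ^ 2 * B ^ 2 * Real.sqrt d / (H ^ 2 * lam ^ 2) := by
    rw [div_pow, mul_pow, Real.sq_sqrt hl.le]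
    field_simp
  have e' : 4 * bigL K lam W / (H * Real.sqrt lam / K) =
      4 * K * bigL K lam W / (H * Real.sqrt lam) := by
    rw [div_div_eq_mul_div]; ring
  rw [coverTerm, netExp, e, e']
  ring

lemma coverTerm_nonneg (hl : 0 < lam) (hW : 0 ≤ W) (d H K : ℕ) (B : ℝ) :
    0 ≤ coverTerm d H K lam W B := by
  have hL : 0 ≤ bigL K lam W := add_nonneg hW (by positivity)
  have hJ := numJ_nonneg d H K
  have h1 : (0 : ℝ) ≤ 4 * K * bigL K lam W / (H * Real.sqrt lam) := by positivity
  have h2 : (0 : ℝ) ≤ 8 * K ^ 2 * B ^ 2 * Real.sqrt d / (H ^ 2 * lam ^ 2) := by positivity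
  exact add_nonneg (mul_nonneg (by positivity) (Real.log_nonneg (by linarith)))
    (mul_nonneg (by positivity) (Real.log_nonneg (by linarith)))

lemma betaBar_nonneg (d H K : ℕ) (lam W δ B : ℝ) : 0 ≤ betaBar d H K lam W δ B := by
  unfold betaBar; positivity

lemma betaTil_nonneg (d H K : ℕ) (lam W δ B : ℝ) : 0 ≤ betaTil d H K lam W δ B := by
  unfold betaTil; positivity

lemma betaChk_nonneg (d H K : ℕ) (lam W δ B : ℝ) : 0 ≤ betaChk d H K lam W δ B := by
  unfold betaChk; positivity

lemma log_four_mul_nonneg (hH : 0 < H) (hK : 0 < K) (hδ : 0 < δ) (hδ1 : δ < 1) :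
    0 ≤ Real.log (4 * K ^ 2 * H / δ) := by
  have h1 : (1 : ℝ) ≤ H := by exact_mod_cast hH
  have h2 : (1 : ℝ) ≤ (K : ℝ) ^ 2 := one_le_pow₀ (by exact_mod_cast hK)
  refine Real.log_nonneg ((one_le_div hδ).mpr ?_)
  nlinarith

lemma betaOne_nonneg (hH : 0 < H) (hK : 0 < K) (hδ : 0 < δ) (hδ1 : δ < 1) (d : ℕ) (lam : ℝ) :
    0 ≤ betaOne d H K lam δ := by
  have := log_four_mul_nonneg hH hK hδ hδ1
  unfold betaOne
  positivity

lemma betaTwo_nonneg (hH : 0 < H) (hK : 0 < K) (hδ : 0 < δ) (hδ1 : δ < 1) (hl : 0 < lam)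
    (hW : 0 ≤ W) (d : ℕ) (B : ℝ) : 0 ≤ betaTwo d H K lam W δ B := by
  have h1 := log_four_mul_nonneg hH hK hδ hδ1
  have h2 := coverTerm_nonneg hl hW d H K B
  unfold betaTwo
  positivity

lemma betaHat_nonneg (hH : 0 < H) (hK : 0 < K) (hδ : 0 < δ) (hδ1 : δ < 1) (hl : 0 < lam)
    (hW : 0 ≤ W) (d : ℕ) (B : ℝ) : 0 ≤ betaHat d H K lam W δ B :=
  add_nonneg (betaOne_nonneg hH hK hδ hδ1 d lam) (betaTwo_nonneg hH hK hδ hδ1 hl hW d B)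

end Radii

/-! ### Optimism and the variance bounds on the good event -/

section Good

variable {S A : Type*} [MeasurableSpace S] [MeasurableSpace A] [MeasurableSingletonClass A]
  [Fintype A] [Nonempty A] {d : ℕ} {c : Config S A d} {W δ Bhat Bchk : ℝ}

/-- The configuration `c` belongs to the MDP `M` and to the radii with constants `B̂` and `B̌`. -/
structure IsTuned (M : LinearMDP S A d c.H W) (δ Bhat Bchk : ℝ) : Prop where
  phi : c.phi = M.phi
  reward : c.reward = M.reward
  d_pos : 0 < d
  H_pos : 0 < c.H
  K_pos : 0 < c.K
  le_lam : 1 / ((c.H : ℝ) ^ 2 * Real.sqrt d) ≤ c.lam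
  δ_pos : 0 < δ
  δ_lt : δ < 1
  bHat : c.bHat = betaHat d c.H c.K c.lam W δ Bhat
  bBar : c.bBar = betaBar d c.H c.K c.lam W δ Bhat
  bTil : c.bTil = betaTil d c.H c.K c.lam W δ Bhat
  bChk : c.bChk = betaChk d c.H c.K c.lam W δ Bchk
  bHat_le : c.bHat ≤ Bhat
  bChk_le : c.bChk ≤ Bchk

/-- The accuracy `ζ = H √λ / K`. -/
def zeta (c : Config S A d) : ℝ := c.H * Real.sqrt c.lam / c.K

/-- The finite set `N` of functions approximates all optimistic value functions at stage `h`. -/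
structure IsNetHat (c : Config S A d) (h n : ℕ) (ε : ℝ) (N : Finset (S → ℝ)) : Prop where
  bounds : ∀ V ∈ N, Measurable V ∧ ∀ x, 0 ≤ V x ∧ V x ≤ c.H
  cover : ∀ s a, ∀ k ≤ c.K, (∀ j ≤ k, Measurable ((c.run s a j).vHat c (h + 1)) ∧
        ∀ x, |(c.run s a j).vHat c (h + 1) x| ≤ c.H) → (∀ x, 0 ≤ (c.run s a k).vHat c h x) →
        (updSet c s a (k + 1)).card ≤ n →
        ∃ V ∈ N, ∀ x, |(c.run s a k).vHat c h x - V x| ≤ ε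

/-- The finite set `N` of functions approximates all pessimistic value functions at stage `h`. -/
structure IsNetChk (c : Config S A d) (h : ℕ) (ε : ℝ) (N : Finset (S → ℝ)) : Prop where
  bounds : ∀ V ∈ N, Measurable V ∧ ∀ x, 0 ≤ V x ∧ V x ≤ c.H
  cover : ∀ s a, ∀ k ≤ c.K, Measurable ((c.run s a k).vChk c (h + 1)) →
        (∀ x, |(c.run s a k).vChk c (h + 1) x| ≤ c.H) → (∀ x, (c.run s a k).vChk c h x ≤ c.H) →
        ∃ V ∈ N, ∀ x, |(c.run s a k).vChk c h x - V x| ≤ ε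

/-- The nets for the value functions at stage `h`. -/
structure NetFamily (c : Config S A d) (NB NT NC : ℕ → Finset (S → ℝ)) : Prop where
  bar : ∀ h < c.H, IsNetHat c h ⌊2 * numJ d c.H c.K⌋₊ (zeta c) (NB h)
  til : ∀ h < c.H, IsNetHat c h ⌊2 * numJ d c.H c.K⌋₊ (Real.sqrt c.lam / (2 * c.K)) (NT h)
  chk : ∀ h < c.H, IsNetChk c h (zeta c) (NC h)

/-- The noise of all functions in the nets is small along the trajectory. -/
structure NoiseBounds (M : LinearMDP S A d c.H W) (δ Bhat Bchk : ℝ) (NB NT NC : ℕ → Finset (S → ℝ))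
    (s : ℕ → ℕ → S) (a : ℕ → ℕ → A) : Prop where
  bar : ∀ h, h + 1 < c.H → ∀ V ∈ NB (h + 1), ∀ k ≤ c.K, noiseNorm M s a h V k ≤
    betaBar d c.H c.K c.lam W δ Bhat - c.H * Real.sqrt (c.lam * d) - 2
  til : ∀ h, h + 1 < c.H → ∀ V ∈ NT (h + 1), ∀ k ≤ c.K, noiseNorm M s a h (fun x => V x ^ 2) k ≤
    betaTil d c.H c.K c.lam W δ Bhat - c.H ^ 2 * Real.sqrt (c.lam * d) - 2
  chk : ∀ h, h + 1 < c.H → ∀ V ∈ NC (h + 1), ∀ k ≤ c.K, noiseNorm M s a h V k ≤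
    betaChk d c.H c.K c.lam W δ Bchk - c.H * Real.sqrt (c.lam * d) - 2
  one : ∀ h, h + 1 < c.H → ∀ k ≤ c.K, (∀ i < k, M.var h (M.vStar (h + 1)) (s i h) (a i h) ≤
      1 * sigSeq c s a h i ^ 2) → noiseNorm M s a h (M.vStar (h + 1)) k ≤
    betaOne d c.H c.K c.lam δ - c.H * Real.sqrt (c.lam * d)
  two : ∀ h, h + 1 < c.H → ∀ V ∈ NB (h + 1), ∀ k ≤ c.K,
    (∀ i < k, M.var h (fun x => max (V x) (M.vStar (h + 1) x) - M.vStar (h + 1) x)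
      (s i h) (a i h) ≤ 1 / (d ^ 3 * c.H) * sigSeq c s a h i ^ 2) →
    noiseNorm M s a h (fun x => max (V x) (M.vStar (h + 1) x) - M.vStar (h + 1) x) k ≤
    betaTwo d c.H c.K c.lam W δ Bhat - c.H * Real.sqrt (c.lam * d) - 2

namespace IsTuned

variable {M : LinearMDP S A d c.H W} (ht : IsTuned M δ Bhat Bchk)

include ht

omit [MeasurableSpace A] [MeasurableSingletonClass A] [Fintype A] [Nonempty A]

lemma lam_pos : 0 < c.lam := by
  have h1 : (0 : ℝ) < c.H := by exact_mod_cast ht.H_pos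
  have h2 : (0 : ℝ) < d := by exact_mod_cast ht.d_pos
  exact lt_of_lt_of_le (by positivity) ht.le_lam

lemma W_nonneg : 0 ≤ W := (enorm2_nonneg _).trans (M.theta_norm 0 ht.H_pos)

lemma bHat_nonneg : 0 ≤ c.bHat := by
  rw [ht.bHat]
  exact betaHat_nonneg ht.H_pos ht.K_pos ht.δ_pos ht.δ_lt ht.lam_pos ht.W_nonneg d Bhat

lemma bBar_nonneg : 0 ≤ c.bBar := by rw [ht.bBar]; exact betaBar_nonneg _ _ _ _ _ _ _

lemma bChk_nonneg : 0 ≤ c.bChk := by rw [ht.bChk]; exact betaChk_nonneg _ _ _ _ _ _ _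

lemma zeta_pos : 0 < zeta c := by
  have h1 : (0 : ℝ) < c.H := by exact_mod_cast ht.H_pos
  have h2 : (0 : ℝ) < c.K := by exact_mod_cast ht.K_pos
  have h3 := Real.sqrt_pos.mpr ht.lam_pos
  unfold zeta
  positivity

end IsTuned

variable (M : LinearMDP S A d c.H W) (s : ℕ → ℕ → S) (a : ℕ → ℕ → A)

lemma measurable_vHat_run (hphi : c.phi = M.phi) (hr : c.reward = M.reward) (k h : ℕ) :
    Measurable ((c.run s a k).vHat c h) := by
  have hm := runMeas (Ω := Unit) (c := c) (s := fun i l _ => s i l) (a := fun i l _ => a i l)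
    (fun b => by rw [hphi]; exact M.phi_measurable b)
    (fun h b => by rw [hr]; exact M.measurable_reward h b) (k := k)
    (fun _ _ _ _ => measurable_const) (fun _ _ _ _ => measurable_const)
  exact (hm.vHat (fun b => by rw [hphi]; exact M.phi_measurable b)
    (fun h b => by rw [hr]; exact M.measurable_reward h b) h).comp
    (measurable_prodMk_left (x := ()))

lemma measurable_vChk_run (hphi : c.phi = M.phi) (hr : c.reward = M.reward) (k h : ℕ) :
    Measurable ((c.run s a k).vChk c h) := by
  have hm := runMeas (Ω := Unit) (c := c) (s := fun i l _ => s i l) (a := fun i l _ => a i l)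
    (fun b => by rw [hphi]; exact M.phi_measurable b)
    (fun h b => by rw [hr]; exact M.measurable_reward h b) (k := k)
    (fun _ _ _ _ => measurable_const) (fun _ _ _ _ => measurable_const)
  exact (hm.vChk (fun b => by rw [hphi]; exact M.phi_measurable b)
    (fun h b => by rw [hr]; exact M.measurable_reward h b) h).comp
    (measurable_prodMk_left (x := ()))

/-- The value functions of episode `k` at stage `h` enclose the optimal value function. -/
def Enclosed (k h : ℕ) : Prop := ∀ x, M.vStar h x ≤ (c.run s a k).vHat c h x ∧
  (c.run s a k).vChk c h x ≤ M.vStar h x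

/-- The confidence sets at stage `h` of episode `k` contain `μ_h`. -/
structure InConf (δ Bhat Bchk : ℝ) (k h : ℕ) : Prop where
  hat : M.mu h ∈ (c.run s a k).confSet h ((c.run s a k).vHat c (h + 1))
    (betaHat d c.H c.K c.lam W δ Bhat)
  chk : M.mu h ∈ (c.run s a k).confSet h ((c.run s a k).vChk c (h + 1))
    (betaChk d c.H c.K c.lam W δ Bchk)
  one : M.mu h ∈ (c.run s a k).confSet h (M.vStar (h + 1)) (betaOne d c.H c.K c.lam δ)
  two : M.mu h ∈ (c.run s a k).confSet h
    (fun x => (c.run s a k).vHat c (h + 1) x - M.vStar (h + 1) x) (betaTwo d c.H c.K c.lam W δ Bhat)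
  bar : M.mu h ∈ (c.run s a k).confSet h ((c.run s a k).vHat c (h + 1))
    (betaBar d c.H c.K c.lam W δ Bhat)
  til : M.mu h ∈ (c.run s a k).confSet h (fun x => (c.run s a k).vHat c (h + 1) x ^ 2)
    (betaTil d c.H c.K c.lam W δ Bhat)

/-- The variance bounds at stage `h` of episode `k`. -/
structure VarBounds (k h : ℕ) : Prop where
  offU : ∀ x b, |(c.run s a k).varHat c h x b - M.var h (M.vStar (h + 1)) x b| ≤
    (c.run s a k).offU c h x b
  offE : ∀ V : S → ℝ, Measurable V → (∀ x, 0 ≤ V x ∧ V x ≤ c.H) →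
    (∀ x, M.vStar (h + 1) x - zeta c ≤ V x ∧ V x ≤ (c.run s a k).vHat c (h + 1) x + zeta c) →
    ∀ x b, M.var h (fun y => V y - M.vStar (h + 1) y) x b ≤ (c.run s a k).offE c h x b

section Steps

variable {M s a} (ht : IsTuned M δ Bhat Bchk)

include ht

omit ht in
lemma Enclosed.bounds {k h : ℕ} (he : Enclosed M s a k h) (x : S) :
    0 ≤ M.vStar h x ∧ 0 ≤ (c.run s a k).vHat c h x ∧ (c.run s a k).vHat c h x ≤ c.H ∧
      0 ≤ (c.run s a k).vChk c h x ∧ (c.run s a k).vChk c h x ≤ c.H :=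
  ⟨M.vStar_nonneg h x, (M.vStar_nonneg h x).trans (he x).1, vHat_le_H s a k h x,
    State.vChk_nonneg _ _ _ _, (he x).2.trans (M.vStar_le h x)⟩

/-- The expected gap between the optimistic and the optimal value is controlled by observable
quantities. -/
lemma expect_gap_le {k h : ℕ} (hh : h < c.H) (he : Enclosed M s a k (h + 1))
    (hc : InConf M s a δ Bhat Bchk k h) (x : S) (b : A) :
    M.expect h ((c.run s a k).vHat c (h + 1)) x b - M.expect h (M.vStar (h + 1)) x b ≤
      (c.run s a k).pHat c h ((c.run s a k).vHat c (h + 1)) x b -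
        (c.run s a k).pHat c h ((c.run s a k).vChk c (h + 1)) x b +
        c.bBar * (c.run s a k).width c h x b + c.bChk * (c.run s a k).width c h x b := by
  have hm1 := measurable_vHat_run M s a ht.phi ht.reward k (h + 1)
  have hm2 := measurable_vChk_run M s a ht.phi ht.reward k (h + 1)
  have hb := fun y => he.bounds y
  have d1 : ∀ y, |(c.run s a k).vHat c (h + 1) y| ≤ c.H := fun y =>
    abs_le.mpr ⟨by linarith [(hb y).2.1, (hb y).2.2.1], (hb y).2.2.1⟩
  have d2 : ∀ y, |(c.run s a k).vChk c (h + 1) y| ≤ c.H := fun y =>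
    abs_le.mpr ⟨by linarith [(hb y).2.2.2.1, (hb y).2.2.2.2], (hb y).2.2.2.2⟩
  have d3 : ∀ y, |M.vStar (h + 1) y| ≤ c.H := fun y =>
    abs_le.mpr ⟨by linarith [M.vStar_nonneg (h + 1) y, M.vStar_le (h + 1) y], M.vStar_le (h + 1) y⟩
  have e1 := abs_le.mp (abs_pHat_sub_expect_le M s a ht.phi ht.lam_pos hh k hm1 d1 hc.bar x b)
  have e2 := abs_le.mp (abs_pHat_sub_expect_le M s a ht.phi ht.lam_pos hh k hm2 d2 hc.chk x b)
  have e3 := M.expect_mono hh hm2 (M.measurable_vStar (h + 1)) d2 d3 (fun y => (he y).2) x b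
  rw [ht.bBar, ht.bChk]
  linarith [e1.1, e2.2]

/-- The confidence sets at `(k, h)` and the enclosure at stage `h + 1` give the variance bounds: on
`[0, H]` the function `x ↦ x²` is `2H`-Lipschitz, so that all errors reduce to prediction errors and
to the expected gap between `V̂` and `V*`. -/
lemma varBounds {k h : ℕ} (hh : h < c.H) (he : Enclosed M s a k (h + 1))
    (hc : InConf M s a δ Bhat Bchk k h) : VarBounds M s a k h := by
  have hHr : (0 : ℝ) < c.H := by exact_mod_cast ht.H_pos
  have hm1 := measurable_vHat_run M s a ht.phi ht.reward k (h + 1)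
  have hm2 := measurable_vChk_run M s a ht.phi ht.reward k (h + 1)
  have hm3 := M.measurable_vStar (h + 1)
  have hb := fun y => he.bounds y
  have d1 : ∀ y, |(c.run s a k).vHat c (h + 1) y| ≤ c.H := fun y =>
    abs_le.mpr ⟨by linarith [(hb y).2.1, (hb y).2.2.1], (hb y).2.2.1⟩
  have d2 : ∀ y, |(c.run s a k).vChk c (h + 1) y| ≤ c.H := fun y =>
    abs_le.mpr ⟨by linarith [(hb y).2.2.2.1, (hb y).2.2.2.2], (hb y).2.2.2.2⟩
  have d3 : ∀ y, |M.vStar (h + 1) y| ≤ c.H := fun y =>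
    abs_le.mpr ⟨by linarith [(hb y).1, M.vStar_le (h + 1) y], M.vStar_le (h + 1) y⟩
  have sqb : ∀ {V : S → ℝ}, (∀ y, |V y| ≤ c.H) → ∀ y, |V y ^ 2| ≤ (c.H : ℝ) ^ 2 := fun hV y => by
    rw [abs_pow]; exact pow_le_pow_left₀ (abs_nonneg _) (hV y) 2
  refine ⟨fun x b => ?_, fun V hV hVH hVz x b => ?_⟩
  · have hgap := expect_gap_le ht hh he hc x b
    set Vh := (c.run s a k).vHat c (h + 1) with hVh
    set Vc := (c.run s a k).vChk c (h + 1) with hVc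
    set Vs := M.vStar (h + 1) with hVs
    set w := (c.run s a k).width c h x b with hw
    have hw0 : 0 ≤ w := wnorm_nonneg _ _
    have e1 := abs_pHat_sub_expect_le M s a ht.phi ht.lam_pos hh k hm1 d1 hc.bar x b
    have e2 := abs_pHat_sub_expect_le M s a ht.phi ht.lam_pos hh k (hm1.pow_const 2)
      (sqb d1) hc.til x b
    rw [← ht.bBar] at e1
    rw [← ht.bTil] at e2
    -- The expectations of the two value functions and of their squares.
    have p0 : 0 ≤ M.expect h Vs x b := M.expect_nonneg h (fun y => (hb y).1) x b
    have p1 : M.expect h Vs x b ≤ M.expect h Vh x b :=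
      M.expect_mono hh hm3 hm1 d3 d1 (fun y => (he y).1) x b
    have p2 : M.expect h Vh x b ≤ c.H := M.expect_le hh hm1 d1 (fun y => (hb y).2.2.1) x b
    have q0 : 0 ≤ M.expect h (fun y => Vs y ^ 2) x b := M.expect_nonneg h (fun y => sq_nonneg _) x b
    have q1 : M.expect h (fun y => Vs y ^ 2) x b ≤ M.expect h (fun y => Vh y ^ 2) x b :=
      M.expect_mono hh (hm3.pow_const 2) (hm1.pow_const 2) (sqb d3) (sqb d1)
        (fun y => pow_le_pow_left₀ (hb y).1 (he y).1 2) x b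
    have q2 : M.expect h (fun y => Vh y ^ 2) x b ≤ (c.H : ℝ) ^ 2 :=
      M.expect_le hh (hm1.pow_const 2) (sqb d1)
        (fun y => pow_le_pow_left₀ (hb y).2.1 (hb y).2.2.1 2) x b
    have q3 : M.expect h (fun y => Vh y ^ 2) x b - M.expect h (fun y => Vs y ^ 2) x b ≤
        2 * c.H * (M.expect h Vh x b - M.expect h Vs x b) := by
      rw [← M.expect_sub hh (hm1.pow_const 2) (hm3.pow_const 2) (sqb d1) (sqb d3),
        ← M.expect_sub hh hm1 hm3 d1 d3, LinearMDP.expect, LinearMDP.expect, ← integral_const_mul]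
      refine integral_mono ((M.integrable_trans hh (hm1.pow_const 2) (sqb d1) x b).sub
        (M.integrable_trans hh (hm3.pow_const 2) (sqb d3) x b))
        (((M.integrable_trans hh hm1 d1 x b).sub (M.integrable_trans hh hm3 d3 x b)).const_mul _)
        fun y => ?_
      have := (he y).1
      have b1 := (hb y).2.2.1
      have b3 := M.vStar_le (h + 1) y
      simp only [← hVh, ← hVs] at this b1 b3 ⊢
      nlinarith
    -- Clipping does not move points away from the interval.
    have c1 : |clip (c.H : ℝ) ((c.run s a k).pHat c h Vh x b) - M.expect h Vh x b| ≤ c.bBar * w := by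
      have := abs_clip_sub_clip_le c.H ((c.run s a k).pHat c h Vh x b) (M.expect h Vh x b)
      rw [clip_eq_self (p0.trans p1) p2] at this
      exact this.trans e1
    have c2 : |clip ((c.H : ℝ) ^ 2) ((c.run s a k).pHat c h (fun y => Vh y ^ 2) x b) -
        M.expect h (fun y => Vh y ^ 2) x b| ≤ c.bTil * w := by
      have := abs_clip_sub_clip_le ((c.H : ℝ) ^ 2) ((c.run s a k).pHat c h (fun y => Vh y ^ 2) x b)
        (M.expect h (fun y => Vh y ^ 2) x b)
      rw [clip_eq_self (q0.trans q1) q2] at this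
      exact this.trans e2
    have r0 := clip_nonneg (c.H : ℝ) ((c.run s a k).pHat c h Vh x b)
    have r1 := clip_le hHr.le ((c.run s a k).pHat c h Vh x b)
    have r2 := clip_nonneg ((c.H : ℝ) ^ 2) ((c.run s a k).pHat c h (fun y => Vh y ^ 2) x b)
    have r3 := clip_le (sq_nonneg (c.H : ℝ)) ((c.run s a k).pHat c h (fun y => Vh y ^ 2) x b)
    have hpsub : (c.run s a k).pHat c h (fun y => Vh y - Vc y) x b =
        (c.run s a k).pHat c h Vh x b - (c.run s a k).pHat c h Vc x b := by
      rw [State.pHat, muApply_sub _ hm1 hm2 d1 d2, sub_dotProduct]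
      rfl
    have habs := le_abs_self ((c.run s a k).pHat c h (fun y => Vh y - Vc y) x b)
    rw [hpsub] at habs
    have vn := M.var_nonneg hh hm3 d3 x b
    have vb : M.var h Vs x b = M.expect h (fun y => Vs y ^ 2) x b - M.expect h Vs x b ^ 2 := rfl
    rw [State.varHat, State.offU, ← hVh, ← hVc, ← hw, hpsub]
    set C1 := clip (c.H : ℝ) ((c.run s a k).pHat c h Vh x b)
    set C2 := clip ((c.H : ℝ) ^ 2) ((c.run s a k).pHat c h (fun y => Vh y ^ 2) x b)
    set g := |(c.run s a k).pHat c h Vh x b - (c.run s a k).pHat c h Vc x b|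
    set m1 := M.expect h Vh x b
    set m0 := M.expect h Vs x b
    set n1 := M.expect h (fun y => Vh y ^ 2) x b
    set n0 := M.expect h (fun y => Vs y ^ 2) x b
    have hB0 := mul_nonneg ht.bBar_nonneg hw0
    have hC0 := mul_nonneg ht.bChk_nonneg hw0
    have t1 : |C1 ^ 2 - m1 ^ 2| ≤ 2 * c.H * (c.bBar * w) := by
      rw [sq_sub_sq, abs_mul, abs_of_nonneg (by linarith : 0 ≤ C1 + m1)]
      exact mul_le_mul (by linarith) c1 (abs_nonneg _) (by positivity)
    have t2 : 0 ≤ m1 ^ 2 - m0 ^ 2 ∧ m1 ^ 2 - m0 ^ 2 ≤ 2 * c.H * (m1 - m0) := by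
      rw [sq_sub_sq]
      exact ⟨mul_nonneg (by linarith) (by linarith),
        mul_le_mul_of_nonneg_right (by linarith) (by linarith)⟩
    have hgm : m1 - m0 ≤ g + c.bBar * w + c.bChk * w := by linarith
    have t3 : 2 * (c.H : ℝ) * (m1 - m0) ≤ 2 * c.H * (g + c.bBar * w + c.bChk * w) :=
      mul_le_mul_of_nonneg_left hgm (by positivity)
    have hg0 : 0 ≤ g := abs_nonneg _
    have t4 : (0 : ℝ) ≤ c.H * (g + c.bBar * w + c.bChk * w) := by positivity
    have t5 : (0 : ℝ) ≤ c.H * (g + c.bChk * w) := by positivity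
    have c2' := abs_le.mp c2
    have t1' := abs_le.mp t1
    rw [vb] at vn ⊢
    refine le_min ?_ ?_
    · rw [abs_le]
      constructor <;> linarith [t2.1, t2.2, c2'.1, c2'.2, t1'.1, t1'.2]
    · rw [abs_le]
      constructor <;> linarith [sq_nonneg C1, sq_nonneg m0, pow_le_pow_left₀ r0 r1 2]
  · have hgap := expect_gap_le ht hh he hc x b
    have hz := ht.zeta_pos
    set Vh := (c.run s a k).vHat c (h + 1) with hVh
    set Vc := (c.run s a k).vChk c (h + 1) with hVc
    set Vs := M.vStar (h + 1) with hVs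
    have hdm : Measurable fun y => V y - Vs y := hV.sub hm3
    have hdH : ∀ y, |V y - Vs y| ≤ c.H := fun y => abs_le.mpr
      ⟨by linarith [(hVH y).1, M.vStar_le (h + 1) y], by linarith [(hVH y).2, (hb y).1]⟩
    have hsq : ∀ y, (V y - Vs y) ^ 2 ≤ c.H * ((Vh y - Vs y) + zeta c) := by
      intro y
      have h1 : |V y - Vs y| ≤ (Vh y - Vs y) + zeta c :=
        abs_le.mpr ⟨by linarith [(hVz y).1, (he y).1], by linarith [(hVz y).2]⟩
      rw [← sq_abs, sq]
      exact mul_le_mul (hdH y) h1 (abs_nonneg _) hHr.le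
    have h1 : M.expect h (fun y => (V y - Vs y) ^ 2) x b ≤
        c.H * ((M.expect h Vh x b - M.expect h Vs x b) + zeta c) := by
      have := M.trans_prob h hh x b
      have i1 := M.integrable_trans hh hm1 d1 x b
      have i2 := M.integrable_trans hh hm3 d3 x b
      have e : c.H * ((M.expect h Vh x b - M.expect h Vs x b) + zeta c) =
          ∫ y, c.H * ((Vh y - Vs y) + zeta c) ∂(M.trans h x b) := by
        have i3 : Integrable (fun y => Vh y - Vs y) (M.trans h x b) := i1.sub i2
        rw [integral_const_mul, integral_add i3 (integrable_const _), integral_sub i1 i2,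
          integral_const, probReal_univ, one_smul]
        rfl
      rw [e]
      exact integral_mono (M.integrable_trans hh (hdm.pow_const 2) (sqb hdH) x b)
        (((i1.sub i2).add (integrable_const _)).const_mul _) hsq
    have h2 : M.expect h (fun y => (V y - Vs y) ^ 2) x b ≤ (c.H : ℝ) ^ 2 :=
      M.expect_le hh (hdm.pow_const 2) (sqb hdH)
        (fun y => by rw [← sq_abs]; exact pow_le_pow_left₀ (abs_nonneg _) (hdH y) 2) x b
    have h3 : M.var h (fun y => V y - Vs y) x b ≤ M.expect h (fun y => (V y - Vs y) ^ 2) x b :=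
      sub_le_self _ (sq_nonneg _)
    rw [State.offE]
    refine le_min ((h3.trans h1).trans (mul_le_mul_of_nonneg_left ?_ hHr.le)) (h3.trans h2)
    rw [← hVh, ← hVc]
    unfold zeta
    linarith

end Steps

end Good

section Induction

variable {S A : Type*} [MeasurableSpace S] [MeasurableSpace A] [MeasurableSingletonClass A]
  [Fintype A] [Nonempty A] {d : ℕ} {c : Config S A d} {W δ Bhat Bchk : ℝ}
  {M : LinearMDP S A d c.H W} {s : ℕ → ℕ → S} {a : ℕ → ℕ → A}

omit [MeasurableSpace A] [MeasurableSingletonClass A] [Fintype A] [Nonempty A] in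
lemma mem_confSet_zero (st : State S A d) (μ : Fin d → SignedMeasure S) (h : ℕ) {β : ℝ}
    (hβ : 0 ≤ β) : μ ∈ st.confSet h (fun _ => 0) β := by
  change wnorm _ (muApply _ _) ≤ β
  rwa [muApply_zero, wnorm_zero]

/-- At the last stage all value functions vanish. -/
lemma inConf_last (ht : IsTuned M δ Bhat Bchk) {k h : ℕ} (hh : c.H = h + 1) :
    InConf M s a δ Bhat Bchk k h := by
  have h1 : (c.run s a k).vHat c (h + 1) = fun _ => 0 := State.vHat_of_ge _ _ hh.le
  have h2 : (c.run s a k).vChk c (h + 1) = fun _ => 0 := State.vChk_of_ge _ _ hh.le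
  have h3 : M.vStar (h + 1) = fun _ => 0 := by
    rw [← hh]; exact funext M.vStar_last
  have hl := ht.lam_pos
  have hW := ht.W_nonneg
  refine ⟨?_, ?_, ?_, ?_, ?_, ?_⟩
  · rw [h1]; exact mem_confSet_zero _ _ _
      (betaHat_nonneg ht.H_pos ht.K_pos ht.δ_pos ht.δ_lt hl hW _ _)
  · rw [h2]; exact mem_confSet_zero _ _ _ (betaChk_nonneg _ _ _ _ _ _ _)
  · rw [h3]; exact mem_confSet_zero _ _ _ (betaOne_nonneg ht.H_pos ht.K_pos ht.δ_pos ht.δ_lt _ _)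
  · simp only [h1, h3, sub_zero]
    exact mem_confSet_zero _ _ _ (betaTwo_nonneg ht.H_pos ht.K_pos ht.δ_pos ht.δ_lt hl hW _ _)
  · rw [h1]; exact mem_confSet_zero _ _ _ (betaBar_nonneg _ _ _ _ _ _ _)
  · simp only [h1, ne_eq, OfNat.ofNat_ne_zero, not_false_eq_true, zero_pow]
    exact mem_confSet_zero _ _ _ (betaTil_nonneg _ _ _ _ _ _ _)

omit [MeasurableSpace A] [MeasurableSingletonClass A] in
/-- Membership in a confidence set follows from a noise bound for a nearby function. -/
lemma mem_confSet_of_noiseNorm_le (ht : IsTuned M δ Bhat Bchk) {k h : ℕ} (hk : k ≤ c.K)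
    (hh : h < c.H) {V V' : S → ℝ} (hV : Measurable V) (hV' : Measurable V') {D D' ε β : ℝ}
    (hD0 : 0 ≤ D) (hD : ∀ x, |V x| ≤ D) (hD' : ∀ x, |V' x| ≤ D') (hε0 : 0 ≤ ε)
    (hε : ∀ x, |V x - V' x| ≤ ε)
    (hβ : D * Real.sqrt (c.lam * d) + noiseNorm M s a h V' k +
      2 * ε * c.K / (c.H * Real.sqrt c.lam) ≤ β) :
    M.mu h ∈ (c.run s a k).confSet h V β := by
  have h1 := wnorm_mu_sub_muHat_le M s a ht.phi ht.lam_pos hh k hV hD0 hD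
  have h2 := noiseNorm_le_of_abs_sub_le M s a ht.phi ht.lam_pos ht.d_pos hh hk hV hV' hD hD' hε0 hε
  change wnorm _ _ ≤ β
  linarith

variable {NB NT NC : ℕ → Finset (S → ℝ)}

/-- The confidence sets at `(k, h)`, from the enclosures at later stages and the variance bounds in
earlier episodes. -/
lemma inConf_step (ht : IsTuned M δ Bhat Bchk) (hnet : NetFamily c NB NT NC)
    (hn : NoiseBounds M δ Bhat Bchk NB NT NC s a) {k h : ℕ} (hk : k < c.K) (hh : h + 1 < c.H)
    (he : ∀ j ≤ k, ∀ h', h < h' → h' ≤ c.H → Enclosed M s a j h')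
    (hv : ∀ i < k, VarBounds M s a i h) : InConf M s a δ Bhat Bchk k h := by
  have hh' : h < c.H := by omega
  have hHr : (0 : ℝ) < c.H := by exact_mod_cast ht.H_pos
  have hKr : (0 : ℝ) < c.K := by exact_mod_cast ht.K_pos
  have hdr : (0 : ℝ) < d := by exact_mod_cast ht.d_pos
  have hsl := Real.sqrt_pos.mpr ht.lam_pos
  have hz := ht.zeta_pos
  have hmV : ∀ j h', Measurable ((c.run s a j).vHat c h') :=
    measurable_vHat_run M s a ht.phi ht.reward
  have hmC := measurable_vChk_run M s a ht.phi ht.reward k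
  have hmS := M.measurable_vStar (h + 1)
  have hb := fun j hj h' h1 h2 y => (he j hj h' h1 h2).bounds y
  have dV : ∀ j ≤ k, ∀ h', h < h' → h' ≤ c.H → ∀ y, |(c.run s a j).vHat c h' y| ≤ c.H :=
    fun j hj h' h1 h2 y => abs_le.mpr
      ⟨by linarith [(hb j hj h' h1 h2 y).2.1], (hb j hj h' h1 h2 y).2.2.1⟩
  have dC : ∀ h', h < h' → h' ≤ c.H → ∀ y, |(c.run s a k).vChk c h' y| ≤ c.H :=
    fun h' h1 h2 y => abs_le.mpr
      ⟨by linarith [(hb k le_rfl h' h1 h2 y).2.2.2.1], (hb k le_rfl h' h1 h2 y).2.2.2.2⟩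
  have dS : ∀ y, |M.vStar (h + 1) y| ≤ c.H := fun y => abs_le.mpr
    ⟨by linarith [M.vStar_nonneg (h + 1) y], M.vStar_le (h + 1) y⟩
  have dN : ∀ {V : S → ℝ}, (Measurable V ∧ ∀ x, 0 ≤ V x ∧ V x ≤ c.H) → ∀ y, |V y| ≤ c.H :=
    fun hV y => abs_le.mpr ⟨by linarith [(hV.2 y).1], (hV.2 y).2⟩
  have hcard : (updSet c s a (k + 1)).card ≤ ⌊2 * numJ d c.H c.K⌋₊ :=
    Nat.le_floor (card_updSet_le s a (by omega) ht.d_pos ht.le_lam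
      (fun x b => by rw [ht.phi]; exact M.phi_norm x b) ht.K_pos hk)
  have he1 := he k le_rfl (h + 1) (Nat.lt_succ_self h) hh.le
  have hzK : 2 * zeta c * c.K / (c.H * Real.sqrt c.lam) = 2 := by
    unfold zeta
    field_simp
  have hcov0 : ∀ j ≤ k, Measurable ((c.run s a j).vHat c (h + 1 + 1)) ∧
      ∀ x, |(c.run s a j).vHat c (h + 1 + 1) x| ≤ c.H := fun j hj =>
    ⟨hmV _ _, dV j hj _ (by omega) (by omega)⟩
  have hcov1 : ∀ x, 0 ≤ (c.run s a k).vHat c (h + 1) x := fun x => (he1.bounds x).2.1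
  obtain ⟨Vb, hVb, hVbε⟩ := (hnet.bar (h + 1) hh).cover s a k hk.le hcov0 hcov1 hcard
  obtain ⟨Vt, hVt, hVtε⟩ := (hnet.til (h + 1) hh).cover s a k hk.le hcov0 hcov1 hcard
  obtain ⟨Vc, hVc, hVcε⟩ := (hnet.chk (h + 1) hh).cover s a k hk.le (hmC _)
    (dC _ (by omega) (by omega)) (fun x => (he1.bounds x).2.2.2.2)
  have hVb' := (hnet.bar (h + 1) hh).bounds Vb hVb
  have hVt' := (hnet.til (h + 1) hh).bounds Vt hVt
  have hVc' := (hnet.chk (h + 1) hh).bounds Vc hVc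
  have c1 : M.mu h ∈ (c.run s a k).confSet h (M.vStar (h + 1)) (betaOne d c.H c.K c.lam δ) := by
    have hno := hn.one h hh k hk.le fun i hi => by
      have h1 := (abs_le.mp ((hv i hi).offU (s i h) (a i h))).1
      have h2 := (c.run s a i).varHat_add_offU_le_sigHat_sq (c := c) h (s i h) (a i h)
      rw [one_mul, sigSeq]
      linarith
    have h1 := wnorm_mu_sub_muHat_le M s a ht.phi ht.lam_pos hh' k hmS hHr.le dS
    change wnorm _ _ ≤ _
    linarith
  have c2 : M.mu h ∈ (c.run s a k).confSet h
      (fun x => (c.run s a k).vHat c (h + 1) x - M.vStar (h + 1) x)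
      (betaTwo d c.H c.K c.lam W δ Bhat) := by
    -- The net function is raised to `V*`, which keeps the difference in `[0, H]` and does not worsen
    -- the approximation, as `V* ≤ V̂`.
    have hmx : Measurable fun x => max (Vb x) (M.vStar (h + 1) x) := hVb'.1.max hmS
    have hno := hn.two h hh Vb hVb k hk.le fun i hi => by
      have h1 := (hv i hi).offE (fun x => max (Vb x) (M.vStar (h + 1) x)) hmx
        (fun x => ⟨(hVb'.2 x).1.trans (le_max_left _ _), max_le (hVb'.2 x).2 (M.vStar_le _ x)⟩)
        (fun x => ⟨by linarith [le_max_right (Vb x) (M.vStar (h + 1) x)], by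
          have b1 := (abs_le.mp (hVbε x)).1
          -- The functions `V̂` decrease in the episode, so that the condition holds for all `i < k`.
          have b2 := vHat_anti (c := c) s a (h + 1) x hi.le
          have b3 := (he1 x).1
          simp only at b2
          exact max_le (by linarith) (by linarith)⟩) (s i h) (a i h)
      have h2 := (c.run s a i).offE_le_sigHat_sq (c := c) h (s i h) (a i h)
      refine h1.trans ?_
      rw [one_div_mul_eq_div, le_div_iff₀ (by positivity), sigSeq]
      linarith
    refine mem_confSet_of_noiseNorm_le
      (V := fun x => (c.run s a k).vHat c (h + 1) x - M.vStar (h + 1) x)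
      (V' := fun x => max (Vb x) (M.vStar (h + 1) x) - M.vStar (h + 1) x) ht hk.le hh'
      ((hmV _ _).sub hmS) (hmx.sub hmS) (D := c.H) (D' := c.H)
      (ε := zeta c) hHr.le (fun x => ?_) (fun x => ?_) hz.le (fun x => ?_) ?_
    · have b1 := (he1.bounds x)
      exact abs_le.mpr ⟨by linarith [(he1 x).1], by linarith [b1.1, b1.2.2.1]⟩
    · refine abs_le.mpr ⟨?_, ?_⟩
      · linarith [le_max_right (Vb x) (M.vStar (h + 1) x)]
      · have := max_le (hVb'.2 x).2 (M.vStar_le (h + 1) x)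
        linarith [M.vStar_nonneg (h + 1) x]
    · rw [sub_sub_sub_cancel_right]
      nth_rewrite 1 [← max_eq_left (he1 x).1]
      exact (abs_max_sub_max_le_abs _ _ _).trans (hVbε x)
    · rw [hzK]
      linarith
  have cb : ∀ V ∈ NB (h + 1), (∀ x, |(c.run s a k).vHat c (h + 1) x - V x| ≤ zeta c) →
      M.mu h ∈ (c.run s a k).confSet h ((c.run s a k).vHat c (h + 1))
        (betaBar d c.H c.K c.lam W δ Bhat) := fun V hV hVε => by
    have hV' := (hnet.bar (h + 1) hh).bounds V hV
    have hno := hn.bar h hh V hV k hk.le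
    refine mem_confSet_of_noiseNorm_le ht hk.le hh' (hmV _ _) hV'.1 hHr.le
      (dV k le_rfl _ (by omega) hh.le) (dN hV') hz.le hVε ?_
    rw [hzK]
    linarith
  refine ⟨?_, ?_, c1, c2, cb Vb hVb hVbε, ?_⟩
  · have hsum : muApply (M.mu h - (c.run s a k).muHat h) ((c.run s a k).vHat c (h + 1)) =
        muApply (M.mu h - (c.run s a k).muHat h) (M.vStar (h + 1)) +
        muApply (M.mu h - (c.run s a k).muHat h)
          (fun x => (c.run s a k).vHat c (h + 1) x - M.vStar (h + 1) x) := by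
      rw [muApply_sub _ (hmV _ _) hmS (dV k le_rfl _ (by omega) hh.le) dS]
      abel
    have hG : ((c.run s a k).lamHat h).PosSemidef := by
      rw [run_lamHat]; exact (gram_posDef ht.lam_pos _ _).posSemidef
    change wnorm _ _ ≤ _
    rw [hsum]
    exact (wnorm_add_le hG _ _).trans (add_le_add c1 c2)
  · have hno := hn.chk h hh Vc hVc k hk.le
    refine mem_confSet_of_noiseNorm_le ht hk.le hh' (hmC _) hVc'.1 hHr.le
      (dC _ (by omega) hh.le) (dN hVc') hz.le hVcε ?_
    rw [hzK]
    linarith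
  · have hno := hn.til h hh Vt hVt k hk.le
    refine mem_confSet_of_noiseNorm_le ht hk.le hh' ((hmV _ _).pow_const 2) (hVt'.1.pow_const 2)
      (D := (c.H : ℝ) ^ 2) (D' := (c.H : ℝ) ^ 2) (ε := 2 * c.H * (Real.sqrt c.lam / (2 * c.K)))
      (by positivity) (fun x => ?_) (fun x => ?_) (by positivity) (fun x => ?_) ?_
    · rw [abs_pow]
      exact pow_le_pow_left₀ (abs_nonneg _) (dV k le_rfl _ (by omega) hh.le x) 2
    · rw [abs_pow]
      exact pow_le_pow_left₀ (abs_nonneg _) (dN hVt' x) 2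
    · rw [sq_sub_sq, abs_mul]
      refine mul_le_mul ?_ (hVtε x) (abs_nonneg _) (by positivity)
      refine (abs_add_le _ _).trans ?_
      linarith [dV k le_rfl _ (Nat.lt_succ_self h) hh.le x, dN hVt' x]
    · have e : 2 * (2 * c.H * (Real.sqrt c.lam / (2 * c.K))) * c.K / (c.H * Real.sqrt c.lam) = 2 := by
        field_simp
      rw [e]
      linarith

/-- The confidence sets at one stage propagate optimism and pessimism to this stage. -/
lemma enclosed_step (ht : IsTuned M δ Bhat Bchk) {k h : ℕ} (hh : h < c.H)
    (he : ∀ j ≤ k, Enclosed M s a j (h + 1)) (hc : ∀ j ≤ k, InConf M s a δ Bhat Bchk j h) :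
    Enclosed M s a k h := by
  have hmV : ∀ j h', Measurable ((c.run s a j).vHat c h') :=
    measurable_vHat_run M s a ht.phi ht.reward
  have hmC := measurable_vChk_run M s a ht.phi ht.reward k (h + 1)
  have hmS := M.measurable_vStar (h + 1)
  have hb := fun j hj y => (he j hj).bounds y
  have dV : ∀ j ≤ k, ∀ y, |(c.run s a j).vHat c (h + 1) y| ≤ c.H := fun j hj y => abs_le.mpr
    ⟨by linarith [(hb j hj y).2.1, (hb j hj y).2.2.1], (hb j hj y).2.2.1⟩
  have dC : ∀ y, |(c.run s a k).vChk c (h + 1) y| ≤ c.H := fun y => abs_le.mpr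
    ⟨by linarith [(hb k le_rfl y).2.2.2.1, (hb k le_rfl y).2.2.2.2], (hb k le_rfl y).2.2.2.2⟩
  have dS : ∀ y, |M.vStar (h + 1) y| ≤ c.H := fun y => abs_le.mpr
    ⟨by linarith [M.vStar_nonneg (h + 1) y, M.vStar_le (h + 1) y], M.vStar_le (h + 1) y⟩
  intro x
  have hQ : ∀ b, M.reward h x b + M.expect h (M.vStar (h + 1)) x b ≤ M.vStar h x := fun b => by
    rw [M.vStar_bellman hh]
    exact Finset.le_sup' (fun b => M.reward h x b + M.expect h (M.vStar (h + 1)) x b)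
      (Finset.mem_univ b)
  constructor
  · rw [State.vHat_of_lt _ _ hh, M.vStar_bellman hh]
    refine Finset.sup'_le _ _ fun b _ => ?_
    refine le_trans ?_ (Finset.le_sup' (fun b => (c.run s a k).qHat c h x b) (Finset.mem_univ b))
    rw [← qPrev_succ, le_qPrev_iff]
    refine ⟨(hQ b).trans (M.vStar_le h x), fun j hj => ?_⟩
    have hj : j ≤ k := by
      classical
      exact Nat.lt_succ_iff.mp (Finset.mem_range.mp (Finset.mem_filter.mp hj).1)
    have h1 := (abs_le.mp (abs_pHat_sub_expect_le M s a ht.phi ht.lam_pos hh j (hmV j _) (dV j hj)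
      (hc j hj).hat x b)).1
    have h2 := M.expect_mono hh hmS (hmV j _) dS (dV j hj) (fun y => (he j hj y).1) x b
    rw [updPiece, ht.bHat, ht.reward]
    linarith
  · rw [State.vChk_of_lt _ _ hh]
    refine max_le (Finset.sup'_le _ _ fun b _ => le_trans ?_ (hQ b)) (M.vStar_nonneg h x)
    have h1 := (abs_le.mp (abs_pHat_sub_expect_le M s a ht.phi ht.lam_pos hh k hmC dC
      (hc k le_rfl).chk x b)).2
    have h2 := M.expect_mono hh hmC hmS dC dS (fun y => (he k le_rfl y).2) x b
    rw [State.qChkOf, ht.bChk, ht.reward]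
    linarith

/-- On the good event the confidence sets contain the transition measures and the value functions
enclose the optimal one, by induction on the episodes and, within an episode, backwards on the
stages. -/
theorem inConf_of_noiseBounds (ht : IsTuned M δ Bhat Bchk) (hnet : NetFamily c NB NT NC)
    (hn : NoiseBounds M δ Bhat Bchk NB NT NC s a) {k : ℕ} (hk : k < c.K) :
    (∀ h < c.H, InConf M s a δ Bhat Bchk k h) ∧ ∀ h ≤ c.H, Enclosed M s a k h := by
  induction k using Nat.strong_induction_on with
  | _ k ih =>
    have hback : ∀ n ≤ c.H, (∀ h < c.H, c.H ≤ h + n → InConf M s a δ Bhat Bchk k h) ∧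
        ∀ h ≤ c.H, c.H ≤ h + n → Enclosed M s a k h := by
      intro n
      induction n with
      | zero =>
        refine fun _ => ⟨fun h h1 h2 => absurd h2 (by omega), fun h h1 h2 x => ?_⟩
        obtain rfl : h = c.H := le_antisymm h1 h2
        rw [State.vHat_of_ge _ _ le_rfl, State.vChk_of_ge _ _ le_rfl, M.vStar_last]
        exact ⟨le_rfl, le_rfl⟩
      | succ n ihn =>
        intro hnH
        obtain ⟨ihc, ihe⟩ := ihn (by omega)
        have hall : ∀ j ≤ k, ∀ h', c.H ≤ h' + n → h' ≤ c.H → Enclosed M s a j h' := by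
          intro j hj h' h1 h2
          rcases hj.lt_or_eq with hj | rfl
          · exact (ih j hj (hj.trans hk)).2 h' h2
          · exact ihe h' h2 h1
        have hconf : ∀ h < c.H, c.H ≤ h + (n + 1) → InConf M s a δ Bhat Bchk k h := by
          intro h hh h1
          rcases (Nat.succ_le_of_lt hh).eq_or_lt with h2 | h2
          · exact inConf_last ht h2.symm
          · exact inConf_step ht hnet hn hk h2 (fun j hj h' h3 h4 => hall j hj h' (by omega) h4)
              fun i hi => varBounds ht hh ((ih i hi (hi.trans hk)).2 (h + 1) h2.le)
                ((ih i hi (hi.trans hk)).1 h hh)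
        refine ⟨hconf, fun h hh h1 => ?_⟩
        rcases hh.eq_or_lt with h2 | h2
        · exact ihe h hh (by omega)
        · refine enclosed_step ht h2 (fun j hj => hall j hj (h + 1) (by omega) h2) fun j hj => ?_
          rcases hj.lt_or_eq with hj | rfl
          · exact (ih j hj (hj.trans hk)).1 h h2
          · exact hconf h h2 h1
    have := hback c.H le_rfl
    exact ⟨fun h hh => this.1 h hh (by omega), fun h hh => this.2 h hh (by omega)⟩

end Induction

/-! ### The probability of the good event -/

section GoodEvent

/-- A union bound that distributes the failure probability `ε` evenly. -/
lemma measure_exists_mem_le {Ω ι : Type*} [MeasurableSpace Ω] (P : Measure Ω) (N : Finset ι)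
    {p : ι → Ω → Prop} {ε : ℝ}
    (h : ∀ i ∈ N, P {ω | p i ω} ≤ ENNReal.ofReal (ε / N.card)) :
    P {ω | ∃ i ∈ N, p i ω} ≤ ENNReal.ofReal ε := by
  have e : {ω | ∃ i ∈ N, p i ω} = ⋃ i ∈ N, {ω | p i ω} := by
    ext ω; simp
  rw [e]
  refine (measure_biUnion_finset_le _ _).trans ((Finset.sum_le_sum h).trans ?_)
  rw [Finset.sum_const, nsmul_eq_mul]
  rcases N.eq_empty_or_nonempty with rfl | hN
  · simp
  · have hc : (0 : ℝ) < N.card := by exact_mod_cast hN.card_pos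
    rw [← ENNReal.ofReal_natCast, ← ENNReal.ofReal_mul hc.le, mul_div_cancel₀ _ hc.ne']

variable {S A Ω : Type*} [MeasurableSpace S] [MeasurableSpace A] [MeasurableSingletonClass A]
  [Fintype A] [Nonempty A] [MeasurableSpace Ω] {d : ℕ} {c : Config S A d} {W δ Bhat Bchk : ℝ}
  {M : LinearMDP S A d c.H W} {P : Measure Ω} [IsProbabilityMeasure P]
  {s : ℕ → ℕ → Ω → S} {a : ℕ → ℕ → Ω → A}

/-- The noise of one of `n` functions, with the failure probability `δ / (H n)`. -/
lemma IsInteraction.measure_lt_noiseNorm_le (hI : IsInteraction M c P s a)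
    (ht : IsTuned M δ Bhat Bchk) {h : ℕ} (hh : h + 1 < c.H) {V : S → ℝ} (hV : Measurable V)
    {D : ℝ} (hD : 0 < D) (hV0 : ∀ x, 0 ≤ V x) (hVD : ∀ x, V x ≤ D) {n : ℕ} (hn : 0 < n) {r : ℝ}
    (hr0 : 0 ≤ r) (hr : D ^ 2 / (4 * c.H) * (2 * (Real.log (c.H / δ) + Real.log n) +
      d * Real.log (1 + c.K / (c.H * d * c.lam))) ≤ r ^ 2) :
    P {ω | ∃ k ≤ c.K, r < noiseNorm M (fun i l => s i l ω) (fun i l => a i l ω) h V k} ≤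
      ENNReal.ofReal (δ / c.H / n) := by
  have hHr : (0 : ℝ) < c.H := by exact_mod_cast ht.H_pos
  have hnr : (0 : ℝ) < n := by exact_mod_cast hn
  have hδ := ht.δ_pos
  refine le_trans (measure_mono ?_) (hI.measure_noise_hoeffding ht.phi ht.reward ht.lam_pos ht.d_pos
    hh hV hD hV0 hVD (δ := δ / c.H / n) (by positivity))
  rintro ω ⟨k, hk, hω⟩
  refine ⟨k, hk, lt_of_le_of_lt ?_ (pow_lt_pow_left₀ hω hr0 two_ne_zero)⟩
  rwa [show 1 / (δ / c.H / n) = c.H / δ * n by field_simp,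
    Real.log_mul (by positivity) hnr.ne']

omit [MeasurableSpace A] [MeasurableSingletonClass A] [Fintype A] [Nonempty A] in
lemma IsTuned.log_two_le (ht : IsTuned M δ Bhat Bchk) (hH : 2 ≤ c.H) :
    Real.log 2 ≤ Real.log (c.H / δ) := by
  have hHr : (2 : ℝ) ≤ c.H := by exact_mod_cast hH
  have h1 := ht.δ_pos
  have h2 := ht.δ_lt
  refine Real.log_le_log (by norm_num) ((le_div_iff₀ h1).mpr ?_)
  nlinarith

omit [MeasurableSpace A] [MeasurableSingletonClass A] [Fintype A] [Nonempty A] in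
lemma IsTuned.logTerm_nonneg (ht : IsTuned M δ Bhat Bchk) :
    0 ≤ Real.log (1 + c.K / (c.H * d * c.lam)) := by
  have hl := ht.lam_pos
  have : (0 : ℝ) ≤ c.K / (c.H * d * c.lam) := by positivity
  exact Real.log_nonneg (by linarith)

/-- The Hoeffding bound for all functions in a net, at all stages. The slack in the constant leaves
room for nets whose logarithmic size is twice the covering term `g`. -/
lemma IsInteraction.measure_net_hoeffding (hI : IsInteraction M c P s a)
    (ht : IsTuned M δ Bhat Bchk) {N : ℕ → Finset (S → ℝ)} {D g r : ℝ} (hD : 0 < D) (hg : 0 ≤ g)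
    (f : (S → ℝ) → S → ℝ) (hN0 : ∀ h < c.H, (N h).Nonempty)
    (hNb : ∀ h < c.H, ∀ V ∈ N h, Measurable (f V) ∧ ∀ x, 0 ≤ f V x ∧ f V x ≤ D)
    (hNc : ∀ h < c.H, Real.log (N h).card ≤ Real.log 2 + 2 * g)
    (hr : r = Real.sqrt (D ^ 2 / c.H) * Real.sqrt (d * Real.log (1 + c.K / (c.H * d * c.lam)) +
      Real.log (c.H / δ) + g)) :
    P {ω | ∃ h ∈ Finset.range c.H, ∃ V ∈ N (h + 1), h + 1 < c.H ∧ ∃ k ≤ c.K,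
      r < noiseNorm M (fun i l => s i l ω) (fun i l => a i l ω) h (f V) k} ≤
      ENNReal.ofReal δ := by
  have hHr : (0 : ℝ) < c.H := by exact_mod_cast ht.H_pos
  refine measure_exists_mem_le P _ fun h _ => ?_
  rw [Finset.card_range]
  refine measure_exists_mem_le P _ fun V hV => ?_
  by_cases hh : h + 1 < c.H
  · simp only [hh, true_and]
    have hb := hNb _ hh V hV
    have h2 := ht.log_two_le (by omega)
    have hℓ := mul_nonneg (Nat.cast_nonneg (α := ℝ) d) ht.logTerm_nonneg
    have hlog2 : 0 ≤ Real.log 2 := Real.log_nonneg (by norm_num)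
    refine hI.measure_lt_noiseNorm_le ht hh hb.1 hD (fun x => (hb.2 x).1) (fun x => (hb.2 x).2)
      (hN0 _ hh).card_pos (by rw [hr]; positivity) ?_
    have hcard := hNc _ hh
    rw [hr, mul_pow, Real.sq_sqrt (by positivity), Real.sq_sqrt (by linarith),
      show D ^ 2 / (4 * c.H) = D ^ 2 / c.H * (1 / 4) by field_simp, mul_assoc]
    refine mul_le_mul_of_nonneg_left ?_ (by positivity)
    linarith
  · simp [hh]

lemma one_le_log_four : 1 ≤ Real.log 4 := by
  have h := Real.log_two_gt_d9
  rw [show (4 : ℝ) = 2 ^ 2 by norm_num, Real.log_pow]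
  push_cast
  linarith

omit [MeasurableSpace A] [MeasurableSingletonClass A] [Fintype A] [Nonempty A] in
lemma IsTuned.log_four_le (ht : IsTuned M δ Bhat Bchk) :
    Real.log 4 ≤ Real.log (4 * c.K ^ 2 * c.H / δ) := by
  have h1 : (1 : ℝ) ≤ c.H := by exact_mod_cast ht.H_pos
  have h2 : (1 : ℝ) ≤ (c.K : ℝ) ^ 2 := one_le_pow₀ (by exact_mod_cast ht.K_pos)
  have h3 := ht.δ_pos
  refine Real.log_le_log (by norm_num) ((le_div_iff₀ h3).mpr ?_)
  nlinarith [ht.δ_lt]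

/-- The noise of the optimal value function, which needs no net. -/
lemma IsInteraction.measure_bad_one (hI : IsInteraction M c P s a) (ht : IsTuned M δ Bhat Bchk) :
    P {ω | ∃ h ∈ Finset.range c.H, h + 1 < c.H ∧ ∃ k ≤ c.K,
      (∀ i < k, M.var h (M.vStar (h + 1)) (s i h ω) (a i h ω) ≤
        1 * sigSeq c (fun i l => s i l ω) (fun i l => a i l ω) h i ^ 2) ∧
      betaOne d c.H c.K c.lam δ - c.H * Real.sqrt (c.lam * d) <
        noiseNorm M (fun i l => s i l ω) (fun i l => a i l ω) h (M.vStar (h + 1)) k} ≤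
      ENNReal.ofReal δ := by
  have hHr : (1 : ℝ) ≤ c.H := by exact_mod_cast ht.H_pos
  have hKr : (1 : ℝ) ≤ (c.K : ℝ) ^ 2 := one_le_pow₀ (by exact_mod_cast ht.K_pos)
  have hdr : (1 : ℝ) ≤ d := by exact_mod_cast ht.d_pos
  have hδ := ht.δ_pos
  refine measure_exists_mem_le P _ fun h _ => ?_
  rw [Finset.card_range]
  by_cases hh : h + 1 < c.H
  · simp only [hh, true_and]
    have hΛ : Real.log (1 / (δ / (4 * c.K ^ 2 * c.H))) = Real.log (4 * c.K ^ 2 * c.H / δ) := by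
      rw [one_div_div]
    have hΛ1 := one_le_log_four.trans ht.log_four_le
    have hm := hI.measure_noise_bernstein ht.phi ht.reward ht.lam_pos ht.d_pos hh
      (M.measurable_vStar (h + 1)) (M.vStar_nonneg (h + 1)) (M.vStar_le (h + 1)) (s2 := 1)
      (δ := δ / (4 * c.K ^ 2 * c.H)) zero_le_one (by positivity) (by rw [hΛ]; exact hΛ1)
    refine (measure_mono ?_).trans (hm.trans (ENNReal.ofReal_le_ofReal ?_))
    · rintro ω ⟨k, hk, hv, hω⟩
      refine ⟨k, hk, hv, ?_⟩
      rw [hΛ]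
      set Y := Real.log (4 * c.K ^ 2 * c.H / δ) with hY
      have hR : 1 / (c.H * Real.sqrt ((d : ℝ) ^ 5)) ≤ 1 := by
        rw [div_le_one (by positivity)]
        exact one_le_mul_of_one_le_of_one_le hHr (Real.one_le_sqrt.mpr (one_le_pow₀ hdr))
      refine pow_lt_pow_left₀ (lt_of_le_of_lt ?_ hω) (by positivity) two_ne_zero
      rw [betaOne, ← hY, one_mul]
      have := mul_le_mul_of_nonneg_right hR (by linarith : 0 ≤ Y)
      linarith
    · exact div_le_div_of_nonneg_left hδ.le (by linarith) (by nlinarith)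
  · simp [hh]

/-- The noise of `V̂ - V*`, for all functions in a net. The variance is smaller by the factor
`d³ H`, which pays for the size of the net. -/
lemma IsInteraction.measure_bad_two (hI : IsInteraction M c P s a) (ht : IsTuned M δ Bhat Bchk)
    {N : ℕ → Finset (S → ℝ)} (hN0 : ∀ h < c.H, (N h).Nonempty)
    (hNb : ∀ h < c.H, ∀ V ∈ N h, Measurable V ∧ ∀ x, 0 ≤ V x ∧ V x ≤ c.H)
    (hNc : ∀ h < c.H, Real.log (N h).card ≤
      Real.log 2 + 2 * coverTerm d c.H c.K c.lam W Bhat) :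
    P {ω | ∃ h ∈ Finset.range c.H, ∃ V ∈ N (h + 1), h + 1 < c.H ∧ ∃ k ≤ c.K,
      (∀ i < k, M.var h (fun x => max (V x) (M.vStar (h + 1) x) - M.vStar (h + 1) x)
          (s i h ω) (a i h ω) ≤
        1 / (d ^ 3 * c.H) * sigSeq c (fun i l => s i l ω) (fun i l => a i l ω) h i ^ 2) ∧
      betaTwo d c.H c.K c.lam W δ Bhat - c.H * Real.sqrt (c.lam * d) - 2 <
        noiseNorm M (fun i l => s i l ω) (fun i l => a i l ω) h
          (fun x => max (V x) (M.vStar (h + 1) x) - M.vStar (h + 1) x) k} ≤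
      ENNReal.ofReal δ := by
  have hHr : (1 : ℝ) ≤ c.H := by exact_mod_cast ht.H_pos
  have hKr : (1 : ℝ) ≤ (c.K : ℝ) ^ 2 := one_le_pow₀ (by exact_mod_cast ht.K_pos)
  have hdr : (1 : ℝ) ≤ d := by exact_mod_cast ht.d_pos
  have hδ := ht.δ_pos
  refine measure_exists_mem_le P _ fun h _ => ?_
  rw [Finset.card_range]
  refine measure_exists_mem_le P _ fun V hV => ?_
  by_cases hh : h + 1 < c.H
  · simp only [hh, true_and]
    have hb := hNb _ hh V hV
    have hcard : (1 : ℝ) ≤ (N (h + 1)).card := by exact_mod_cast (hN0 _ hh).card_pos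
    have hlogc := Real.log_nonneg hcard
    have hcard2 := hNc _ hh
    have hΛ : Real.log (1 / (δ / (4 * c.K ^ 2 * c.H) / (N (h + 1)).card)) =
        Real.log (4 * c.K ^ 2 * c.H / δ) + Real.log (N (h + 1)).card := by
      rw [← Real.log_mul (by positivity) (by positivity)]
      congr 1
      field_simp
    have hΛ1 := one_le_log_four.trans ht.log_four_le
    have h24 : Real.log 2 ≤ Real.log 4 := Real.log_le_log (by norm_num) (by norm_num)
    have h4 := ht.log_four_le
    have hg0 := coverTerm_nonneg ht.lam_pos ht.W_nonneg d c.H c.K Bhat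
    have hm := hI.measure_noise_bernstein ht.phi ht.reward ht.lam_pos ht.d_pos hh
      (V := fun x => max (V x) (M.vStar (h + 1) x) - M.vStar (h + 1) x)
      ((hb.1.max (M.measurable_vStar (h + 1))).sub (M.measurable_vStar (h + 1)))
      (fun x => sub_nonneg.mpr (le_max_right _ _))
      (fun x => (sub_le_self _ (M.vStar_nonneg _ _)).trans
        (max_le (hb.2 x).2 (M.vStar_le _ x))) (s2 := 1 / (d ^ 3 * c.H))
      (δ := δ / (4 * c.K ^ 2 * c.H) / (N (h + 1)).card) (by positivity) (by positivity)
      (by rw [hΛ]; linarith)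
    refine (measure_mono ?_).trans (hm.trans (ENNReal.ofReal_le_ofReal ?_))
    · rintro ω ⟨k, hk, hv, hω⟩
      refine ⟨k, hk, hv, ?_⟩
      rw [hΛ]
      have hℓ := ht.logTerm_nonneg
      rw [betaTwo] at hω
      set Y := Real.log (4 * c.K ^ 2 * c.H / δ) with hY
      set Λ := Y + Real.log (N (h + 1)).card with hΛd
      set g := coverTerm d c.H c.K c.lam W Bhat
      set ℓ := Real.log (1 + c.K / (c.H * d * c.lam))
      have hΛ2 : Λ ≤ 2 * (Y + g) := by linarith
      have hΛ0 : 0 ≤ Λ := by linarith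
      refine pow_lt_pow_left₀ (lt_of_le_of_lt ?_ hω) (by positivity) two_ne_zero
      have e1 : Real.sqrt (1 / (d ^ 3 * c.H) * (d * ℓ) * Λ) ≤
          Real.sqrt (2 / (c.H * d ^ 2) * ℓ * (Y + g)) := by
        apply Real.sqrt_le_sqrt
        calc 1 / (d ^ 3 * c.H) * (d * ℓ) * Λ = 1 / (c.H * d ^ 2) * ℓ * Λ := by field_simp
          _ ≤ 1 / (c.H * d ^ 2) * ℓ * (2 * (Y + g)) := by gcongr
          _ = 2 / (c.H * d ^ 2) * ℓ * (Y + g) := by ring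
      have e2 : 2 * (1 / (c.H * Real.sqrt ((d : ℝ) ^ 5))) * Λ ≤
          4 / (c.H * Real.sqrt ((d : ℝ) ^ 5)) * (Y + g) := by
        calc 2 * (1 / (c.H * Real.sqrt ((d : ℝ) ^ 5))) * Λ
            ≤ 2 * (1 / (c.H * Real.sqrt ((d : ℝ) ^ 5))) * (2 * (Y + g)) := by gcongr
          _ = 4 / (c.H * Real.sqrt ((d : ℝ) ^ 5)) * (Y + g) := by ring
      linarith
    · refine div_le_div_of_nonneg_right ?_ (by positivity)
      exact div_le_div_of_nonneg_left hδ.le (by linarith) (by nlinarith)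
  · simp [hh]

omit [MeasurableSpace A] [MeasurableSingletonClass A] in
/-- The nets exist, with sizes matching the covering terms of the radii. The accuracies are those for
which the bias of the approximation is at most `2`. -/
lemma IsTuned.exists_nets (ht : IsTuned M δ Bhat Bchk) : ∃ NB NT NC : ℕ → Finset (S → ℝ),
    NetFamily c NB NT NC ∧
    (∀ h < c.H, (NB h).Nonempty ∧ Real.log (NB h).card ≤
      Real.log 2 + 2 * coverTerm d c.H c.K c.lam W Bhat) ∧
    (∀ h < c.H, (NT h).Nonempty ∧ Real.log (NT h).card ≤ Real.log 2 + 2 * (numJ d c.H c.K *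
      netExp d c.lam (bigL c.K c.lam W) Bhat (Real.sqrt c.lam / (2 * c.K)))) ∧
    ∀ h < c.H, (NC h).Nonempty ∧ Real.log (NC h).card ≤
      netExp d c.lam (bigL c.K c.lam W) Bchk (zeta c) := by
  have hl := ht.lam_pos
  have hKr : (0 : ℝ) < c.K := by exact_mod_cast ht.K_pos
  have hε : 0 < Real.sqrt c.lam / (2 * c.K) := div_pos (Real.sqrt_pos.mpr hl) (by positivity)
  have hL : 0 ≤ bigL c.K c.lam W := add_nonneg ht.W_nonneg (by positivity)
  have hJ := numJ_nonneg d c.H c.K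
  have key : ∀ ε > 0, ∃ N : ℕ → Finset (S → ℝ), ∀ h < c.H, ((N h).Nonempty ∧
      Real.log (N h).card ≤ Real.log 2 +
        2 * (numJ d c.H c.K * netExp d c.lam (bigL c.K c.lam W) Bhat ε)) ∧
      IsNetHat c h ⌊2 * numJ d c.H c.K⌋₊ ε (N h) := by
    intro ε hε
    have hex : ∀ h, ∃ N : Finset (S → ℝ), h < c.H → ((N.Nonempty ∧
        Real.log N.card ≤ Real.log 2 +
          2 * (numJ d c.H c.K * netExp d c.lam (bigL c.K c.lam W) Bhat ε)) ∧
        IsNetHat c h ⌊2 * numJ d c.H c.K⌋₊ ε N) := by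
      intro h
      by_cases hh : h < c.H
      · obtain ⟨N, h1, h2, h3, h4⟩ := exists_net_vHat M ht.phi ht.reward hl ht.d_pos ht.W_nonneg
          ht.bHat_nonneg ht.bHat_le hh hε ⌊2 * numJ d c.H c.K⌋₊
        refine ⟨N, fun _ => ⟨⟨h1, h2.trans ?_⟩, ⟨h3, h4⟩⟩⟩
        have := mul_le_mul_of_nonneg_right (Nat.floor_le (by positivity : 0 ≤ 2 * numJ d c.H c.K))
          (netExp_nonneg (d := d) (B := Bhat) hl hL hε)
        linarith
      · exact ⟨∅, fun h => absurd h hh⟩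
    choose N hN using hex
    exact ⟨N, hN⟩
  obtain ⟨NB, hNB⟩ := key _ ht.zeta_pos
  obtain ⟨NT, hNT⟩ := key _ hε
  have hex : ∀ h, ∃ N : Finset (S → ℝ), h < c.H → ((N.Nonempty ∧
      Real.log N.card ≤ netExp d c.lam (bigL c.K c.lam W) Bchk (zeta c)) ∧
      IsNetChk c h (zeta c) N) := by
    intro h
    by_cases hh : h < c.H
    · obtain ⟨N, h1, h2, h3, h4⟩ := exists_net_vChk M ht.phi ht.reward hl ht.d_pos ht.W_nonneg
        ht.bChk_nonneg ht.bChk_le hh ht.zeta_pos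
      exact ⟨N, fun _ => ⟨⟨h1, h2⟩, ⟨h3, h4⟩⟩⟩
    · exact ⟨∅, fun h => absurd h hh⟩
  choose NC hNC using hex
  refine ⟨NB, NT, NC, ⟨fun h hh => (hNB h hh).2, fun h hh => (hNT h hh).2,
    fun h hh => (hNC h hh).2⟩, fun h hh => ?_, fun h hh => (hNT h hh).1, fun h hh => (hNC h hh).1⟩
  rw [coverTerm_eq hl]
  exact (hNB h hh).1

/-- The bad sets need not be measurable, and are replaced by a measurable hull. -/
lemma exists_measurableSet_compl {Ω : Type*} [MeasurableSpace Ω] (P : Measure Ω)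
    [IsProbabilityMeasure P] {n : ℕ} {B : Fin n → Set Ω} {δ : ℝ} (hδ : 0 ≤ δ)
    (hB : ∀ i, P (B i) ≤ ENNReal.ofReal δ) : ∃ G : Set Ω, MeasurableSet G ∧
      ENNReal.ofReal (1 - n * δ) ≤ P G ∧ ∀ ω ∈ G, ∀ i, ω ∉ B i := by
  refine ⟨(toMeasurable P (⋃ i, B i))ᶜ, (measurableSet_toMeasurable _ _).compl, ?_,
    fun ω hω i hi => hω (subset_toMeasurable _ _ (Set.mem_iUnion_of_mem i hi))⟩
  rw [prob_compl_eq_one_sub (measurableSet_toMeasurable _ _), measure_toMeasurable]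
  have h : P (⋃ i, B i) ≤ n * ENNReal.ofReal δ := by
    refine (measure_iUnion_fintype_le _ _).trans ((Finset.sum_le_sum fun i _ => hB i).trans ?_)
    simp
  rw [ENNReal.ofReal_sub _ (by positivity), ENNReal.ofReal_mul (by positivity),
    ENNReal.ofReal_one, ENNReal.ofReal_natCast]
  exact tsub_le_tsub_left h _

/-- With probability at least `1 - 5δ` the noise of all relevant functions is small. -/
theorem IsInteraction.exists_good_event (hI : IsInteraction M c P s a)
    (ht : IsTuned M δ Bhat Bchk) : ∃ NB NT NC : ℕ → Finset (S → ℝ), NetFamily c NB NT NC ∧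
      ∃ G : Set Ω, MeasurableSet G ∧ ENNReal.ofReal (1 - 5 * δ) ≤ P G ∧ ∀ ω ∈ G,
        NoiseBounds M δ Bhat Bchk NB NT NC (fun i l => s i l ω) (fun i l => a i l ω) := by
  obtain ⟨NB, NT, NC, hnet, hB, hT, hC⟩ := ht.exists_nets
  refine ⟨NB, NT, NC, hnet, ?_⟩
  have hl := ht.lam_pos
  have hHr : (0 : ℝ) < c.H := by exact_mod_cast ht.H_pos
  have hKr : (0 : ℝ) < c.K := by exact_mod_cast ht.K_pos
  have hL : 0 ≤ bigL c.K c.lam W := add_nonneg ht.W_nonneg (by positivity)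
  have hε : 0 < Real.sqrt c.lam / (2 * c.K) := div_pos (Real.sqrt_pos.mpr hl) (by positivity)
  have hJ := numJ_nonneg d c.H c.K
  have hlog2 : 0 ≤ Real.log 2 := Real.log_nonneg (by norm_num)
  have hgB := coverTerm_nonneg hl ht.W_nonneg d c.H c.K Bhat
  have hgT := netExp_nonneg (d := d) (B := Bhat) hl hL hε
  have hgC := netExp_nonneg (d := d) (B := Bchk) hl hL ht.zeta_pos
  have m1 := hI.measure_net_hoeffding ht (N := NB) hHr hgB id (fun h hh => (hB h hh).1)
    (fun h hh => (hnet.bar h hh).bounds) (fun h hh => (hB h hh).2) rfl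
  have m2 := hI.measure_net_hoeffding ht (N := NT) (D := (c.H : ℝ) ^ 2) (by positivity)
    (mul_nonneg hJ hgT) (fun V x => V x ^ 2) (fun h hh => (hT h hh).1)
    (fun h hh V hV => by
      have hb := (hnet.til h hh).bounds V hV
      exact ⟨hb.1.pow_const 2, fun x => ⟨sq_nonneg _,
        pow_le_pow_left₀ (hb.2 x).1 (hb.2 x).2 2⟩⟩) (fun h hh => (hT h hh).2) rfl
  have m3 := hI.measure_net_hoeffding ht (N := NC) hHr hgC id (fun h hh => (hC h hh).1)
    (fun h hh => (hnet.chk h hh).bounds) (fun h hh => by linarith [(hC h hh).2]) rfl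
  have m4 := hI.measure_bad_one ht
  have m5 := hI.measure_bad_two ht (N := NB) (fun h hh => (hB h hh).1)
    (fun h hh => (hnet.bar h hh).bounds) (fun h hh => (hB h hh).2)
  obtain ⟨G, hG, hGP, hGB⟩ := exists_measurableSet_compl P
    (B := ![_, _, _, _, _]) ht.δ_pos.le (fun i => by
      fin_cases i
      exacts [m1, m2, m3, m4, m5])
  refine ⟨G, hG, hGP, fun ω hω => ?_⟩
  have b1 := hGB ω hω 0
  have b2 := hGB ω hω 1
  have b3 := hGB ω hω 2
  have b4 := hGB ω hω 3
  have b5 := hGB ω hω 4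
  have hsq : (c.H : ℝ) ^ 2 / c.H = c.H := by field_simp
  have hcu : ((c.H : ℝ) ^ 2) ^ 2 / c.H = c.H ^ 3 := by field_simp
  refine ⟨fun h hh V hV k hk => ?_, fun h hh V hV k hk => ?_, fun h hh V hV k hk => ?_,
    fun h hh k hk hv => ?_, fun h hh V hV k hk hv => ?_⟩
  · by_contra hlt
    refine b1 ⟨h, Finset.mem_range.mpr (by omega), V, hV, hh, k, hk, lt_of_eq_of_lt ?_
      (not_le.mp hlt)⟩
    rw [hsq, betaBar]
    ring
  · by_contra hlt
    refine b2 ⟨h, Finset.mem_range.mpr (by omega), V, hV, hh, k, hk, lt_of_eq_of_lt ?_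
      (not_le.mp hlt)⟩
    have e1 : 4 * bigL c.K c.lam W / (Real.sqrt c.lam / (2 * c.K)) =
        8 * c.K * bigL c.K c.lam W / Real.sqrt c.lam := by
      rw [div_div_eq_mul_div]; ring
    have e2 : 8 * Bhat ^ 2 * Real.sqrt d / (c.lam * (Real.sqrt c.lam / (2 * c.K)) ^ 2) =
        32 * c.K ^ 2 * Bhat ^ 2 * Real.sqrt d / c.lam ^ 2 := by
      rw [div_pow, Real.sq_sqrt hl.le]
      field_simp
      ring
    rw [hcu, betaTil, netExp, e1, e2, mul_add, ← add_assoc, mul_left_comm (numJ _ _ _) (d : ℝ),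
      mul_left_comm (numJ _ _ _) ((d : ℝ) ^ 2)]
    ring_nf
  · by_contra hlt
    refine b3 ⟨h, Finset.mem_range.mpr (by omega), V, hV, hh, k, hk, lt_of_eq_of_lt ?_
      (not_le.mp hlt)⟩
    have e1 : 4 * bigL c.K c.lam W / zeta c =
        4 * c.K * bigL c.K c.lam W / (c.H * Real.sqrt c.lam) := by
      rw [zeta, div_div_eq_mul_div]; ring
    have e2 : 8 * Bchk ^ 2 * Real.sqrt d / (c.lam * zeta c ^ 2) =
        8 * c.K ^ 2 * Bchk ^ 2 * Real.sqrt d / (c.H ^ 2 * c.lam ^ 2) := by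
      rw [zeta, div_pow, mul_pow, Real.sq_sqrt hl.le]
      field_simp
    rw [hsq, betaChk, netExp, e1, e2, ← add_assoc]
    ring
  · by_contra hlt
    exact b4 ⟨h, Finset.mem_range.mpr (by omega), hh, k, hk, hv, not_le.mp hlt⟩
  · by_contra hlt
    exact b5 ⟨h, Finset.mem_range.mpr (by omega), V, hV, hh, k, hk, hv, not_le.mp hlt⟩

end GoodEvent

/-! ### The size of the exploration radius -/

section RadiusSize

variable {d H K : ℕ} {W δ B x : ℝ}

lemma one_lt_log_three : 1 < Real.log 3 := by
  rw [Real.lt_log_iff_exp_lt (by norm_num)]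
  exact Real.exp_one_lt_d9.trans (by norm_num)

/-- For the smallest admissible `λ`, the radius `β̂` is bounded in terms of any `x` that dominates
the four logarithms which occur in it. -/
lemma betaHat_le_of_logs (hd : 0 < d) (hH : 0 < H) {lam : ℝ}
    (hlam : lam = 1 / ((H : ℝ) ^ 2 * Real.sqrt d)) (hW : 0 ≤ W) (hx : 1 ≤ x)
    (h1 : Real.log (1 + K) ≤ x) (h2 : Real.log (1 + K / (H * d * lam)) ≤ x)
    (h3 : Real.log (4 * K ^ 2 * H / δ) ≤ 4 * x) (h3' : 0 ≤ Real.log (4 * K ^ 2 * H / δ))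
    (h4 : Real.log (1 + 4 * K * bigL K lam W / (H * Real.sqrt lam)) ≤ 4 * x)
    (h5 : Real.log (1 + 8 * K ^ 2 * B ^ 2 * Real.sqrt d / (H ^ 2 * lam ^ 2)) ≤ 4 * x) :
    betaHat d H K lam W δ B ≤ 124 * Real.sqrt d * x ^ 2 := by
  have hHr : (1 : ℝ) ≤ H := by exact_mod_cast hH
  have hdr : (1 : ℝ) ≤ d := by exact_mod_cast hd
  have hl : 0 < lam := by rw [hlam]; positivity
  have hs1 : 1 ≤ Real.sqrt d := Real.one_le_sqrt.mpr hdr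
  have hss : Real.sqrt d ^ 2 = d := Real.sq_sqrt (by positivity)
  have hx0 : 0 ≤ x := by linarith
  have hxx : x ≤ x ^ 2 := by nlinarith
  have hsx : x ^ 2 ≤ Real.sqrt d * x ^ 2 := le_mul_of_one_le_left (by positivity) hs1
  have hsx' : Real.sqrt d ≤ Real.sqrt d * x ^ 2 :=
    le_mul_of_one_le_right (by positivity) (by nlinarith)
  -- the bias term is `d ^ (1/4)`
  have hbias : H * Real.sqrt (lam * d) ≤ Real.sqrt d := by
    have e : lam * d = Real.sqrt d / H ^ 2 := by
      rw [hlam]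
      nth_rw 2 [← hss]
      field_simp
    rw [e, Real.sqrt_div (Real.sqrt_nonneg _), Real.sqrt_sq (by positivity), mul_div_cancel₀ _
      (by positivity)]
    exact Real.sqrt_le_sqrt (by nlinarith)
  have hJ : numJ d H K ≤ d * H * x := mul_le_mul_of_nonneg_left h1 (by positivity)
  have hJ0 := numJ_nonneg d H K
  have hcov : coverTerm d H K lam W B ≤ 8 * (d ^ 3 * H * x ^ 2) := by
    have t1 : d * numJ d H K * Real.log (1 + 4 * K * bigL K lam W / (H * Real.sqrt lam)) ≤
        d ^ 2 * (d * H * x) * (4 * x) := by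
      refine (mul_le_mul_of_nonneg_left h4 (by positivity)).trans ?_
      gcongr
      nlinarith
    have t2 : d ^ 2 * numJ d H K *
        Real.log (1 + 8 * K ^ 2 * B ^ 2 * Real.sqrt d / (H ^ 2 * lam ^ 2)) ≤
        d ^ 2 * (d * H * x) * (4 * x) := by
      refine (mul_le_mul_of_nonneg_left h5 (by positivity)).trans ?_
      gcongr
    rw [coverTerm]
    nlinarith
  have hcov0 := coverTerm_nonneg hl hW d H K B
  have hR : Real.log (4 * K ^ 2 * H / δ) + coverTerm d H K lam W B ≤
      12 * (d ^ 3 * H * x ^ 2) := by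
    have h6 : (1 : ℝ) ≤ d ^ 3 * H := one_le_mul_of_one_le_of_one_le (one_le_pow₀ hdr) hHr
    have : x ^ 2 ≤ d ^ 3 * H * x ^ 2 := le_mul_of_one_le_left (by positivity) h6
    linarith
  have hℓ0 : 0 ≤ Real.log (1 + K / (H * d * lam)) := by
    have : (0 : ℝ) ≤ K / (H * d * lam) := by positivity
    exact Real.log_nonneg (by linarith)
  have hone : betaOne d H K lam δ ≤ 33 * (Real.sqrt d * x ^ 2) := by
    have e1 : Real.sqrt (d * Real.log (1 + K / (H * d * lam)) * Real.log (4 * K ^ 2 * H / δ)) ≤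
        2 * (Real.sqrt d * x ^ 2) := by
      refine Real.sqrt_le_iff.mpr ⟨by positivity, ?_⟩
      calc d * Real.log (1 + K / (H * d * lam)) * Real.log (4 * K ^ 2 * H / δ)
          ≤ d * x * (4 * x) := by gcongr
        _ ≤ d * x ^ 2 * (4 * x ^ 2) := by gcongr
        _ = (2 * (Real.sqrt d * x ^ 2)) ^ 2 := by rw [mul_pow, mul_pow, hss]; ring
    rw [betaOne]
    linarith
  have htwo : betaTwo d H K lam W δ B ≤ 91 * (Real.sqrt d * x ^ 2) := by
    have e1 : Real.sqrt (2 / (H * d ^ 2) * Real.log (1 + K / (H * d * lam)) *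
        (Real.log (4 * K ^ 2 * H / δ) + coverTerm d H K lam W B)) ≤
        5 * (Real.sqrt d * x ^ 2) := by
      refine Real.sqrt_le_iff.mpr ⟨by positivity, ?_⟩
      calc 2 / (H * d ^ 2) * Real.log (1 + K / (H * d * lam)) *
            (Real.log (4 * K ^ 2 * H / δ) + coverTerm d H K lam W B)
          ≤ 2 / (H * d ^ 2) * x * (12 * (d ^ 3 * H * x ^ 2)) := by gcongr
        _ ≤ 2 / (H * d ^ 2) * x ^ 2 * (12 * (d ^ 3 * H * x ^ 2)) := by gcongr
        _ = 24 * (d * x ^ 4) := by field_simp; ring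
        _ ≤ 25 * (d * x ^ 4) := by gcongr; norm_num
        _ = (5 * (Real.sqrt d * x ^ 2)) ^ 2 := by rw [mul_pow, mul_pow, hss]; ring
    have e2 : 4 / (H * Real.sqrt ((d : ℝ) ^ 5)) *
        (Real.log (4 * K ^ 2 * H / δ) + coverTerm d H K lam W B) ≤
        48 * (Real.sqrt d * x ^ 2) := by
      have h5 : Real.sqrt ((d : ℝ) ^ 5) = d ^ 2 * Real.sqrt d := by
        rw [show (d : ℝ) ^ 5 = (d ^ 2) ^ 2 * d by ring, Real.sqrt_mul (by positivity),
          Real.sqrt_sq (by positivity)]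
      rw [h5]
      calc 4 / (H * (d ^ 2 * Real.sqrt d)) *
            (Real.log (4 * K ^ 2 * H / δ) + coverTerm d H K lam W B)
          ≤ 4 / (H * (d ^ 2 * Real.sqrt d)) * (12 * (d ^ 2 * Real.sqrt d ^ 2 * H * x ^ 2)) := by
            rw [hss]
            gcongr
            linarith
        _ = 48 * (Real.sqrt d * x ^ 2) := by field_simp; ring
    rw [betaTwo]
    linarith
  rw [betaHat]
  linarith

lemma div_mul_sqrt_le (hd : 0 < d) (hH : 0 < H) (hK : 0 < K) (hW : 0 ≤ W) {lam : ℝ}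
    (hlam : lam = 1 / ((H : ℝ) ^ 2 * Real.sqrt d)) :
    4 * K * bigL K lam W / (H * Real.sqrt lam) ≤ 4 * (K ^ 2 * H ^ 2 * d ^ 2 * (1 + W)) := by
  have hHr : (1 : ℝ) ≤ H := by exact_mod_cast hH
  have hdr : (1 : ℝ) ≤ d := by exact_mod_cast hd
  have hKr : (1 : ℝ) ≤ K := by exact_mod_cast hK
  have hl : 0 < lam := by rw [hlam]; positivity
  have hL : bigL K lam W ≤ (1 + W) * (K * H ^ 2 * d) := by
    rw [bigL, hlam, div_div_eq_mul_div, div_one]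
    have e1 : K * (H ^ 2 * Real.sqrt d) ≤ K * H ^ 2 * d := by
      rw [mul_assoc]
      gcongr
      exact Real.sqrt_le_iff.mpr ⟨by positivity, le_self_pow₀ hdr two_ne_zero⟩
    have e2 : (1 : ℝ) ≤ K * H ^ 2 * d := one_le_mul_of_one_le_of_one_le
      (one_le_mul_of_one_le_of_one_le hKr (one_le_pow₀ hHr)) hdr
    have e3 := le_mul_of_one_le_right hW e2
    linarith
  have hden : 1 / (d : ℝ) ≤ H * Real.sqrt lam := by
    have e : H * Real.sqrt lam = 1 / Real.sqrt (Real.sqrt d) := by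
      rw [hlam, Real.sqrt_div zero_le_one, Real.sqrt_mul (by positivity),
        Real.sqrt_sq (by positivity), Real.sqrt_one]
      field_simp
    rw [e]
    refine one_div_le_one_div_of_le (by positivity) (Real.sqrt_le_iff.mpr
      ⟨by positivity, Real.sqrt_le_iff.mpr ⟨by positivity, ?_⟩⟩)
    rw [← pow_mul]
    exact le_self_pow₀ hdr (by norm_num)
  calc 4 * K * bigL K lam W / (H * Real.sqrt lam)
      ≤ 4 * K * ((1 + W) * (K * H ^ 2 * d)) / (1 / d) := by gcongr
    _ = 4 * (K ^ 2 * H ^ 2 * d ^ 2 * (1 + W)) := by field_simp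

lemma div_sq_mul_sq_le (hd : 0 < d) (hH : 0 < H) (hB : 0 ≤ B) {lam : ℝ}
    (hlam : lam = 1 / ((H : ℝ) ^ 2 * Real.sqrt d)) :
    8 * K ^ 2 * B ^ 2 * Real.sqrt d / (H ^ 2 * lam ^ 2) ≤
      8 * (K ^ 2 * (1 + B) ^ 2 * d ^ 2 * H ^ 2) := by
  have hHr : (1 : ℝ) ≤ H := by exact_mod_cast hH
  have hdr : (1 : ℝ) ≤ d := by exact_mod_cast hd
  have hsd : Real.sqrt d ≤ d :=
    Real.sqrt_le_iff.mpr ⟨by positivity, le_self_pow₀ hdr two_ne_zero⟩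
  calc 8 * K ^ 2 * B ^ 2 * Real.sqrt d / (H ^ 2 * lam ^ 2)
      = 8 * K ^ 2 * B ^ 2 * Real.sqrt d * (H ^ 2 * Real.sqrt d ^ 2) := by
        rw [hlam]
        field_simp
    _ = 8 * (K ^ 2 * B ^ 2 * (Real.sqrt d * d) * H ^ 2) := by
        rw [Real.sq_sqrt (by positivity)]
        ring
    _ ≤ 8 * (K ^ 2 * (1 + B) ^ 2 * (d * d) * H ^ 2) := by
        gcongr
        linarith
    _ = 8 * (K ^ 2 * (1 + B) ^ 2 * d ^ 2 * H ^ 2) := by ring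

/-- The exploration radius is `O(√d log²)`. -/
lemma betaHat_le (hd : 0 < d) (hH : 0 < H) (hK : 0 < K) (hW : 0 ≤ W) (hδ : 0 < δ) (hδ1 : δ < 1)
    (hB : 0 ≤ B) : betaHat d H K (1 / ((H : ℝ) ^ 2 * Real.sqrt d)) W δ B ≤
      124 * Real.sqrt d * Real.log (3 + d * H * K * (1 + W) * (1 + B) / δ) ^ 2 := by
  obtain ⟨lam, hlam⟩ : ∃ lam, lam = 1 / ((H : ℝ) ^ 2 * Real.sqrt d) := ⟨_, rfl⟩
  have hHr : (1 : ℝ) ≤ H := by exact_mod_cast hH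
  have hdr : (1 : ℝ) ≤ d := by exact_mod_cast hd
  have hKr : (1 : ℝ) ≤ K := by exact_mod_cast hK
  have hl : 0 < lam := by rw [hlam]; positivity
  have hs1 : 1 ≤ Real.sqrt d := Real.one_le_sqrt.mpr hdr
  have hL0 : 0 ≤ bigL K lam W := add_nonneg hW (by positivity)
  have a2 : K / (H * d * lam) ≤ (K : ℝ) * H := by
    have e : K / (H * d * lam) = K * H * Real.sqrt d / d := by
      rw [hlam]
      field_simp
    rw [e, div_le_iff₀ (by positivity)]
    gcongr
    exact Real.sqrt_le_iff.mpr ⟨by positivity, le_self_pow₀ hdr two_ne_zero⟩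
  have a4 := div_mul_sqrt_le hd hH hK hW hlam
  have a5 := div_sq_mul_sq_le (K := K) hd hH hB hlam
  have p4 : 0 ≤ 4 * K * bigL K lam W / (H * Real.sqrt lam) := by positivity
  have p5 : 0 ≤ 8 * K ^ 2 * B ^ 2 * Real.sqrt d / (H ^ 2 * lam ^ 2) := by positivity
  obtain ⟨u, hu⟩ : ∃ u, u = δ⁻¹ := ⟨_, rfl⟩
  have hu1 : 1 ≤ u := by rw [hu]; exact (one_le_inv₀ hδ).mpr hδ1.le
  have hw1 : 1 ≤ 1 + W := by linarith
  have hb1 : 1 ≤ 1 + B := by linarith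
  rw [← hlam, div_eq_mul_inv _ δ, ← hu]
  obtain ⟨q, hq⟩ : ∃ q : ℝ, q = d * H * K * (1 + W) * (1 + B) * u := ⟨_, rfl⟩
  rw [← hq]
  have hq1 : 1 ≤ q := by
    calc (1 : ℝ) = 1 * 1 * 1 * 1 * 1 * 1 := by norm_num
      _ ≤ q := by rw [hq]; gcongr
  have hq2 : 1 ≤ q ^ 2 := one_le_pow₀ hq1
  have hz2 : 9 * q ^ 2 ≤ (3 + q) ^ 4 := by
    calc 9 * q ^ 2 = 3 ^ 2 * q ^ 2 := by ring
      _ ≤ (3 + q) ^ 2 * (3 + q) ^ 2 := by gcongr <;> linarith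
      _ = (3 + q) ^ 4 := by ring
  have pow4 : ∀ y, 0 < y → y ≤ 9 * q ^ 2 → Real.log y ≤ 4 * Real.log (3 + q) := by
    intro y hy hyq
    have := Real.log_le_log hy (hyq.trans hz2)
    rwa [Real.log_pow] at this
  have mono1 : (K : ℝ) * H ≤ q := by
    calc (K : ℝ) * H = 1 * H * K * 1 * 1 * 1 := by ring
      _ ≤ q := by rw [hq]; gcongr
  have mono2 : (K : ℝ) ^ 2 * H * u ≤ q ^ 2 := by
    calc (K : ℝ) ^ 2 * H * u ≤ K ^ 2 * H ^ 2 * u ^ 2 := by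
          gcongr
          · exact le_self_pow₀ hHr two_ne_zero
          · exact le_self_pow₀ hu1 two_ne_zero
      _ = (1 * H * K * 1 * 1 * u) ^ 2 := by ring
      _ ≤ q ^ 2 := by rw [hq]; gcongr
  have mono3 : (K : ℝ) ^ 2 * H ^ 2 * d ^ 2 * (1 + W) ≤ q ^ 2 := by
    calc (K : ℝ) ^ 2 * H ^ 2 * d ^ 2 * (1 + W) ≤ K ^ 2 * H ^ 2 * d ^ 2 * (1 + W) ^ 2 := by
          gcongr
          exact le_self_pow₀ hw1 two_ne_zero
      _ = (d * H * K * (1 + W) * 1 * 1) ^ 2 := by ring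
      _ ≤ q ^ 2 := by rw [hq]; gcongr
  have mono4 : (K : ℝ) ^ 2 * (1 + B) ^ 2 * d ^ 2 * H ^ 2 ≤ q ^ 2 := by
    calc (K : ℝ) ^ 2 * (1 + B) ^ 2 * d ^ 2 * H ^ 2 = (d * H * K * 1 * (1 + B) * 1) ^ 2 := by ring
      _ ≤ q ^ 2 := by rw [hq]; gcongr
  refine betaHat_le_of_logs hd hH hlam hW ?_ ?_ ?_ ?_ (log_four_mul_nonneg hH hK hδ hδ1) ?_ ?_
  · exact one_lt_log_three.le.trans (Real.log_le_log (by norm_num) (by linarith))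
  · have := le_mul_of_one_le_right (Nat.cast_nonneg (α := ℝ) K) hHr
    exact Real.log_le_log (by positivity) (by linarith)
  · exact Real.log_le_log (by positivity) (by linarith)
  · refine pow4 _ (by positivity) ?_
    rw [div_eq_mul_inv, ← hu]
    linarith
  · exact pow4 _ (by linarith) (by linarith)
  · exact pow4 _ (by linarith) (by linarith)

/-- The constant `B̂` can be chosen of the order `√d log²`: the radius depends on it only
logarithmically. -/
lemma exists_betaHat_le (hd : 0 < d) (hH : 0 < H) (hK : 0 < K) (hW : 0 ≤ W) (hδ : 0 < δ)
    (hδ1 : δ < 1) : ∃ B : ℝ, betaHat d H K (1 / ((H : ℝ) ^ 2 * Real.sqrt d)) W δ B ≤ B ∧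
      B ≤ 3 ^ 10 * Real.sqrt d * Real.log (3 + d * H * K * (1 + W) / δ) ^ 2 := by
  have hHr : (1 : ℝ) ≤ H := by exact_mod_cast hH
  have hdr : (1 : ℝ) ≤ d := by exact_mod_cast hd
  have hKr : (1 : ℝ) ≤ K := by exact_mod_cast hK
  have hu1 : 1 ≤ δ⁻¹ := (one_le_inv₀ hδ).mpr hδ1.le
  have hq : (d : ℝ) ≤ d * H * K * (1 + W) / δ := by
    rw [div_eq_mul_inv]
    calc (d : ℝ) = d * 1 * 1 * 1 * 1 := by ring
      _ ≤ _ := by gcongr; linarith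
  set q : ℝ := d * H * K * (1 + W) / δ
  set x := Real.log (3 + q) with hx
  have hl3 : Real.log 3 ≤ x := Real.log_le_log (by norm_num) (by linarith)
  have hx0 : 0 ≤ x := one_lt_log_three.le.trans hl3 |>.trans' zero_le_one
  have hxz : x ≤ 3 + q := (Real.log_le_sub_one_of_pos (by linarith)).trans (by linarith)
  -- `log (1 + B)` is at most `10 log 3 + 3 x ≤ 13 x`, hence the radius is at most `124 · 14² √d x²`,
  -- and `124 · 14² ≤ 3 ^ 10 - 1`.
  obtain ⟨B, hB⟩ : ∃ B, B = (3 ^ 10 - 1) * Real.sqrt d * x ^ 2 := ⟨_, rfl⟩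
  have hB0 : 0 ≤ B := by rw [hB]; positivity
  have h1B : 1 + B ≤ 3 ^ 10 * (3 + q) ^ 3 := by
    have h1 : Real.sqrt d ≤ 3 + q := Real.sqrt_le_iff.mpr ⟨by linarith, by nlinarith⟩
    have h2 : Real.sqrt d * x ^ 2 ≤ (3 + q) ^ 3 := by
      calc Real.sqrt d * x ^ 2 ≤ (3 + q) * (3 + q) ^ 2 := by gcongr
        _ = (3 + q) ^ 3 := by ring
    have h3 : (1 : ℝ) ≤ (3 + q) ^ 3 := one_le_pow₀ (by linarith)
    rw [hB]
    nlinarith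
  have hlog : Real.log (3 + d * H * K * (1 + W) * (1 + B) / δ) ≤ 14 * x := by
    have e : 3 + d * H * K * (1 + W) * (1 + B) / δ = 3 + q * (1 + B) := by ring
    rw [e]
    calc Real.log (3 + q * (1 + B)) ≤ Real.log (3 ^ 10 * (3 + q) ^ 4) := by
          refine Real.log_le_log (by nlinarith) ?_
          calc 3 + q * (1 + B) ≤ (3 + q) * (1 + B) := by nlinarith
            _ ≤ (3 + q) * (3 ^ 10 * (3 + q) ^ 3) := by gcongr
            _ = _ := by ring
      _ = 10 * Real.log 3 + 4 * x := by
          rw [Real.log_mul (by positivity) (pow_ne_zero _ (by linarith)), Real.log_pow,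
            Real.log_pow, ← hx]
          norm_num
      _ ≤ 14 * x := by linarith
  refine ⟨B, (betaHat_le hd hH hK hW hδ hδ1 hB0).trans ?_, ?_⟩
  · have h0 : 0 ≤ Real.log (3 + d * H * K * (1 + W) * (1 + B) / δ) :=
      Real.log_nonneg (by have : 0 ≤ d * H * K * (1 + W) * (1 + B) / δ := by positivity
                          linarith)
    calc 124 * Real.sqrt d * Real.log (3 + d * H * K * (1 + W) * (1 + B) / δ) ^ 2
        ≤ 124 * Real.sqrt d * (14 * x) ^ 2 := by gcongr
      _ = 24304 * (Real.sqrt d * x ^ 2) := by ring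
      _ ≤ (3 ^ 10 - 1) * (Real.sqrt d * x ^ 2) := by gcongr; norm_num
      _ = B := by rw [hB]; ring
  · rw [hB]
    gcongr
    norm_num

end RadiusSize

end LinMDP

end

theorem lemma2 :
    -- the exploration radius is `Õ(√d)`
    (∃ C : ℝ, 0 < C ∧ ∀ (d H K : ℕ) (W δ : ℝ), 0 < d → 0 < H → 0 < K → 0 ≤ W → 0 < δ → δ < 1 →
      (∀ B : ℝ, 0 ≤ B →
        LinMDP.betaHat d H K (1 / ((H : ℝ) ^ 2 * Real.sqrt d)) W δ B ≤
          C * Real.sqrt d * Real.log (3 + d * H * K * (1 + W) * (1 + B) / δ) ^ 2) ∧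
      ∃ B : ℝ, LinMDP.betaHat d H K (1 / ((H : ℝ) ^ 2 * Real.sqrt d)) W δ B ≤ B ∧
        B ≤ C * Real.sqrt d * Real.log (3 + d * H * K * (1 + W) / δ) ^ 2) ∧
    -- the confidence sets and the variance bounds hold with probability at least `1 - 7δ`
    (∀ {S A Ω : Type*} [MeasurableSpace S] [MeasurableSpace A] [MeasurableSingletonClass A]
      [Fintype A] [Nonempty A] [MeasurableSpace Ω] (P : MeasureTheory.Measure Ω)
      [MeasureTheory.IsProbabilityMeasure P] (d H K : ℕ) (W lam δ Bhat Bchk : ℝ)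
      (M : LinMDP.LinearMDP S A d H W) (s : ℕ → ℕ → Ω → S) (a : ℕ → ℕ → Ω → A),
      0 < d → 0 < H → 0 < K → 1 / ((H : ℝ) ^ 2 * Real.sqrt d) ≤ lam → 0 < δ → δ < 1 →
      LinMDP.betaHat d H K lam W δ Bhat ≤ Bhat →
      LinMDP.betaChk d H K lam W δ Bchk ≤ Bchk →
      LinMDP.IsInteraction M (M.config K lam δ Bhat Bchk) P s a →
      ∃ G : Set Ω, MeasurableSet G ∧ ENNReal.ofReal (1 - 7 * δ) ≤ P G ∧
        ∀ ω ∈ G, ∀ k < K, ∀ h < H,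
          let c := M.config K lam δ Bhat Bchk
          let st := c.run (fun i l => s i l ω) (fun i l => a i l ω) k
          let Vhat := st.vHat c (h + 1)
          let Vchk := st.vChk c (h + 1)
          let Vstar := M.vStar (h + 1)
          let ζ := H * Real.sqrt lam / K
          (M.mu h ∈ st.confSet h Vhat (LinMDP.betaHat d H K lam W δ Bhat) ∧
            M.mu h ∈ st.confSet h Vchk (LinMDP.betaChk d H K lam W δ Bchk) ∧
            M.mu h ∈ st.confSet h Vstar (LinMDP.betaOne d H K lam δ) ∧
            M.mu h ∈ st.confSet h (fun x => Vhat x - Vstar x)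
              (LinMDP.betaTwo d H K lam W δ Bhat) ∧
            M.mu h ∈ st.confSet h Vhat (LinMDP.betaBar d H K lam W δ Bhat) ∧
            M.mu h ∈ st.confSet h (fun x => Vhat x ^ 2) (LinMDP.betaTil d H K lam W δ Bhat)) ∧
          |st.varHat c h (s k h ω) (a k h ω) - M.var h Vstar (s k h ω) (a k h ω)| ≤
            st.offU c h (s k h ω) (a k h ω) ∧
          M.var h (fun x => Vhat x - Vstar x) (s k h ω) (a k h ω) ≤
            st.offE c h (s k h ω) (a k h ω) ∧
          ∀ V : S → ℝ, Measurable V → (∀ x, 0 ≤ V x ∧ V x ≤ H) →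
            (∀ x, Vstar x - ζ ≤ V x ∧ V x ≤ Vhat x + ζ) →
            M.var h (fun x => V x - Vstar x) (s k h ω) (a k h ω) ≤
              st.offE c h (s k h ω) (a k h ω)) := by
  refine ⟨⟨3 ^ 10, by norm_num, fun d H K W δ hd hH hK hW hδ hδ1 => ⟨fun B hB => ?_,
    LinMDP.exists_betaHat_le hd hH hK hW hδ hδ1⟩⟩, ?_⟩
  · refine (LinMDP.betaHat_le hd hH hK hW hδ hδ1 hB).trans ?_
    gcongr
    norm_num
  · intro S A Ω _ _ _ _ _ _ P _ d H K W lam δ Bhat Bchk M s a hd hH hK hlam hδ hδ1 hBhat hBchk hI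
    have ht : LinMDP.IsTuned (c := M.config K lam δ Bhat Bchk) M δ Bhat Bchk :=
      ⟨rfl, rfl, hd, hH, hK, hlam, hδ, hδ1, rfl, rfl, rfl, rfl, hBhat, hBchk⟩
    obtain ⟨NB, NT, NC, hnet, G, hG, hGP, hGN⟩ := hI.exists_good_event ht
    refine ⟨G, hG, (ENNReal.ofReal_le_ofReal (by linarith)).trans hGP, fun ω hω k hk h hh => ?_⟩
    obtain ⟨hconf, henc⟩ := LinMDP.inConf_of_noiseBounds ht hnet (hGN ω hω) hk
    have hc := hconf h hh
    have he := henc (h + 1) hh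
    have hv := LinMDP.varBounds ht hh he hc
    refine ⟨⟨hc.hat, hc.chk, hc.one, hc.two, hc.bar, hc.til⟩, hv.offU _ _, ?_,
      fun V hV hVb hVz => hv.offE V hV hVb hVz _ _⟩
    have hζ : 0 ≤ LinMDP.zeta (M.config K lam δ Bhat Bchk) := ht.zeta_pos.le
    refine hv.offE _ (LinMDP.measurable_vHat_run M _ _ ht.phi ht.reward k (h + 1))
      (fun x => ⟨(he.bounds x).2.1, (he.bounds x).2.2.1⟩) (fun x => ⟨?_, ?_⟩) _ _
    · exact (sub_le_self _ hζ).trans (he x).1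
    · exact le_add_of_nonneg_right hζ
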